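/- **Problem.** Let $T\ge 3$. Let $\xi^1$ be deterministic and let $\xi^2,\dots,\xi^T$ be random, with $\xi^{t+1}$ drawn from its conditional law given the history $\xi^{[t]}=(\xi^1,\dots,\xi^t)$. For $t=1,\dots,T$ let $X^t$ be a nonempty compact convex subset of a finite-dimensional real normed space (norm $\|\cdot\|$, dual norm $\|\cdot\|_*$), $K^t\subseteq\mathbb R^{m_t}$ a closed convex cone with dual cone $K^t_*$ ($\mathbb R^{m_t}$ carries the Euclidean norm), and let the linear maps $A^t$, $B^t$, the vector $b^t$ and the convex lower semicontinuous function $h^t$ on $X^t$ be determined by the scenario, measurably where appropriate. For $t<T$ let $F^t$ be convex and Lipschitz continuous on $X^t$, with a computable subgradient $(F^t)'$, the Lipschitz constant and $\|(F^t)'\|_*$ being bounded uniformly in the scenario; also $\|B^t\|$ is essentially bounded. Put $v^{T+1}=0$ and, for $t=T,\dots,2$, $$V^t(u,\xi^{[t]})=\min\{h^t(x)+v^{t+1}(x):x\in X^t,\ A^tx-b^t-B^tu\in K^t\},\qquad v^t(u)=F^{t-1}(u)+\mathbb E\big[V^t(u,\xi^{[t]})\,\big|\,\xi^{[t-1]}\big],$$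 assumed well defined and finite for $u\in X^{t-1}$ ($F^{T-1}=0$ is allowed). The problem is $\min\{h^1(x)+v^2(x): x\in X^1,\ A^1x-b^1\in K^1\}$. Strong duality is assumed: almost surely, for all $u\in X^{t-1}$, the function $\langle b^t+B^tu-A^tx,y\rangle+h^t(x)+v^{t+1}(x)$ has a saddle point $(x^t_*,y^t_*)$ on $X^t\times K^t_*$ (minimum in $x$, maximum in $y$), with $y^t_*$ chosen measurably; likewise for $t=1$, without the term $B^tu$. Let $\omega_t$ be continuously differentiable and strongly convex with modulus $\alpha_t>0$ on $X^t$, $P_t(p,x)=\omega_t(x)-\omega_t(p)-\langle\nabla\omega_t(p),x-p\rangle$ and $\Omega_t^2=\max_{p,x\in X^t}P_t(p,x)$. **Algorithm.** Initial points $x_0^t\in X^t$, $y^t_{-1}=y_0^t\in\mathbb R^{m_t}$ are given. The procedure $\mathrm{DSA}(t,u)$ with current scenario does the following for $k=1,\dots,N_t$. If $t<T$, draw a new scenario $\xi^{t+1}$ given the history, let $(\bar x^{t+1},\bar y^{t+1})=\mathrm{DSA}(t+1,x^t_{k-1})$ for it and put $G=(F^t)'(x^t_{k-1})+(B^{t+1})^{\mathsf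 T}\bar y^{t+1}$; if $t=T$, put $G=0$. Then, with $\tilde y=\frac{w_{k-1}}{w_k}(y^t_{k-1}-y^t_{k-2})+y^t_{k-1}$, $$x_k^t\in\operatorname*{argmin}_{x\in X^t}\ \langle b^t+B^tu-A^tx,\tilde y\rangle+h^t(x)+\langle G,x\rangle+\tau_kP_t(x^t_{k-1},x),$$ $$y_k^t\in\operatorname*{argmin}_{y\in K_*^t}\ \langle A^tx_k^t-b^t-B^tu,y\rangle+\tfrac{\eta_k}2\|y-y^t_{k-1}\|^2,$$ where the minimizers are chosen measurably. It returns $(\bar x^t,\bar y^t)=\sum_kw_k(x^t_k,y^t_k)/\sum_kw_k$. The algorithm is $\mathrm{DSA}(1,\cdot)$, with $b^1$ in place of $b^1+B^1u$. Let $\varepsilon>0$, $M_{T+1}=0$ and $d_t=\|y^t_*-y^t_0\|$. Every $N_t$ below is the least positive integer at least as large as the stated expression (it may depend on the scenario and on $u$); $0/0$ and $c/0$ are read as $0$ in $\tau_k$. **(a) General convex case.** $w_k=1$. For $t=1$ and $t=T$: $\eta_k=\sqrt2\|A^t\|/\sqrt{\alpha_t}$ and $\tau_k=\max\{\frac{M_{t+1}\sqrt{3N_t}}{\Omega_t\sqrt{\alpha_t}},\frac{\sqrt2\|A^t\|}{\sqrt{\alpha_t}}\}$.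 For $1<t<T$: $\eta_k=\sqrt{2N_t}\|A^t\|/\sqrt{\alpha_t}$ and $\tau_k=\max\{\frac{M_{t+1}\sqrt{3N_t}}{\Omega_t\sqrt{\alpha_t}},\frac{\sqrt2\|A^t\|}{\sqrt{\alpha_tN_t}}\}$. Moreover $$N_T:\ \frac{T\sqrt2\|A^T\|(2\Omega_T^2+d_T^2)}{\sqrt{\alpha_T}\,\varepsilon},\qquad N_t:\ \Big(\frac{4\sqrt2T\|A^t\|\Omega_t^2}{\sqrt{\alpha_t}\,\varepsilon}\Big)^{2/3}+\Big[\frac{2T(\|A^t\|d_t^2+4\sqrt3M_{t+1}\Omega_t)}{\sqrt{\alpha_t}\,\varepsilon}\Big]^2\ (1<t<T),$$ $$N_1:\ \max\Big\{\tfrac{2\sqrt2T\|A^1\|(2\Omega_1^2+\|y^1_0\|^2)}{\sqrt{\alpha_1}\varepsilon}+\big(\tfrac{8\sqrt3TM_2\Omega_1}{\sqrt{\alpha_1}\varepsilon}\big)^2,\ \tfrac{6T\|A^1\|(\sqrt{2\alpha_1}d_1+2\Omega_1)+27(T-1)\sqrt{\alpha_1}\|A^1\|}{\alpha_1T\varepsilon}+\big(\tfrac{6\sqrt3M_2(\sqrt2\|A^1\|+\sqrt{\alpha_1})}{\alpha_1\varepsilon}\big)^2\Big\}.$$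 **(b) Strongly convex case.** Here it is assumed that there are $\mu_t>0$ with $h^t(x_1)-h^t(x_2)-\langle g,x_1-x_2\rangle\ge\mu_tP_t(x_2,x_1)$ for all $x_1,x_2\in X^t$ and every subgradient $g$ of $h^t$ at $x_2$, almost surely. $w_k=k$, $\tau_k=\frac{k-1}2\mu_t$; $\eta_k=\frac{4\|A^t\|^2}{k\alpha_t\mu_t}$ for $t\in\{1,T\}$ and $\eta_k=\frac{4\|A^t\|^2N_t}{k\alpha_t\mu_t}$ for $1<t<T$. Moreover $$N_T:\ \frac{\sqrt{8T}\|A^T\|d_T}{\sqrt{\alpha_T\mu_T\varepsilon}},\qquad N_t:\ \frac{8T\|A^t\|^2d_t^2+24TM_{t+1}^2}{\alpha_t\mu_t\varepsilon}\ (1<t<T),$$ $$N_1:\ \max\Big\{\tfrac{4\sqrt T\|A^1\|\|y_0^1\|}{\sqrt{\alpha_1\mu_1\varepsilon}}+\tfrac{24TM_2^2}{\alpha_1\mu_1\varepsilon},\ \tfrac{4\sqrt3\|A^1\|\sqrt{d_1}}{\sqrt{\alpha_1\mu_1\varepsilon}}+\big(\tfrac{24\sqrt6\|A^1\|M_2}{\alpha_1\mu_1\varepsilon}\big)^{2/3}+\tfrac{12\|A^1\|\sqrt{T-1}}{\sqrt{\alpha_1\mu_1T\varepsilon}}\Big\}.$$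 **The constants $M_t$.** Call $M_2,\dots,M_T\ge0$ *valid* if, for $t=2,\dots,T$ and almost surely in $\xi^{[t-1]}$, $v^t$ is $M_t$-Lipschitz on $X^{t-1}$ and, for every $u\in X^{t-1}$, the stochastic subgradient $G=(F^{t-1})'(u)+(B^t)^{\mathsf T}\bar y^t$ obtained by drawing $\xi^t$ and running $\mathrm{DSA}(t,u)$ satisfies $\mathbb E[\|G\|_*^2\mid\xi^{[t-1]}]\le M_t^2$. **Theorem.** In each of the cases (a) and (b): (i) If $\|A^t\|$ is essentially bounded away from $0$ and $\|y^t_*\|$ is essentially bounded, uniformly over $u\in X^{t-1}$, for $t=2,\dots,T$, then valid constants $M_2,\dots,M_T$ exist. (ii) For any valid constants $M_2,\dots,M_T$, the algorithm with the above parameters returns a random $\bar x^1\in X^1$ for which there is a random vector $\delta\in\mathbb R^{m_1}$ such that, for every optimal solution $x^*$ of the problem, $$\mathbb E\big[h^1(\bar x^1)+v^2(\bar x^1)-(h^1(x^*)+v^2(x^*))\big]\le\varepsilon,\qquad A^1\bar x^1-b^1-\delta\in K^1\ \text{a.s.},\qquad \mathbb E\|\delta\|\le\varepsilon .$$ -/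

import Mathlib

open MeasureTheory ProbabilityTheory

noncomputable section

namespace DSA

/-- `ℝ^{m_t}` with the Euclidean norm: the space of the conic constraint and of the dual variable
of stage `t`. -/
abbrev Y (m : ℕ → ℕ) (t : ℕ) : Type := EuclideanSpace ℝ (Fin (m t))

/-- `x` minimizes `f` over `C`. -/
def IsArgmin {β : Type*} (f : β → ℝ) (C : Set β) (x : β) : Prop :=
  x ∈ C ∧ ∀ z ∈ C, f x ≤ f z

/-- The data of a `T`-stage problem. A point of `S t` is the history `(ξ¹, …, ξᵗ)` of the scenario
up to stage `t`, so that every datum of stage `t` is a function on `S t`. The space `E t` carries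
the decision `xᵗ` (a finite dimensional space with an arbitrary norm). Only the indices
`1 ≤ t ≤ T` are used. -/
structure Problem (S : ℕ → Type*) [∀ t, MeasurableSpace (S t)]
    (E : ℕ → Type*) [∀ t, NormedAddCommGroup (E t)] [∀ t, NormedSpace ℝ (E t)]
    (m : ℕ → ℕ) where
  /-- number of stages -/
  T : ℕ
  /-- the (deterministic) data of the first stage -/
  root : S 1
  /-- conditional law of the history up to stage `t + 1` given the history up to stage `t` -/
  κ : ∀ t, Kernel (S t) (S (t + 1))
  /-- `Xᵗ` -/
  X : ∀ t, Set (E t)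
  /-- the closed convex cone `Kᵗ` -/
  K : ∀ t, ProperCone ℝ (Y m t)
  /-- `Aᵗ` -/
  A : ∀ t, S t → E t →L[ℝ] Y m t
  /-- `bᵗ` -/
  b : ∀ t, S t → Y m t
  /-- `B t` is the operator `B^{t+1}`, which maps `xᵗ` into the constraint of stage `t + 1` -/
  B : ∀ t, S (t + 1) → E t →L[ℝ] Y m (t + 1)
  /-- `hᵗ(·, cᵗ)` -/
  h : ∀ t, S t → E t → ℝ
  /-- `Fᵗ(·, pᵗ)` -/
  F : ∀ t, S t → E t → ℝ
  /-- the subgradient of `Fᵗ(·, pᵗ)` that is computed -/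
  F' : ∀ t, S t → E t → (E t →L[ℝ] ℝ)
  /-- the distance generating function of `Xᵗ` -/
  ω : ∀ t, E t → ℝ
  /-- its derivative -/
  ω' : ∀ t, E t → (E t →L[ℝ] ℝ)
  /-- its modulus of strong convexity `α_t` -/
  α : ℕ → ℝ

/-- What the method is given besides the problem: initial points, minimizers computed in the primal
and dual steps, and the dual solutions that enter the iteration counts. -/
structure Method (S : ℕ → Type*) (E : ℕ → Type*) [∀ t, NormedAddCommGroup (E t)]
    [∀ t, NormedSpace ℝ (E t)] (m : ℕ → ℕ) where
  /-- `x₀ᵗ` -/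
  x0 : ∀ t, E t
  /-- `y₀ᵗ` (and also `y₋₁ᵗ`) -/
  y0 : ∀ t, Y m t
  /-- the primal step: `(ξ, b + B u, p, d̃, G, τ) ↦ p₊` -/
  prox : ∀ t, S t × Y m t × E t × Y m t × (E t →L[ℝ] ℝ) × ℝ → E t
  /-- the dual step: `(ξ, b + B u, p₊, d, η) ↦ d₊` -/
  dual : ∀ t, S t × Y m t × E t × Y m t × ℝ → Y m t
  /-- `y_*ᵗ`, as a function of the scenario and of the right-hand side `b + B u` -/
  ystar : ∀ t, S t × Y m t → Y m t

/-- Parameters of the method: iteration counts `N_t` and step sizes `w_k, τ_k, η_k` of stage `t`,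
which may depend on the scenario and on the right-hand side `b + B u`. -/
structure Params (S : ℕ → Type*) (m : ℕ → ℕ) where
  N : ∀ t, S t → Y m t → ℕ
  w : ∀ t, S t → Y m t → ℕ → ℝ
  τ : ∀ t, S t → Y m t → ℕ → ℝ
  η : ∀ t, S t → Y m t → ℕ → ℝ

/-- Current state of the loop of one stage: `(x_k, y_k, y_{k-1}, ∑_{i≤k} w_i x_i, ∑_{i≤k} w_i y_i)`. -/
abbrev State (E : ℕ → Type*) (m : ℕ → ℕ) (t : ℕ) : Type _ :=
  E t × Y m t × Y m t × E t × Y m t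

/-- Law of the state after `n` steps of a Markov chain started at `init`; `step k` is the law of
the `k`-th transition, `k ≥ 1`. -/
def iterateLaw {σ : Type*} [MeasurableSpace σ] (step : ℕ → σ → Measure σ) (init : σ) :
    ℕ → Measure σ
  | 0 => Measure.dirac init
  | k + 1 => (iterateLaw step init k).bind (step (k + 1))

variable {S : ℕ → Type*} [∀ t, MeasurableSpace (S t)]
  {E : ℕ → Type*} [∀ t, NormedAddCommGroup (E t)] [∀ t, NormedSpace ℝ (E t)]
  {m : ℕ → ℕ}

namespace Problem

variable (P : Problem S E m)

/-- Law of the history up to stage `t`. -/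
def law : ∀ t, Measure (S t)
  | 0 => 0
  | 1 => Measure.dirac P.root
  | t + 2 => (law (t + 1)).bind (P.κ (t + 1))

/-- The dual cone `K_*ᵗ`. -/
def Kdual (t : ℕ) : Set (Y m t) :=
  (ProperCone.innerDual (P.K t : Set (Y m t)) : Set (Y m t))

/-- The prox-function `P_X(p, x)` of `Xᵗ`. -/
def bregman (t : ℕ) (p x : E t) : ℝ := P.ω t x - P.ω t p - P.ω' t p (x - p)

/-- `Ω_t`, where `Ω_t² = max {P_X(p, x) : p, x ∈ Xᵗ}`. -/
def Ω (t : ℕ) : ℝ :=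
  Real.sqrt (sSup {r | ∃ p ∈ P.X t, ∃ x ∈ P.X t, r = P.bregman t p x})

/-- Right-hand side `b^{t+1} + B^{t+1} x` of stage `t + 1` at the decision `x` of stage `t`. -/
def rhs (t : ℕ) (s' : S (t + 1)) (x : E t) : Y m (t + 1) := P.b (t + 1) s' + P.B t s' x

/-- Feasible set of stage `t` with right-hand side `q`. -/
def feasible (t : ℕ) (s : S t) (q : Y m t) : Set (E t) :=
  {x | x ∈ P.X t ∧ P.A t s x - q ∈ P.K t}

/-- The value function `v^{t+1}` of the stages that follow stage `t`, when there are `r` of them. -/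
def costToGo : ℕ → ∀ t, S t → E t → ℝ
  | 0, _ => fun _ _ => 0
  | r + 1, t => fun s x => P.F t s x +
      ∫ s', sInf ((fun x' => P.h (t + 1) s' x' + costToGo r (t + 1) s' x') ''
        P.feasible (t + 1) s' (P.rhs t s' x)) ∂(P.κ t s)

/-- `v t s` is the value function `v^{t+1}`, a function of the decision `xᵗ` (and of the history
`s` up to stage `t`); it vanishes for `t = T`. -/
def v (t : ℕ) (s : S t) (x : E t) : ℝ := P.costToGo (P.T - t) t s x

/-- The stochastic value function `Vᵗ` of stage `t`, as a function of the scenario and of the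
right-hand side `q = bᵗ + Bᵗ x^{t-1}`. -/
def V (t : ℕ) (s : S t) (q : Y m t) : ℝ :=
  sInf ((fun x => P.h t s x + P.v t s x) '' P.feasible t s q)

/-- `⟨q - A x, y⟩ + h(x) + v(x)`. -/
def lagrangian (t : ℕ) (s : S t) (q : Y m t) (x : E t) (y : Y m t) : ℝ :=
  inner ℝ (q - P.A t s x) y + P.h t s x + P.v t s x

/-- `(x, y)` is a saddle point on `Xᵗ × K_*ᵗ` of the stage problem. -/
def IsSaddle (t : ℕ) (s : S t) (q : Y m t) (x : E t) (y : Y m t) : Prop :=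
  x ∈ P.X t ∧ y ∈ P.Kdual t ∧
    (∀ y' ∈ P.Kdual t, P.lagrangian t s q x y' ≤ P.lagrangian t s q x y) ∧
    ∀ x' ∈ P.X t, P.lagrangian t s q x y ≤ P.lagrangian t s q x' y

/-- Standing assumptions on the problem. -/
structure Regular [∀ t, MeasurableSpace (E t)] : Prop where
  markov : ∀ t, 1 ≤ t → t < P.T → IsMarkovKernel (P.κ t)
  meas_A : ∀ t, 1 ≤ t → t ≤ P.T → Measurable (P.A t)
  meas_b : ∀ t, 1 ≤ t → t ≤ P.T → Measurable (P.b t)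
  meas_B : ∀ t, 1 ≤ t → t < P.T → Measurable (P.B t)
  meas_F' : ∀ t, 1 ≤ t → t < P.T → Measurable (fun z : S t × E t => P.F' t z.1 z.2)
  X_nonempty : ∀ t, 1 ≤ t → t ≤ P.T → (P.X t).Nonempty
  X_compact : ∀ t, 1 ≤ t → t ≤ P.T → IsCompact (P.X t)
  X_convex : ∀ t, 1 ≤ t → t ≤ P.T → Convex ℝ (P.X t)
  α_pos : ∀ t, 1 ≤ t → t ≤ P.T → 0 < P.α t
  ω_deriv : ∀ t, 1 ≤ t → t ≤ P.T → ∀ x ∈ P.X t,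
    HasFDerivWithinAt (P.ω t) (P.ω' t x) (P.X t) x
  ω'_cont : ∀ t, 1 ≤ t → t ≤ P.T → ContinuousOn (P.ω' t) (P.X t)
  ω_strong : ∀ t, 1 ≤ t → t ≤ P.T → StrongConvexOn (P.X t) (P.α t) (P.ω t)
  h_convex : ∀ t, 1 ≤ t → t ≤ P.T → ∀ᵐ s ∂(P.law t), ConvexOn ℝ (P.X t) (P.h t s)
  h_closed : ∀ t, 1 ≤ t → t ≤ P.T → ∀ᵐ s ∂(P.law t), LowerSemicontinuousOn (P.h t s) (P.X t)
  /-- `Fᵗ(·, pᵗ)` is convex and Lipschitz continuous, with bounded computable subgradients. -/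
  F_lipschitz : ∀ t, 1 ≤ t → t < P.T → ∃ L : ℝ, ∀ᵐ s ∂(P.law t),
    ConvexOn ℝ (P.X t) (P.F t s) ∧
    ∀ x ∈ P.X t, ‖P.F' t s x‖ ≤ L ∧
      ∀ x' ∈ P.X t, |P.F t s x' - P.F t s x| ≤ L * ‖x' - x‖ ∧
        P.F t s x + P.F' t s x (x' - x) ≤ P.F t s x'
  B_bounded : ∀ t, 1 ≤ t → t < P.T → ∃ C : ℝ, ∀ᵐ s' ∂(P.law (t + 1)), ‖P.B t s'‖ ≤ C
  /-- the value functions are well defined and finite -/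
  v_finite : ∀ t, 1 ≤ t → t < P.T → ∀ᵐ s ∂(P.law t), ∀ x ∈ P.X t,
    Integrable (fun s' => P.V (t + 1) s' (P.rhs t s' x)) (P.κ t s)

/-- Strong convexity of the stage objectives with moduli `μ_t`, relative to the prox-function:
`h(x₁) - h(x₂) - ⟨h'(x₂), x₁ - x₂⟩ ≥ μ_t P_X(x₂, x₁)` for every subgradient `h'(x₂)`. -/
def StronglyConvex (μ : ℕ → ℝ) : Prop :=
  ∀ t, 1 ≤ t → t ≤ P.T → 0 < μ t ∧ ∀ᵐ s ∂(P.law t), ∀ x₂ ∈ P.X t, ∀ g : E t →L[ℝ] ℝ,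
    (∀ x ∈ P.X t, P.h t s x₂ + g (x - x₂) ≤ P.h t s x) →
    ∀ x₁ ∈ P.X t, μ t * P.bregman t x₂ x₁ ≤ P.h t s x₁ - P.h t s x₂ - g (x₁ - x₂)

/-- The method is a method for `P`: the initial points are feasible, the primal and dual steps
return minimizers, `ystar` is a measurable choice of dual solutions (so that strong duality holds,
almost surely, at every stage), and everything is measurable. The minimum of the dual step is
attained whenever `η > 0`. -/
structure Admissible [∀ t, MeasurableSpace (E t)] (Q : Method S E m) : Prop where
  x0_mem : ∀ t, 1 ≤ t → t ≤ P.T → Q.x0 t ∈ P.X t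
  meas_prox : ∀ t, 1 ≤ t → t ≤ P.T → Measurable (Q.prox t)
  meas_dual : ∀ t, 1 ≤ t → t ≤ P.T → Measurable (Q.dual t)
  meas_ystar : ∀ t, 1 ≤ t → t ≤ P.T → Measurable (Q.ystar t)
  prox_spec : ∀ t, 1 ≤ t → t ≤ P.T → ∀ᵐ s ∂(P.law t), ∀ (q : Y m t), ∀ p ∈ P.X t,
    ∀ (d : Y m t) (G : E t →L[ℝ] ℝ) (τ : ℝ), 0 ≤ τ →
      IsArgmin (fun x => inner ℝ (q - P.A t s x) d + P.h t s x + G x + τ * P.bregman t p x)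
        (P.X t) (Q.prox t (s, q, p, d, G, τ))
  dual_spec : ∀ t, 1 ≤ t → t ≤ P.T → ∀ᵐ s ∂(P.law t), ∀ (q : Y m t), ∀ p ∈ P.X t,
    ∀ (d : Y m t) (η : ℝ), 0 ≤ η →
      (∃ y, IsArgmin (fun y => inner ℝ (P.A t s p - q) y + η / 2 * ‖y - d‖ ^ 2) (P.Kdual t) y) →
      IsArgmin (fun y => inner ℝ (P.A t s p - q) y + η / 2 * ‖y - d‖ ^ 2)
        (P.Kdual t) (Q.dual t (s, q, p, d, η))
  ystar_first : ∃ x, P.IsSaddle 1 P.root (P.b 1 P.root) x (Q.ystar 1 (P.root, P.b 1 P.root))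
  ystar_spec : ∀ t, 1 ≤ t → t < P.T → ∀ᵐ s' ∂(P.law (t + 1)), ∀ u ∈ P.X t,
    ∃ x, P.IsSaddle (t + 1) s' (P.rhs t s' u) x (Q.ystar (t + 1) (s', P.rhs t s' u))

/-- The norms of `Aᵗ`, `t = 2, …, T`, are bounded away from zero and the dual solutions of these
stages are bounded. -/
def BoundedDuals (Q : Method S E m) : Prop :=
  ∀ t, 1 ≤ t → t < P.T → ∃ a > 0, ∃ D : ℝ, ∀ᵐ s' ∂(P.law (t + 1)),
    a ≤ ‖P.A (t + 1) s'‖ ∧ ∀ u ∈ P.X t, ‖Q.ystar (t + 1) (s', P.rhs t s' u)‖ ≤ D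

end Problem

variable [∀ t, MeasurableSpace (E t)]

/-- The `k`-th stochastic primal-dual transformation of stage `t`, with scenario `s`, right-hand
side `q` and stochastic subgradient `G`; the extrapolation parameter is `θ_k = w_{k-1} / w_k`. -/
def spdt (Q : Method S E m) (par : Params S m) (t : ℕ) (s : S t) (q : Y m t) (k : ℕ)
    (st : State E m t) (G : E t →L[ℝ] ℝ) : State E m t :=
  let x := st.1
  let y := st.2.1
  let yprev := st.2.2.1
  let ytilde := (par.w t s q (k - 1) / par.w t s q k) • (y - yprev) + y
  let xnew := Q.prox t (s, q, x, ytilde, G, par.τ t s q k)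
  let ynew := Q.dual t (s, q, xnew, y, par.η t s q k)
  (xnew, ynew, y, st.2.2.2.1 + par.w t s q k • xnew, st.2.2.2.2 + par.w t s q k • ynew)

/-- The initial state of the loop of stage `t`. -/
def initState (Q : Method S E m) (t : ℕ) : State E m t := (Q.x0 t, Q.y0 t, Q.y0 t, 0, 0)

/-- `x̄ᵗ`, read off from the final state of the loop. -/
def xbar (par : Params S m) (t : ℕ) (s : S t) (q : Y m t) (st : State E m t) : E t :=
  (∑ k ∈ Finset.Icc 1 (par.N t s q), par.w t s q k)⁻¹ • st.2.2.2.1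

/-- `ȳᵗ`, read off from the final state of the loop. -/
def ybar (par : Params S m) (t : ℕ) (s : S t) (q : Y m t) (st : State E m t) : Y m t :=
  (∑ k ∈ Finset.Icc 1 (par.N t s q), par.w t s q k)⁻¹ • st.2.2.2.2

/-- The stochastic subgradient of `v^{t+1}` at `x`: the computed subgradient of `Fᵗ(·, pᵗ)` plus
`(B^{t+1})ᵀ ȳ^{t+1}`, where `ȳ^{t+1}` comes from the final state `st` of a run of stage `t + 1`
with scenario `s'`. -/
def stochGrad (P : Problem S E m) (par : Params S m) (t : ℕ) (s : S t) (x : E t)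
    (s' : S (t + 1)) (st : State E m (t + 1)) : E t →L[ℝ] ℝ :=
  P.F' t s x + (innerSL ℝ (ybar par (t + 1) s' (P.rhs t s' x) st)).comp (P.B t s')

/-- Law of the final state of the recursive procedure for stage `t` with scenario `s` and
right-hand side `q = bᵗ + Bᵗ u`, when `r` stages follow stage `t`. In the `k`-th iteration the
procedure draws a scenario `s'` of stage `t + 1` given `s`, calls itself for stage `t + 1` with
`u = x_{k-1}ᵗ`, and performs one primal-dual transformation. -/
def run (P : Problem S E m) (Q : Method S E m) (par : Params S m) :
    ℕ → ∀ t, S t → Y m t → Measure (State E m t)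
  | 0, t => fun s q =>
      iterateLaw (fun k st => Measure.dirac (spdt Q par t s q k st 0)) (initState Q t)
        (par.N t s q)
  | r + 1, t => fun s q =>
      iterateLaw (fun k st =>
          (P.κ t s).bind fun s' =>
            (run P Q par r (t + 1) s' (P.rhs t s' st.1)).bind fun st' =>
              Measure.dirac (spdt Q par t s q k st (stochGrad P par t s st.1 s' st')))
        (initState Q t) (par.N t s q)

/-- `M t`, `2 ≤ t ≤ T`, are constants such that `vᵗ` is `M t`-Lipschitz on `X^{t-1}` and such that
the stochastic subgradients of `vᵗ` that the procedure returns have second moment at most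
`(M t)²`. -/
def ValidConstants (P : Problem S E m) (Q : Method S E m) (par : Params S m) (M : ℕ → ℝ) : Prop :=
  ∀ t, 1 ≤ t → t < P.T → 0 ≤ M (t + 1) ∧ ∀ᵐ s ∂(P.law t), ∀ x ∈ P.X t,
    (∀ x' ∈ P.X t, |P.v t s x' - P.v t s x| ≤ M (t + 1) * ‖x' - x‖) ∧
    ∫⁻ s', ∫⁻ st, ‖stochGrad P par t s x s' st‖ₑ ^ 2
        ∂(run P Q par (P.T - (t + 1)) (t + 1) s' (P.rhs t s' x)) ∂(P.κ t s)
      ≤ ENNReal.ofReal (M (t + 1) ^ 2)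

/-- Parameters for general convex objectives: iteration counts (rounded up to positive integers)
and step sizes of the outer loop (`t = 1`), the middle loops (`1 < t < T`) and the innermost loop
(`t = T`). -/
def convexParams (P : Problem S E m) (Q : Method S E m) (ε : ℝ) (M : ℕ → ℝ) : Params S m :=
  let nA : ∀ t, S t → ℝ := fun t s => ‖P.A t s‖
  let dist : ∀ t, S t → Y m t → ℝ := fun t s q => ‖Q.ystar t (s, q) - Q.y0 t‖
  let T : ℝ := P.T
  let N : ∀ t, S t → Y m t → ℕ := fun t s q =>
    max 1 ⌈if t = 1 then
        max
          (2 * √2 * T * nA t s * (2 * P.Ω t ^ 2 + ‖Q.y0 t‖ ^ 2) / (√(P.α t) * ε)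
            + (8 * √3 * T * M 2 * P.Ω t / (√(P.α t) * ε)) ^ 2)
          ((6 * T * nA t s * (√(2 * P.α t) * dist t s q + 2 * P.Ω t)
                + 27 * (T - 1) * √(P.α t) * nA t s) / (P.α t * T * ε)
            + (6 * √3 * M 2 * (√2 * nA t s + √(P.α t)) / (P.α t * ε)) ^ 2)
      else if t < P.T then
        (4 * √2 * T * nA t s * P.Ω t ^ 2 / (√(P.α t) * ε)) ^ (2 / 3 : ℝ)
          + (2 * T * (nA t s * dist t s q ^ 2 + 4 * √3 * M (t + 1) * P.Ω t)
              / (√(P.α t) * ε)) ^ 2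
      else
        T * √2 * nA t s * (2 * P.Ω t ^ 2 + dist t s q ^ 2) / (√(P.α t) * ε)⌉₊
  { N := N
    w := fun _ _ _ _ => 1
    τ := fun t s q _ =>
      if t = 1 then
        max (M 2 * √(3 * N t s q) / (P.Ω t * √(P.α t))) (√2 * nA t s / √(P.α t))
      else if t < P.T then
        max (M (t + 1) * √(3 * N t s q) / (P.Ω t * √(P.α t)))
          (√2 * nA t s / √(P.α t * N t s q))
      else √2 * nA t s / √(P.α t)
    η := fun t s q _ =>
      if 1 < t ∧ t < P.T then √(2 * N t s q) * nA t s / √(P.α t)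
      else √2 * nA t s / √(P.α t) }

/-- Parameters for strongly convex objectives with moduli `μ`. -/
def strongParams (P : Problem S E m) (Q : Method S E m) (μ : ℕ → ℝ) (ε : ℝ) (M : ℕ → ℝ) :
    Params S m :=
  let nA : ∀ t, S t → ℝ := fun t s => ‖P.A t s‖
  let dist : ∀ t, S t → Y m t → ℝ := fun t s q => ‖Q.ystar t (s, q) - Q.y0 t‖
  let T : ℝ := P.T
  let N : ∀ t, S t → Y m t → ℕ := fun t s q =>
    max 1 ⌈if t = 1 then
        max
          (4 * √T * nA t s * ‖Q.y0 t‖ / √(P.α t * μ t * ε)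
            + 24 * T * M 2 ^ 2 / (P.α t * μ t * ε))
          (4 * √3 * nA t s * √(dist t s q) / √(P.α t * μ t * ε)
            + (24 * √6 * nA t s * M 2 / (P.α t * μ t * ε)) ^ (2 / 3 : ℝ)
            + 12 * nA t s * √(T - 1) / √(P.α t * μ t * T * ε))
      else if t < P.T then
        (8 * T * nA t s ^ 2 * dist t s q ^ 2 + 24 * T * M (t + 1) ^ 2) / (P.α t * μ t * ε)
      else
        √(8 * T) * nA t s * dist t s q / √(P.α t * μ t * ε)⌉₊
  { N := N
    w := fun _ _ _ k => k
    τ := fun t _ _ k => ((k : ℝ) - 1) / 2 * μ t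
    η := fun t s q k =>
      if 1 < t ∧ t < P.T then 4 * nA t s ^ 2 * N t s q / (k * P.α t * μ t)
      else 4 * nA t s ^ 2 / (k * P.α t * μ t) }

/-- The output of the whole procedure, started for the first stage, is an `ε`-solution in
expectation: its law is a probability measure, under which `x̄¹ ∈ X¹` almost surely, and there is a
random vector `δ` with `A¹ x̄¹ - b¹ - δ ∈ K¹` almost surely such that the expected optimality gap
and the expected norm of `δ` are at most `ε`. -/
def FindsSolution (P : Problem S E m) (Q : Method S E m) (par : Params S m) (ε : ℝ) : Prop :=
  let s := P.root
  let q := P.b 1 s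
  let out : Measure (State E m 1) := run P Q par (P.T - 1) 1 s q
  let xb : State E m 1 → E 1 := xbar par 1 s q
  let obj : E 1 → ℝ := fun x => P.h 1 s x + P.v 1 s x
  IsProbabilityMeasure out ∧ (∀ᵐ st ∂out, xb st ∈ P.X 1) ∧
    Integrable (fun st => obj (xb st)) out ∧
    (∀ xopt, IsArgmin obj (P.feasible 1 s q) xopt → ∫ st, (obj (xb st) - obj xopt) ∂out ≤ ε) ∧
    ∃ δ : State E m 1 → Y m 1, Measurable δ ∧
      (∀ᵐ st ∂out, P.A 1 s (xb st) - q - δ st ∈ P.K 1) ∧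
      Integrable δ out ∧ ∫ st, ‖δ st‖ ∂out ≤ ε

end DSA

end

/-! ### First-order optimality conditions for the primal and the dual step. -/

noncomputable section

namespace DSA

section Generic

variable {E F : Type*} [NormedAddCommGroup E] [NormedSpace ℝ E]
  [NormedAddCommGroup F] [InnerProductSpace ℝ F]

/-! A stage with right-hand side `q` is a saddle point problem for the Lagrangian `L(x, y) = ⟨q - A
x, y⟩ + h(x) + v(x)`. The recursion rests on weak duality: for any feasible dual point `ȳ`, the
quantity `V(q) + ⟨q' - q, ȳ⟩ - V(q')` is at most the gap `L(x̄, y_*) - L(x', ȳ)`, where `x'` solves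
the problem with right-hand side `q'` (`IsSaddle.V_add_inner_le`). Hence an expected gap of at most
`e` at stage `t + 1` makes `F' + Bᵀ ȳ` an `e`-inexact subgradient of `v^{t+1}` in expectation
(`inexact_subgradient`). The comparator `(x', y_*)` does not depend on the run of the inner loop, so
gaps are needed only against fixed pairs and no supremum is taken inside an expectation.

One loop is analysed with a potential consisting of the weighted gap, a Bregman term, a quadratic
dual term and a bilinear coupling term. The extrapolation makes the coupling terms telescope
(`IsStep.pot_le`), because the step sizes keep `w_k η_k = H` constant. After `N` steps with total
weight `W`, against a fixed comparator `(x, y)` (`integral_wgap_le`), `W E[gap] + H/2 E‖y - y_N‖² ≤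
λ₀ P(x₀, x) + H/2 ‖y - y₀‖² + errors + W e`. The iteration counts keep the first three terms on the
right below `W ε/T`. By backward induction the gap of stage `t ≥ 2` is therefore at most `(T - t +
1) ε/T` (`ae_gapBound`).

At the first stage two comparators are used. The pair `(x^*, 0)` gives the objective gap. For a
saddle point the gap is nonnegative and can be dropped, which bounds `E‖y_* - y_N‖²`. The optimality
conditions of the dual steps add up to `A x̄ - q + (H/W)(y_N - y₀) ∈ K`, so `δ = (H/W)(y₀ - y_N)` is
a residual with small expected norm (`findsSolution_of_fits`).

Valid constants exist because the saddle point estimate, used after every number of steps, bounds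
the second moments of all dual iterates and hence of `ȳ`, while bounded dual solutions make `v`
Lipschitz. The parameters of a stage `t > 1` involve only the constant `M_{t+1}`, so the constants
can be chosen from the last stage backwards (`exists_validConstants`).

With strong convexity the first step has `τ_1 = 0`, and no prox term absorbs its error. A debt `b_k
‖x - x_k‖²` is then carried through the potential and repaid by the Bregman term (`fits_of_linear`).
-/

theorem nonneg_of_forall_quadratic {c e : ℝ}
    (H : ∀ l : ℝ, 0 < l → l ≤ 1 → 0 ≤ l * c + l ^ 2 * e) : 0 ≤ c := by
  by_contra! hc
  set l := min 1 (-c / (2 * (|e| + 1))) with hl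
  have he := abs_nonneg e
  have h2 : 0 < -c / (2 * (|e| + 1)) := div_pos (by linarith) (by linarith)
  have hl0 : 0 < l := lt_min one_pos h2
  have h := H l hl0 (min_le_left _ _)
  have hle : l * (2 * (|e| + 1)) ≤ -c := by
    rw [← le_div_iff₀ (by linarith)]; exact min_le_right _ _
  have h3 : 0 ≤ c + l * e := by
    have : 0 ≤ l * (c + l * e) := by linarith [h, show l * (c + l * e) = l * c + l ^ 2 * e by ring]
    exact nonneg_of_mul_nonneg_right this hl0
  nlinarith [le_abs_self e, mul_le_mul_of_nonneg_left (le_abs_self e) hl0.le]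

/-- The derivative is known only within `X`, so the one-sided slope at `l = 0` along the segment
from `p` to `x` is used; convexity keeps the segment in `X`, and the quadratic term disappears in
the limit. -/
theorem le_fderivWithin_of_segment {f : E → ℝ} {f' : E →L[ℝ] ℝ} {X : Set E} {p x : E} {c e : ℝ}
    (hX : Convex ℝ X) (hp : p ∈ X) (hx : x ∈ X) (hf : HasFDerivWithinAt f f' X p)
    (H : ∀ l : ℝ, 0 < l → l ≤ 1 → l * c - l ^ 2 * e ≤ f (p + l • (x - p)) - f p) :
    c ≤ f' (x - p) := by
  have hmaps : Set.MapsTo (fun l : ℝ => p + l • (x - p)) (Set.Icc 0 1) X := fun l hl =>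
    hX.add_smul_sub_mem hp hx hl
  have hlin : HasDerivWithinAt (fun l : ℝ => p + l • (x - p)) (x - p) (Set.Icc 0 1) 0 := by
    have := ((hasDerivAt_id (0 : ℝ)).smul_const (x - p)).const_add p
    simpa using this.hasDerivWithinAt
  have hf0 : HasFDerivWithinAt f f' X ((fun l : ℝ => p + l • (x - p)) 0) := by simpa using hf
  have hd : HasDerivWithinAt (fun l : ℝ => f (p + l • (x - p))) (f' (x - p)) (Set.Icc 0 1) 0 :=
    hf0.comp_hasDerivWithinAt 0 hlin hmaps
  rw [hasDerivWithinAt_iff_tendsto_slope] at hd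
  have hsub : Set.Icc (0 : ℝ) 1 \ {0} = Set.Ioc 0 1 := by
    ext l; simp only [Set.mem_sdiff, Set.mem_Icc, Set.mem_singleton_iff, Set.mem_Ioc]
    constructor
    · rintro ⟨⟨h1, h2⟩, h3⟩; exact ⟨lt_of_le_of_ne h1 (Ne.symm h3), h2⟩
    · rintro ⟨h1, h2⟩; exact ⟨⟨h1.le, h2⟩, h1.ne'⟩
  rw [hsub, nhdsWithin_Ioc_eq_nhdsGT one_pos] at hd
  have hc : Filter.Tendsto (fun l : ℝ => c - l * e) (nhdsWithin 0 (Set.Ioi 0)) (nhds c) := by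
    have : Filter.Tendsto (fun l : ℝ => c - l * e) (nhds 0) (nhds (c - 0 * e)) := by
      apply Continuous.tendsto; fun_prop
    simp only [zero_mul, sub_zero] at this
    exact this.mono_left nhdsWithin_le_nhds
  refine le_of_tendsto_of_tendsto hc hd ?_
  have hIoc : Set.Ioc (0 : ℝ) 1 ∈ nhdsWithin (0 : ℝ) (Set.Ioi 0) :=
    Ioc_mem_nhdsGT one_pos
  filter_upwards [hIoc] with l hl
  have h := H l hl.1 hl.2
  simp only [slope_def_field, sub_zero, zero_smul, add_zero]
  rw [le_div_iff₀ hl.1]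
  nlinarith

/-- The Bregman divergence of `ω`, with derivative `ω'`. -/
def breg (ω : E → ℝ) (ω' : E → E →L[ℝ] ℝ) (p x : E) : ℝ := ω x - ω p - ω' p (x - p)

theorem breg_three_point (ω : E → ℝ) (ω' : E → E →L[ℝ] ℝ) (p x z : E) :
    (ω' z - ω' p) (x - z) = breg ω ω' p x - breg ω ω' z x - breg ω ω' p z := by
  have : ω' p (x - p) = ω' p (x - z) + ω' p (z - p) := by
    rw [← map_add]; congr 1; abel
  simp only [breg, sub_apply, this]; ring

theorem le_breg {ω : E → ℝ} {ω' : E → E →L[ℝ] ℝ} {X : Set E} {α : ℝ} {p x : E}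
    (hX : Convex ℝ X) (hp : p ∈ X) (hx : x ∈ X) (hd : HasFDerivWithinAt ω (ω' p) X p)
    (hs : StrongConvexOn X α ω) : α / 2 * ‖x - p‖ ^ 2 ≤ breg ω ω' p x := by
  -- Derivatives are bounded from below along segments, hence the passage to `-ω`. The modulus in
  -- the strong convexity inequality enters with `l (1 - l)`, and its `l²` part is the admissible
  -- quadratic error.
  have key : -(ω x - ω p - α / 2 * ‖x - p‖ ^ 2) ≤ (-ω' p) (x - p) := by
    refine le_fderivWithin_of_segment (f := fun x => -ω x) (e := α / 2 * ‖x - p‖ ^ 2) hX hp hx hd.neg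
      fun l h0 h1 => ?_
    have := hs.2 hp hx (sub_nonneg.2 h1) h0.le (sub_add_cancel 1 l)
    have e1 : (1 - l) • p + l • x = p + l • (x - p) := by
      rw [sub_smul, one_smul, smul_sub]; abel
    simp only [e1, smul_eq_mul, norm_sub_rev p x] at this
    nlinarith
  simp only [neg_apply] at key
  unfold breg; linarith

theorem breg_nonneg {ω : E → ℝ} {ω' : E → E →L[ℝ] ℝ} {X : Set E} {α : ℝ} {p x : E}
    (hX : Convex ℝ X) (hα : 0 ≤ α) (hp : p ∈ X) (hx : x ∈ X)
    (hd : HasFDerivWithinAt ω (ω' p) X p)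
    (hs : StrongConvexOn X α ω) : 0 ≤ breg ω ω' p x :=
  le_trans (by positivity) (le_breg hX hp hx hd hs)

/-- Optimality condition of the primal step. -/
theorem IsArgmin.prox_le {ω : E → ℝ} {ω' : E → E →L[ℝ] ℝ} {X : Set E} {p x z : E} {f : E → ℝ}
    {τ : ℝ} (hX : Convex ℝ X) (hf : ConvexOn ℝ X f)
    (hz : IsArgmin (fun x => f x + τ * breg ω ω' p x) X z)
    (hd : HasFDerivWithinAt ω (ω' z) X z) (hx : x ∈ X) :
    f z - τ * (ω' z - ω' p) (x - z) ≤ f x := by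
  -- Only `τ ω` is differentiated along the segment; `f` is merely convex and is handled by the
  -- convexity inequality.
  have key : f z - f x + τ * ω' p (x - z) ≤ (τ • ω' z) (x - z) := by
    refine le_fderivWithin_of_segment (f := fun x => τ * ω x) (e := 0) hX hz.1 hx
      (hd.const_mul τ) fun l h0 h1 => ?_
    have hm : z + l • (x - z) ∈ X := hX.add_smul_sub_mem hz.1 hx ⟨h0.le, h1⟩
    have h2 := hz.2 _ hm
    have h3 := hf.2 hz.1 hx (sub_nonneg.2 h1) h0.le (sub_add_cancel 1 l)
    have e1 : (1 - l) • z + l • x = z + l • (x - z) := by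
      rw [sub_smul, one_smul, smul_sub]; abel
    have e2 : ω' p (z + l • (x - z) - p) = ω' p (z - p) + l * ω' p (x - z) := by
      rw [show z + l • (x - z) - p = (z - p) + l • (x - z) by abel, map_add, map_smul, smul_eq_mul]
    rw [e1] at h3
    simp only [breg, e2, smul_eq_mul] at h2 h3
    nlinarith
  simp only [smul_apply, smul_eq_mul, sub_apply] at key ⊢
  nlinarith

/-- Optimality condition of the dual step. -/
theorem IsArgmin.dual_inner_nonneg {C : Set F} {a d y z : F} {η : ℝ} (hC : Convex ℝ C)
    (hz : IsArgmin (fun y => inner ℝ a y + η / 2 * ‖y - d‖ ^ 2) C z) (hy : y ∈ C) :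
    0 ≤ inner ℝ (a + η • (z - d)) (y - z) := by
  refine nonneg_of_forall_quadratic (e := η / 2 * ‖y - z‖ ^ 2) fun l h0 h1 => ?_
  have h := hz.2 _ (hC.add_smul_sub_mem hz.1 hy ⟨h0.le, h1⟩)
  have e1 : ‖z + l • (y - z) - d‖ ^ 2
      = ‖z - d‖ ^ 2 + 2 * (l * inner ℝ (z - d) (y - z)) + l ^ 2 * ‖y - z‖ ^ 2 := by
    rw [show z + l • (y - z) - d = (z - d) + l • (y - z) by abel, norm_add_sq_real,
      inner_smul_right, norm_smul, mul_pow, Real.norm_eq_abs, sq_abs]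
  simp only [e1, inner_add_right, inner_smul_right] at h
  rw [inner_add_left, inner_smul_left]
  simp only [conj_trivial]
  nlinarith

theorem inner_prox_identity (y z d : F) :
    inner ℝ (z - d) (y - z) = (‖y - d‖ ^ 2 - ‖y - z‖ ^ 2 - ‖z - d‖ ^ 2) / 2 := by
  have : ‖y - d‖ ^ 2 = ‖z - d‖ ^ 2 + 2 * inner ℝ (z - d) (y - z) + ‖y - z‖ ^ 2 := by
    rw [← norm_add_sq_real]; congr 2; abel
  linarith

/-- The dual step has a solution if `η > 0`. -/
theorem exists_isArgmin_dual [CompleteSpace F] {C : Set F} (hne : C.Nonempty) (hcl : IsClosed C)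
    (hC : Convex ℝ C) (a d : F) {η : ℝ} (hη : 0 < η) :
    ∃ z, IsArgmin (fun y => inner ℝ a y + η / 2 * ‖y - d‖ ^ 2) C z := by
  obtain ⟨z, hz, hmin⟩ := exists_norm_eq_iInf_of_complete_convex hne hcl.isComplete hC
    (d - η⁻¹ • a)
  refine ⟨z, hz, fun y hy => ?_⟩
  have h1 : ‖d - η⁻¹ • a - z‖ ≤ ‖d - η⁻¹ • a - y‖ := by
    rw [hmin]
    exact ciInf_le (f := fun w : C => ‖d - η⁻¹ • a - w‖) ⟨0, by rintro _ ⟨w, rfl⟩; positivity⟩ ⟨y, hy⟩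
  -- Completing the square: the minimizer is the projection of `d - η⁻¹ a` onto `C`.
  have h2 : ∀ w : F, inner ℝ a w + η / 2 * ‖w - d‖ ^ 2
      = η / 2 * ‖d - η⁻¹ • a - w‖ ^ 2 + inner ℝ a d - η / 2 * ‖η⁻¹ • a‖ ^ 2 := by
    intro w
    have : ‖d - η⁻¹ • a - w‖ ^ 2
        = ‖w - d‖ ^ 2 + 2 * (η⁻¹ * inner ℝ a (w - d)) + ‖η⁻¹ • a‖ ^ 2 := by
      rw [← norm_neg, show -(d - η⁻¹ • a - w) = (w - d) + η⁻¹ • a by abel, norm_add_sq_real,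
        inner_smul_right, real_inner_comm]
    rw [this, inner_sub_right]
    field_simp
    ring
  have h3 := h2 z
  have h4 := h2 y
  have h5 : ‖d - η⁻¹ • a - z‖ ^ 2 ≤ ‖d - η⁻¹ • a - y‖ ^ 2 := by gcongr
  have h6 : η / 2 * ‖d - η⁻¹ • a - z‖ ^ 2 ≤ η / 2 * ‖d - η⁻¹ • a - y‖ ^ 2 := by gcongr
  linarith

end Generic

end DSA
end

/-! ### Deterministic analysis of one primal-dual step. -/

noncomputable section

namespace DSA

/-- A single stage problem `min {h x + v x : x ∈ X, A x - q ∈ K}`, together with a distance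
generating function `ω` of modulus `α`, the modulus `μ` of `h` relative to `ω` and a Lipschitz
constant `M` of `v`. -/
structure Stage (E F : Type*) [NormedAddCommGroup E] [NormedSpace ℝ E]
    [NormedAddCommGroup F] [InnerProductSpace ℝ F] where
  X : Set E
  K : ProperCone ℝ F
  A : E →L[ℝ] F
  q : F
  h : E → ℝ
  v : E → ℝ
  ω : E → ℝ
  ω' : E → (E →L[ℝ] ℝ)
  α : ℝ
  μ : ℝ
  M : ℝ

/-- Loop state: `(x_k, y_k, y_{k-1}, ∑ w_i x_i, ∑ w_i y_i)`. -/
abbrev LoopState (E F : Type*) : Type _ := E × F × F × E × F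

namespace Stage

set_option linter.unusedSectionVars false

variable {E F : Type*} [NormedAddCommGroup E] [NormedSpace ℝ E]
  [NormedAddCommGroup F] [InnerProductSpace ℝ F] [CompleteSpace F]

/-- The dual cone. -/
def C (Z : Stage E F) : ProperCone ℝ F := ProperCone.innerDual (Z.K : Set F)

/-- The Bregman divergence of the stage. -/
def P (Z : Stage E F) (p x : E) : ℝ := breg Z.ω Z.ω' p x

/-- The Lagrangian of the stage problem. -/
def L (Z : Stage E F) (x : E) (y : F) : ℝ := inner ℝ (Z.q - Z.A x) y + Z.h x + Z.v x

/-- `(x, y)` is a saddle point of the Lagrangian. -/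
def IsSaddle (Z : Stage E F) (x : E) (y : F) : Prop :=
  x ∈ Z.X ∧ y ∈ (Z.C : Set F) ∧ (∀ y' ∈ (Z.C : Set F), Z.L x y' ≤ Z.L x y) ∧
    ∀ x' ∈ Z.X, Z.L x y ≤ Z.L x' y

/-- The feasible set of the stage problem. -/
def feas (Z : Stage E F) : Set E := {x | x ∈ Z.X ∧ Z.A x - Z.q ∈ Z.K}

/-- Standing assumptions on a stage problem. -/
structure Valid (Z : Stage E F) : Prop where
  nonempty : Z.X.Nonempty
  compact : IsCompact Z.X
  convex : Convex ℝ Z.X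
  α_pos : 0 < Z.α
  ω_deriv : ∀ x ∈ Z.X, HasFDerivWithinAt Z.ω (Z.ω' x) Z.X x
  ω'_cont : ContinuousOn Z.ω' Z.X
  ω_strong : StrongConvexOn Z.X Z.α Z.ω
  h_convex : ConvexOn ℝ Z.X Z.h
  h_closed : LowerSemicontinuousOn Z.h Z.X
  μ_nonneg : 0 ≤ Z.μ
  h_strong : ∀ x₂ ∈ Z.X, ∀ g : E →L[ℝ] ℝ, (∀ x ∈ Z.X, Z.h x₂ + g (x - x₂) ≤ Z.h x) →
    ∀ x₁ ∈ Z.X, Z.μ * Z.P x₂ x₁ ≤ Z.h x₁ - Z.h x₂ - g (x₁ - x₂)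
  v_convex : ConvexOn ℝ Z.X Z.v
  M_nonneg : 0 ≤ Z.M
  v_lip : ∀ x ∈ Z.X, ∀ x' ∈ Z.X, |Z.v x' - Z.v x| ≤ Z.M * ‖x' - x‖

theorem inner_nonneg_of_mem (Z : Stage E F) {a y : F} (ha : a ∈ Z.K) (hy : y ∈ Z.C) :
    0 ≤ inner ℝ a y := ProperCone.mem_innerDual.1 hy ha

theorem mem_K_of_inner_nonneg (Z : Stage E F) {a : F} (h : ∀ y ∈ Z.C, 0 ≤ inner ℝ a y) :
    a ∈ Z.K := by
  rw [← ProperCone.innerDual_innerDual Z.K, ProperCone.mem_innerDual]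
  intro y hy
  rw [real_inner_comm]
  exact h y hy

namespace IsSaddle

variable {Z : Stage E F} {x : E} {y : F}

theorem inner_le (hs : Z.IsSaddle x y) {y' : F} (hy' : y' ∈ Z.C) :
    inner ℝ (Z.q - Z.A x) y' ≤ inner ℝ (Z.q - Z.A x) y := by
  have := hs.2.2.1 y' hy'
  unfold L at this; linarith

/-- In a cone `y + y'` is again a competitor of the maximizer `y`, and the value at `y` cancels. -/
theorem inner_nonpos (hs : Z.IsSaddle x y) {y' : F} (hy' : y' ∈ Z.C) :
    inner ℝ (Z.q - Z.A x) y' ≤ 0 := by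
  have := hs.inner_le (Z.C.add_mem hs.2.1 hy')
  rw [inner_add_right] at this; linarith

theorem inner_eq_zero (hs : Z.IsSaddle x y) : inner ℝ (Z.q - Z.A x) y = 0 := by
  refine le_antisymm (hs.inner_nonpos hs.2.1) ?_
  have := hs.inner_le Z.C.zero_mem
  rwa [inner_zero_right] at this

theorem mem_feas (hs : Z.IsSaddle x y) : x ∈ Z.feas := by
  refine ⟨hs.1, Z.mem_K_of_inner_nonneg fun y' hy' => ?_⟩
  have := hs.inner_nonpos hy'
  rw [← neg_sub, inner_neg_left]; linarith

theorem L_eq (hs : Z.IsSaddle x y) : Z.L x y = Z.h x + Z.v x := by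
  unfold L; rw [hs.inner_eq_zero]; ring

theorem L_le_of_feas (Z : Stage E F) {x' : E} {y : F} (hx' : x' ∈ Z.feas) (hy : y ∈ Z.C) :
    Z.L x' y ≤ Z.h x' + Z.v x' := by
  have := Z.inner_nonneg_of_mem hx'.2 hy
  rw [← neg_sub, inner_neg_left] at this
  unfold L; linarith

theorem isArgmin (hs : Z.IsSaddle x y) : IsArgmin (fun x => Z.h x + Z.v x) Z.feas x := by
  refine ⟨hs.mem_feas, fun x' hx' => ?_⟩
  have h1 := hs.2.2.2 x' hx'.1
  have h2 := L_le_of_feas Z hx' hs.2.1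
  rw [hs.L_eq] at h1
  exact h1.trans h2

theorem sInf_eq (hs : Z.IsSaddle x y) :
    sInf ((fun x => Z.h x + Z.v x) '' Z.feas) = Z.h x + Z.v x := by
  refine IsLeast.csInf_eq ⟨⟨x, hs.mem_feas, rfl⟩, ?_⟩
  rintro _ ⟨x', hx', rfl⟩
  exact hs.isArgmin.2 x' hx'

end IsSaddle

/-- One primal-dual step with weights `w₀` (previous) and `w` (current). -/
structure IsStep (Z : Stage E F) (w₀ w τ η : ℝ) (st : LoopState E F) (G : E →L[ℝ] ℝ)
    (st' : LoopState E F) : Prop where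
  prox : IsArgmin (fun x => (inner ℝ (Z.q - Z.A x) ((w₀ / w) • (st.2.1 - st.2.2.1) + st.2.1) + Z.h x
    + G x) + τ * Z.P st.1 x) Z.X st'.1
  dual : IsArgmin (fun y => inner ℝ (Z.A st'.1 - Z.q) y + η / 2 * ‖y - st.2.1‖ ^ 2) (Z.C : Set F)
    st'.2.1
  prev : st'.2.2.1 = st.2.1
  sumx : st'.2.2.2.1 = st.2.2.2.1 + w • st'.1
  sumy : st'.2.2.2.2 = st.2.2.2.2 + w • st'.2.1

/-- The weighted sum of primal vectors is compatible with the total weight `W`. -/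
def SumsIn (Z : Stage E F) (W : ℝ) (st : LoopState E F) : Prop :=
  (W = 0 ∧ st.2.2.2.1 = 0 ∧ st.2.2.2.2 = 0) ∨
    (0 < W ∧ W⁻¹ • st.2.2.2.1 ∈ Z.X ∧ st.2.2.2.2 ∈ Z.C)

/-- `W` times the gap function at the averaged iterates, against the comparator `(x, y)`. -/
def wgap (Z : Stage E F) (W : ℝ) (st : LoopState E F) (x : E) (y : F) : ℝ :=
  W * (Z.h (W⁻¹ • st.2.2.2.1) + Z.v (W⁻¹ • st.2.2.2.1) - Z.h x - Z.v x)
    + inner ℝ (W • Z.q - Z.A st.2.2.2.1) y - inner ℝ (Z.q - Z.A x) st.2.2.2.2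

theorem wgap_eq (Z : Stage E F) {W : ℝ} (hW : 0 < W) (st : LoopState E F) (x : E) (y : F) :
    Z.wgap W st x y
      = W * (Z.L (W⁻¹ • st.2.2.2.1) y - Z.L x (W⁻¹ • st.2.2.2.2)) := by
  have e : W • Z.q - Z.A st.2.2.2.1 = W • (Z.q - Z.A (W⁻¹ • st.2.2.2.1)) := by
    rw [map_smul, smul_sub, smul_smul, mul_inv_cancel₀ hW.ne', one_smul]
  have e2 : inner ℝ (Z.q - Z.A x) st.2.2.2.2
      = W * inner ℝ (Z.q - Z.A x) (W⁻¹ • st.2.2.2.2) := by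
    rw [inner_smul_right, ← mul_assoc, mul_inv_cancel₀ hW.ne', one_mul]
  unfold wgap L
  rw [e, e2, inner_smul_left]
  simp only [conj_trivial]; ring

theorem wgap_saddle_nonneg {Z : Stage E F} {W : ℝ} {st : LoopState E F} {x : E} {y : F}
    (hs : Z.IsSaddle x y) (hW : Z.SumsIn W st) : 0 ≤ Z.wgap W st x y := by
  rcases hW with ⟨h0, h1, h2⟩ | ⟨h0, h1, h2⟩
  · simp [wgap, h0, h1, h2]
  · rw [Z.wgap_eq h0]
    have a := hs.2.2.2 _ h1
    have b := hs.2.2.1 (W⁻¹ • st.2.2.2.2) (Z.C.smul_mem h2 (by positivity))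
    have : 0 ≤ Z.L (W⁻¹ • st.2.2.2.1) y - Z.L x (W⁻¹ • st.2.2.2.2) := by linarith
    positivity

/-- The potential function of the loop. -/
def pot (Z : Stage E F) (W lam H w b : ℝ) (st : LoopState E F) (x : E) (y : F) : ℝ :=
  Z.wgap W st x y + lam * Z.P st.1 x + H / 2 * ‖y - st.2.1‖ ^ 2
    + w * inner ℝ (Z.A (st.1 - x)) (st.2.1 - st.2.2.1) + H / 2 * ‖st.2.1 - st.2.2.1‖ ^ 2
    - b * ‖x - st.1‖ ^ 2

/-- The alternative covers the state before the first step, where `W⁻¹ • S` is the junk value `0`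
and need not lie in `X`; its factor `W = 0` removes it. -/
theorem weighted_jensen {X : Set E} {f : E → ℝ} (hf : ConvexOn ℝ X f) {W w : ℝ} {S x : E}
    (hw : 0 < w) (hS : (W = 0 ∧ S = 0) ∨ (0 < W ∧ W⁻¹ • S ∈ X)) (hx : x ∈ X) :
    (W + w)⁻¹ • (S + w • x) ∈ X ∧
      (W + w) * f ((W + w)⁻¹ • (S + w • x)) ≤ W * f (W⁻¹ • S) + w * f x := by
  rcases hS with ⟨h0, h1⟩ | ⟨h0, h1⟩
  · subst h0 h1
    have e : (0 + w)⁻¹ • (0 + w • x) = x := by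
      rw [zero_add, zero_add, smul_smul, inv_mul_cancel₀ hw.ne', one_smul]
    rw [e]; exact ⟨hx, by simp⟩
  · have hpos : 0 < W + w := by positivity
    have e : (W + w)⁻¹ • (S + w • x) = (W / (W + w)) • (W⁻¹ • S) + (w / (W + w)) • x := by
      rw [smul_add, smul_smul, smul_smul]
      congr 2
      · field_simp
      · field_simp
    have hsum : W / (W + w) + w / (W + w) = 1 := by rw [← add_div, div_self hpos.ne']
    rw [e]
    refine ⟨hf.1 h1 hx (by positivity) (by positivity) hsum, ?_⟩
    have := hf.2 h1 hx (by positivity : 0 ≤ W / (W + w)) (by positivity : 0 ≤ w / (W + w)) hsum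
    calc _ ≤ (W + w) * ((W / (W + w)) • f (W⁻¹ • S) + (w / (W + w)) • f x) := by gcongr
      _ = _ := by simp only [smul_eq_mul]; field_simp

/-- Young's inequality without division, so that `H = 0` or `g = 0` is allowed; both occur when `A =
0`. -/
theorem mul_mul_le_of_sq_le {t H g a b : ℝ} (hH : 0 ≤ H) (hg : 0 ≤ g)
    (h : t ^ 2 ≤ 2 * H * g) : t * a * b ≤ H / 2 * b ^ 2 + g * a ^ 2 := by
  refine le_of_sq_le_sq' ?_ (by positivity)
  calc (t * a * b) ^ 2 = t ^ 2 * (a * b) ^ 2 := by ring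
    _ ≤ 2 * H * g * (a * b) ^ 2 := by gcongr
    _ ≤ _ := by nlinarith [sq_nonneg (H / 2 * b ^ 2 - g * a ^ 2)]
where
  le_of_sq_le_sq' {a b : ℝ} (h : a ^ 2 ≤ b ^ 2) (hb : 0 ≤ b) : a ≤ b :=
    (abs_le_of_sq_le_sq' h hb).2

theorem inner_coupling_le (Z : Stage E F) {w H g : ℝ} (hw : 0 ≤ w) (hH : 0 ≤ H) (hg : 0 ≤ g)
    (h : (w * ‖Z.A‖) ^ 2 ≤ 2 * H * g) (a : E) (b : F) :
    |w * inner ℝ (Z.A a) b| ≤ H / 2 * ‖b‖ ^ 2 + g * ‖a‖ ^ 2 := by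
  rw [abs_mul, abs_of_nonneg hw]
  calc w * |inner ℝ (Z.A a) b| ≤ w * (‖Z.A a‖ * ‖b‖) := by
        gcongr; exact abs_real_inner_le_norm _ _
    _ ≤ w * (‖Z.A‖ * ‖a‖ * ‖b‖) := by gcongr; exact Z.A.le_opNorm a
    _ = w * ‖Z.A‖ * ‖a‖ * ‖b‖ := by ring
    _ ≤ _ := mul_mul_le_of_sq_le hH hg h

variable {Z : Stage E F} {w₀ w τ η : ℝ} {st st' : LoopState E F} {G : E →L[ℝ] ℝ}

/-- Optimality of the primal step exhibits a subgradient of `h` at the new point, namely `Aᵀ ỹ - G -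
τ (ω'(x_k) - ω'(x_{k-1}))`. The modulus `μ` applies to this subgradient, and the three point
identity converts its last part into Bregman divergences. -/
theorem IsStep.h_le (hs : Z.IsStep w₀ w τ η st G st') (hZ : Z.Valid) {x : E} (hx : x ∈ Z.X) :
    Z.h st'.1 - Z.h x ≤ - inner ℝ (Z.A (x - st'.1)) ((w₀ / w) • (st.2.1 - st.2.2.1) + st.2.1)
      + G (x - st'.1) + τ * (Z.P st.1 x - Z.P st'.1 x - Z.P st.1 st'.1) - Z.μ * Z.P st'.1 x := by
  set yt := (w₀ / w) • (st.2.1 - st.2.2.1) + st.2.1 with hyt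
  have hconv : ConvexOn ℝ Z.X (fun x => inner ℝ (Z.q - Z.A x) yt + Z.h x + G x) := by
    refine ⟨hZ.convex, fun a ha b hb s t hs' ht hst => ?_⟩
    have h1 := hZ.h_convex.2 ha hb hs' ht hst
    simp only [smul_eq_mul, map_add, map_smul, inner_sub_left, inner_add_left, inner_smul_left,
      conj_trivial] at h1 ⊢
    have : inner ℝ Z.q yt = s * inner ℝ Z.q yt + t * inner ℝ Z.q yt := by
      rw [← add_mul, hst, one_mul]
    linarith
  have hp := fun x (hx : x ∈ Z.X) =>
    hs.prox.prox_le (ω := Z.ω) (ω' := Z.ω') hZ.convex hconv (hZ.ω_deriv _ hs.prox.1) hx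
  set g : E →L[ℝ] ℝ := (innerSL ℝ yt).comp Z.A - G - τ • (Z.ω' st'.1 - Z.ω' st.1) with hg
  have hgx : ∀ u : E, g u = inner ℝ (Z.A u) yt - G u - τ * (Z.ω' st'.1 - Z.ω' st.1) u := by
    intro u
    simp [hg, real_inner_comm]
  have h2 := hZ.h_strong st'.1 hs.prox.1 g (fun u hu => by
    have := hp u hu
    simp only [inner_sub_left] at this
    rw [hgx, map_sub, map_sub, inner_sub_left]
    linarith) x hx
  have h3 := breg_three_point Z.ω Z.ω' st.1 x st'.1
  rw [hgx, h3] at h2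
  simp only [P] at h2 ⊢
  linarith

theorem IsStep.dual_le (hs : Z.IsStep w₀ w τ η st G st') {y : F} (hy : y ∈ Z.C) :
    inner ℝ (Z.A st'.1 - Z.q) (st'.2.1 - y)
      ≤ η / 2 * (‖y - st.2.1‖ ^ 2 - ‖y - st'.2.1‖ ^ 2 - ‖st'.2.1 - st.2.1‖ ^ 2) := by
  have h := hs.dual.dual_inner_nonneg Z.C.convex (y := y) hy
  rw [inner_add_left, inner_smul_left, inner_prox_identity] at h
  rw [← neg_sub y, inner_neg_right]
  simp only [conj_trivial] at h
  linarith

/-- The source of feasibility. Testing the optimality of `y_k` with `y_k + y`, `y` in the dual cone,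
puts the gradient of the dual objective into the bidual cone, which is `K`. Since `w_k η_k` is
constant, the weighted sum of these inclusions telescopes in `y`. -/
theorem IsStep.mem_K (hs : Z.IsStep w₀ w τ η st G st') :
    Z.A st'.1 - Z.q + η • (st'.2.1 - st.2.1) ∈ Z.K := by
  refine Z.mem_K_of_inner_nonneg fun y hy => ?_
  have h := hs.dual.dual_inner_nonneg Z.C.convex (y := st'.2.1 + y) (Z.C.add_mem hs.dual.1 hy)
  rwa [add_sub_cancel_left] at h

theorem IsStep.sumsIn (hs : Z.IsStep w₀ w τ η st G st') (hZ : Z.Valid) {W : ℝ} (hw : 0 < w)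
    (hW : Z.SumsIn W st) : Z.SumsIn (W + w) st' := by
  have hj := (weighted_jensen hZ.h_convex hw (W := W) (S := st.2.2.2.1) (by
      rcases hW with h | h
      · exact Or.inl ⟨h.1, h.2.1⟩
      · exact Or.inr ⟨h.1, h.2.1⟩) hs.prox.1).1
  have hy : st.2.2.2.2 ∈ Z.C := by
    rcases hW with h | h
    · rw [h.2.2]; exact Z.C.zero_mem
    · exact h.2.2
  refine Or.inr ⟨?_, ?_, ?_⟩
  · rcases hW with h | h
    · rw [h.1]; linarith
    · linarith [h.1]
  · rw [hs.sumx]; exact hj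
  · rw [hs.sumy]; exact Z.C.add_mem hy (Z.C.smul_mem hs.dual.1 hw.le)

theorem Valid.le_P (hZ : Z.Valid) {p x : E} (hp : p ∈ Z.X) (hx : x ∈ Z.X) :
    Z.α / 2 * ‖x - p‖ ^ 2 ≤ Z.P p x :=
  le_breg hZ.convex hp hx (hZ.ω_deriv p hp) hZ.ω_strong

/-- The primal inequality, the dual inequality and Jensen's inequality for the averages are added.
The potential carries the term `H/2 ‖y_k - y_{k-1}‖²`, left over from the dual step, so that the
following step can use it against the extrapolation error; the other half of that error, `g ‖x_k -
x_{k-1}‖²`, is taken from the prox term. -/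
theorem IsStep.pot_le (hs : Z.IsStep w₀ w τ η st G st') (hZ : Z.Valid) {W lam₀ lam H g : ℝ}
    (hW : Z.SumsIn W st) (hw₀ : 0 ≤ w₀) (hw : 0 < w) (hlam₀ : w * τ = lam₀)
    (hlam : lam = w * (τ + Z.μ)) (hη : w * η = H) (hτ : 0 ≤ τ) (hH : 0 ≤ H) (hg : 0 ≤ g)
    (hA : (w₀ * ‖Z.A‖) ^ 2 ≤ 2 * H * g) (hp : st.1 ∈ Z.X) {x : E} {y : F} (hx : x ∈ Z.X)
    (hy : y ∈ Z.C) :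
    Z.pot (W + w) lam H w 0 st' x y ≤ Z.pot W lam₀ H w₀ 0 st x y
      + w * (Z.v st'.1 - Z.v x + G (x - st'.1))
      - (w * τ * Z.α / 2 - g) * ‖st'.1 - st.1‖ ^ 2 := by
  have h1 := mul_le_mul_of_nonneg_left (hs.h_le hZ hx) hw.le
  have h2 := mul_le_mul_of_nonneg_left (hs.dual_le hy) hw.le
  have hS : (W = 0 ∧ st.2.2.2.1 = 0) ∨ (0 < W ∧ W⁻¹ • st.2.2.2.1 ∈ Z.X) := by
    rcases hW with h | h
    · exact Or.inl ⟨h.1, h.2.1⟩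
    · exact Or.inr ⟨h.1, h.2.1⟩
  have h3 := (weighted_jensen hZ.h_convex hw hS hs.prox.1).2
  have h4 := (weighted_jensen hZ.v_convex hw hS hs.prox.1).2
  have h5 := mul_le_mul_of_nonneg_left (hZ.le_P hp hs.prox.1) (mul_nonneg hw.le hτ)
  have h6 := le_of_abs_le (Z.inner_coupling_le hw₀ hH hg hA (st'.1 - st.1) (st.2.1 - st.2.2.1))
  -- This is where the extrapolation parameter `w₀ / w` matters: the bilinear terms become a
  -- difference of consecutive coupling terms plus one term in `x_k - x_{k-1}`, the one bounded in
  -- `h6`.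
  have hid : w * (inner ℝ (Z.q - Z.A st'.1) y - inner ℝ (Z.q - Z.A x) st'.2.1)
      + w * (- inner ℝ (Z.A (x - st'.1)) ((w₀ / w) • (st.2.1 - st.2.2.1) + st.2.1))
      = w * inner ℝ (Z.A st'.1 - Z.q) (st'.2.1 - y)
        - w * inner ℝ (Z.A (st'.1 - x)) (st'.2.1 - st.2.1)
        + w₀ * inner ℝ (Z.A (st.1 - x)) (st.2.1 - st.2.2.1)
        + w₀ * inner ℝ (Z.A (st'.1 - st.1)) (st.2.1 - st.2.2.1) := by
    simp only [map_sub, inner_sub_left, inner_sub_right, inner_add_right, inner_smul_right]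
    field_simp
    ring
  have e1 : Z.wgap (W + w) st' x y
      = (W + w) * Z.h ((W + w)⁻¹ • (st.2.2.2.1 + w • st'.1))
        + (W + w) * Z.v ((W + w)⁻¹ • (st.2.2.2.1 + w • st'.1))
        - (W + w) * (Z.h x + Z.v x) + inner ℝ (W • Z.q - Z.A st.2.2.2.1) y
        - inner ℝ (Z.q - Z.A x) st.2.2.2.2
        + w * (inner ℝ (Z.q - Z.A st'.1) y - inner ℝ (Z.q - Z.A x) st'.2.1) := by
    unfold wgap
    rw [hs.sumx, hs.sumy]
    simp only [map_add, map_smul, inner_sub_left, inner_add_left, inner_add_right, inner_smul_left,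
      inner_smul_right, conj_trivial]
    ring
  have e2 : w * (η / 2 * (‖y - st.2.1‖ ^ 2 - ‖y - st'.2.1‖ ^ 2 - ‖st'.2.1 - st.2.1‖ ^ 2))
      = H / 2 * ‖y - st.2.1‖ ^ 2 - H / 2 * ‖y - st'.2.1‖ ^ 2
        - H / 2 * ‖st'.2.1 - st.2.1‖ ^ 2 := by
    rw [← hη]; ring
  unfold pot
  rw [e1, hs.prev, hlam, ← hlam₀]
  rw [e2] at h2
  unfold wgap
  linarith

/-- `G` is drawn at `x_{k-1}`, while `x_k` depends on `G`. Only the linearization error at `x_{k-1}`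
has a controlled conditional mean, so the error is moved there at the price of `(M + ‖G‖) ‖x_k -
x_{k-1}‖`. -/
theorem IsStep.v_add_le (hs : Z.IsStep w₀ w τ η st G st') (hZ : Z.Valid) (hp : st.1 ∈ Z.X)
    {x : E} : Z.v st'.1 - Z.v x + G (x - st'.1)
      ≤ Z.v st.1 - Z.v x + G (x - st.1) + (Z.M + ‖G‖) * ‖st'.1 - st.1‖ := by
  have h1 := le_of_abs_le (hZ.v_lip st.1 hp st'.1 hs.prox.1)
  have h2 : G (x - st'.1) = G (x - st.1) - G (st'.1 - st.1) := by
    rw [← map_sub]; congr 1; abel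
  have h3 := neg_le_of_abs_le (G.le_opNorm (st'.1 - st.1))
  rw [h2]; linarith

/-- One step decreases the potential up to the error of the stochastic subgradient. -/
theorem IsStep.pot_le_regular (hs : Z.IsStep w₀ w τ η st G st') (hZ : Z.Valid)
    {W lam₀ lam H g b₀ b c r z D : ℝ}
    (hW : Z.SumsIn W st) (hw₀ : 0 ≤ w₀) (hw : 0 < w) (hlam₀ : w * τ = lam₀)
    (hlam : lam = w * (τ + Z.μ)) (hη : w * η = H) (hτ : 0 ≤ τ) (hH : 0 ≤ H) (hg : 0 ≤ g)
    (hA : (w₀ * ‖Z.A‖) ^ 2 ≤ 2 * H * g) (hb₀ : 0 ≤ b₀)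
    (hb : ∀ a d : ℝ, b₀ * (a + d) ^ 2 ≤ b * a ^ 2 + c * d ^ 2)
    (hr : ∀ g' d : ℝ, 0 ≤ g' → 0 ≤ d → d ≤ D → w * (Z.M + g') * d
      - (w * τ * Z.α / 2 - g - c) * d ^ 2 ≤ r * (Z.M + g') ^ 2 + z * (Z.M + g'))
    (hD : ∀ p ∈ Z.X, ∀ x ∈ Z.X, ‖x - p‖ ≤ D)
    (hp : st.1 ∈ Z.X) {x : E} {y : F} (hx : x ∈ Z.X) (hy : y ∈ Z.C) :
    Z.pot (W + w) lam H w b st' x y ≤ Z.pot W lam₀ H w₀ b₀ st x y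
      + w * (Z.v st.1 - Z.v x + G (x - st.1))
      + (r * (Z.M + ‖G‖) ^ 2 + z * (Z.M + ‖G‖)) := by
  have h1 := hs.pot_le hZ hW hw₀ hw hlam₀ hlam hη hτ hH hg hA hp hx hy
  have h2 := mul_le_mul_of_nonneg_left (hs.v_add_le hZ hp (x := x)) hw.le
  have h3 := hr ‖G‖ ‖st'.1 - st.1‖ (norm_nonneg _) (norm_nonneg _) (hD _ hp _ hs.prox.1)
  -- The debt `b₀ ‖x - x_{k-1}‖²` in the potential is handed on as `b ‖x - x_k‖²`; the remainder `c
  -- ‖x_k - x_{k-1}‖²` is charged to the prox term.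
  have h4 := hb ‖x - st'.1‖ ‖st'.1 - st.1‖
  have h5 : ‖x - st.1‖ ≤ ‖x - st'.1‖ + ‖st'.1 - st.1‖ := by
    rw [show x - st.1 = (x - st'.1) + (st'.1 - st.1) by abel]; exact norm_add_le _ _
  have h6 : b₀ * ‖x - st.1‖ ^ 2 ≤ b₀ * (‖x - st'.1‖ + ‖st'.1 - st.1‖) ^ 2 := by gcongr
  unfold pot at h1 ⊢
  linarith

/-- The first step, when it does not involve the prox term. -/
theorem IsStep.pot_le_first (hs : Z.IsStep 0 w 0 η st G st') (hZ : Z.Valid)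
    {W lam H b r z D : ℝ}
    (hW : Z.SumsIn W st) (hw : 0 < w) (hlam : lam = w * Z.μ) (hη : w * η = H) (hH : 0 ≤ H)
    (hr : ∀ g' d : ℝ, 0 ≤ g' → 0 ≤ d → d ≤ D → w * (Z.M + g') * d
      ≤ b * d ^ 2 + r * (Z.M + g') ^ 2 + z * (Z.M + g'))
    (hD : ∀ p ∈ Z.X, ∀ x ∈ Z.X, ‖x - p‖ ≤ D)
    (hp : st.1 ∈ Z.X) {x : E} {y : F} (hx : x ∈ Z.X) (hy : y ∈ Z.C) :
    Z.pot (W + w) lam H w b st' x y ≤ Z.pot W 0 H 0 0 st x y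
      + (r * (Z.M + ‖G‖) ^ 2 + z * (Z.M + ‖G‖)) := by
  subst hlam
  have h1 := hs.pot_le hZ hW le_rfl hw (mul_zero w) (by rw [zero_add]) hη le_rfl hH
    le_rfl (by simp) hp hx hy
  have h3 := hr ‖G‖ ‖x - st'.1‖ (norm_nonneg _) (norm_nonneg _) (hD _ hs.prox.1 _ hx)
  -- Without a prox term nothing controls `‖x_1 - x_0‖`. The error is measured against the
  -- comparator instead, and a part `b ‖x - x_1‖²` of it is booked as debt in the potential.
  have h4 : Z.v st'.1 - Z.v x + G (x - st'.1) ≤ (Z.M + ‖G‖) * ‖x - st'.1‖ := by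
    have a := le_of_abs_le (hZ.v_lip x hx st'.1 hs.prox.1)
    have b := le_of_abs_le (G.le_opNorm (x - st'.1))
    rw [norm_sub_rev] at a
    linarith
  have h5 := mul_le_mul_of_nonneg_left h4 hw.le
  unfold pot at h1 ⊢
  simp only [mul_zero, zero_mul, zero_div, sub_zero] at h1 ⊢
  linarith

/-- The Bregman term is at least `lam α/2 ‖x - x_k‖²`. A share `g` of this coefficient, with the
dual difference term, cancels the coupling term; a share `b` repays the debt. -/
theorem le_pot (hZ : Z.Valid) {W lam H w b g : ℝ} (hw : 0 ≤ w) (hH : 0 ≤ H) (hg : 0 ≤ g)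
    (hA : (w * ‖Z.A‖) ^ 2 ≤ 2 * H * g) (hl : 0 ≤ lam) (hb : g + b ≤ lam * Z.α / 2)
    (hp : st.1 ∈ Z.X) {x : E} (hx : x ∈ Z.X) (y : F) :
    Z.wgap W st x y + H / 2 * ‖y - st.2.1‖ ^ 2 ≤ Z.pot W lam H w b st x y := by
  have h1 := neg_le_of_abs_le (Z.inner_coupling_le hw hH hg hA (st.1 - x) (st.2.1 - st.2.2.1))
  have h2 := mul_le_mul_of_nonneg_left (hZ.le_P hp hx) hl
  have h3 : (g + b) * ‖x - st.1‖ ^ 2 ≤ lam * Z.α / 2 * ‖x - st.1‖ ^ 2 := by gcongr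
  rw [norm_sub_rev st.1 x] at h1
  unfold pot
  linarith

end Stage

end DSA
end

/-! ### The loop of one stage as a Markov chain, and its almost sure invariants. -/

noncomputable section

namespace DSA

set_option linter.unusedSectionVars false

theorem sq_integral_le {Ω : Type*} [MeasurableSpace Ω] {ν : Measure Ω} [IsProbabilityMeasure ν]
    {g : Ω → ℝ} (hg : Integrable g ν) (hg2 : Integrable (fun a => g a ^ 2) ν) :
    (∫ a, g a ∂ν) ^ 2 ≤ ∫ a, g a ^ 2 ∂ν := by
  set c := ∫ a, g a ∂ν with hc
  have h0 : 0 ≤ ∫ a, (g a - c) ^ 2 ∂ν := integral_nonneg fun a => sq_nonneg _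
  have h1 : ∫ a, (g a - c) ^ 2 ∂ν = ∫ a, (g a ^ 2 - 2 * c * g a + c ^ 2) ∂ν := by
    congr 1; ext a; ring
  rw [h1, integral_add (f := fun a => g a ^ 2 - 2 * c * g a) (hg2.sub (hg.const_mul _))
    (integrable_const _), integral_sub hg2 (hg.const_mul _), integral_const_mul, ← hc] at h0
  simp at h0
  nlinarith

theorem moments_of_lintegral_sq_le {Ω : Type*} [MeasurableSpace Ω] {ν : Measure Ω}
    [IsProbabilityMeasure ν] {V : Type*} [NormedAddCommGroup V] {G : Ω → V} {M : ℝ} (hM : 0 ≤ M)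
    (hG : AEStronglyMeasurable G ν) (h : ∫⁻ a, ‖G a‖ₑ ^ 2 ∂ν ≤ ENNReal.ofReal (M ^ 2)) :
    Integrable (fun a => ‖G a‖) ν ∧ Integrable (fun a => ‖G a‖ ^ 2) ν ∧
      ∫ a, ‖G a‖ ∂ν ≤ M ∧ ∫ a, ‖G a‖ ^ 2 ∂ν ≤ M ^ 2 := by
  have e : ∀ a, ‖G a‖ₑ ^ 2 = ENNReal.ofReal (‖G a‖ ^ 2) := fun a => by
    rw [ENNReal.ofReal_pow (norm_nonneg _), ofReal_norm]
  simp_rw [e] at h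
  have h2 : Integrable (fun a => ‖G a‖ ^ 2) ν := by
    refine ⟨hG.norm.pow 2, ?_⟩
    rw [hasFiniteIntegral_iff_ofReal (Filter.Eventually.of_forall fun a => by positivity)]
    exact h.trans_lt ENNReal.ofReal_lt_top
  have h1 : Integrable (fun a => ‖G a‖) ν :=
    ((memLp_two_iff_integrable_sq hG.norm).2 h2).integrable (by norm_num)
  have h3 : ∫ a, ‖G a‖ ^ 2 ∂ν ≤ M ^ 2 := by
    rw [integral_eq_lintegral_of_nonneg_ae (Filter.Eventually.of_forall fun a => by positivity)
      h2.1]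
    exact ENNReal.toReal_le_of_le_ofReal (by positivity) h
  refine ⟨h1, h2, ?_, h3⟩
  exact (abs_le_of_sq_le_sq' ((sq_integral_le h1 h2).trans h3) hM).2

/-- Nothing is known about `f` off `X`. Replaced by zero there, it becomes Borel, since it is lower
semicontinuous on the closed set `X`. -/
theorem aemeasurable_comp_of_ae_mem {Ω E : Type*} [MeasurableSpace Ω] [TopologicalSpace E]
    [MeasurableSpace E] [BorelSpace E] {m : Measure Ω} {X : Set E} {f : E → ℝ}
    {g : Ω → E} (hX : IsClosed X) (hf : LowerSemicontinuousOn f X) (hg : Measurable g)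
    (h : ∀ᵐ a ∂m, g a ∈ X) : AEMeasurable (fun a => f (g a)) m := by
  have hm : Measurable (X.indicator f) := by
    refine measurable_of_restrict_of_restrict_compl hX.measurableSet ?_ ?_
    · have : X.domRestrict (X.indicator f) = X.domRestrict f := by
        ext x; simp [x.2]
      rw [this]
      exact (lowerSemicontinuous_restrict_iff.2 hf).measurable
    · have : Xᶜ.domRestrict (X.indicator f) = fun _ => 0 := by
        ext x; simpa using fun hx => absurd hx x.2
      rw [this]; exact measurable_const
  refine ⟨fun a => X.indicator f (g a), hm.comp hg, ?_⟩
  filter_upwards [h] with a ha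
  rw [Set.indicator_of_mem ha]

/-- A Markov step that draws `G` from a kernel and then updates the state. -/
theorem bind_map_eq_map_compProd {σ V : Type*} [MeasurableSpace σ] [MeasurableSpace V]
    (m : Measure σ) [SFinite m] (κ : Kernel σ V) [IsSFiniteKernel κ] {f : σ → V → σ}
    (hf : Measurable (Function.uncurry f)) :
    m.bind (fun s => (κ s).map (f s)) = (m ⊗ₘ κ).map (Function.uncurry f) := by
  have hmeas : Measurable fun s => (κ s).map (f s) := by
    refine Measure.measurable_of_measurable_coe _ fun u hu => ?_
    have : ∀ s, (κ s).map (f s) u = κ s (Prod.mk s ⁻¹' (Function.uncurry f ⁻¹' u)) := fun s => by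
      rw [Measure.map_apply (hf.of_uncurry_left (x := s)) hu]; rfl
    simp_rw [this]
    exact Kernel.measurable_kernel_prodMk_left (hf hu)
  ext u hu
  rw [Measure.bind_apply hu hmeas.aemeasurable, Measure.map_apply hf hu,
    Measure.compProd_apply (hf hu)]
  refine lintegral_congr fun s => ?_
  rw [Measure.map_apply (hf.of_uncurry_left (x := s)) hu]; rfl

/-- The primal-dual loop of one stage: step sizes, oracle for stochastic subgradients, update
rule and the quantities that enter its analysis. -/
structure Loop (E F : Type*) [NormedAddCommGroup E] [NormedSpace ℝ E] [MeasurableSpace E]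
    [NormedAddCommGroup F] [InnerProductSpace ℝ F] where
  Z : Stage E F
  /-- law of the stochastic subgradient at a point -/
  γ : Kernel E (E →L[ℝ] ℝ)
  upd : ℕ → LoopState E F → (E →L[ℝ] ℝ) → LoopState E F
  x0 : E
  y0 : F
  N : ℕ
  w : ℕ → ℝ
  τ : ℕ → ℝ
  η : ℕ → ℝ
  /-- inexactness of the stochastic subgradients -/
  e : ℝ
  /-- the constant value of `w k * η k` -/
  H : ℝ
  /-- bound of the diameter of `X` -/
  D : ℝ
  lam : ℕ → ℝ
  b : ℕ → ℝ
  r : ℕ → ℝ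
  z : ℕ → ℝ

namespace Loop

variable {E F : Type*} [NormedAddCommGroup E] [NormedSpace ℝ E] [MeasurableSpace E]
  [NormedAddCommGroup F] [InnerProductSpace ℝ F]

/-- Conditions on the step sizes. -/
structure Admissible (ℓ : Loop E F) : Prop where
  w_zero : 0 ≤ ℓ.w 0
  w_pos : ∀ k, 0 < ℓ.w (k + 1)
  τ_nonneg : ∀ k, 0 ≤ ℓ.τ (k + 1)
  η_eq : ∀ k, ℓ.w (k + 1) * ℓ.η (k + 1) = ℓ.H
  H_pos : ℓ.Z.A ≠ 0 → 0 < ℓ.H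
  H_zero : ℓ.Z.A = 0 → ℓ.H = 0
  lam_prev : ∀ k, ℓ.w (k + 1) * ℓ.τ (k + 1) = ℓ.lam k
  lam_next : ∀ k, ℓ.lam (k + 1) = ℓ.w (k + 1) * (ℓ.τ (k + 1) + ℓ.Z.μ)
  diam : ∀ p ∈ ℓ.Z.X, ∀ x ∈ ℓ.Z.X, ‖x - p‖ ≤ ℓ.D
  b_zero : ℓ.b 0 = 0
  b_nonneg : ∀ k, 0 ≤ ℓ.b k
  step : ∀ k < ℓ.N,
    (∃ g c, 0 ≤ g ∧ (ℓ.w k * ‖ℓ.Z.A‖) ^ 2 ≤ 2 * ℓ.H * g ∧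
      (∀ a d : ℝ, ℓ.b k * (a + d) ^ 2 ≤ ℓ.b (k + 1) * a ^ 2 + c * d ^ 2) ∧
      ∀ g' d : ℝ, 0 ≤ g' → 0 ≤ d → d ≤ ℓ.D → ℓ.w (k + 1) * (ℓ.Z.M + g') * d
        - (ℓ.w (k + 1) * ℓ.τ (k + 1) * ℓ.Z.α / 2 - g - c) * d ^ 2
        ≤ ℓ.r (k + 1) * (ℓ.Z.M + g') ^ 2 + ℓ.z (k + 1) * (ℓ.Z.M + g')) ∨
    (k = 0 ∧ ℓ.w 0 = 0 ∧ ℓ.τ 1 = 0 ∧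
      ∀ g' d : ℝ, 0 ≤ g' → 0 ≤ d → d ≤ ℓ.D → ℓ.w 1 * (ℓ.Z.M + g') * d
        ≤ ℓ.b 1 * d ^ 2 + ℓ.r 1 * (ℓ.Z.M + g') ^ 2 + ℓ.z 1 * (ℓ.Z.M + g'))
  final : ∀ k, k + 1 ≤ ℓ.N → ∃ g, 0 ≤ g ∧ (ℓ.w (k + 1) * ‖ℓ.Z.A‖) ^ 2 ≤ 2 * ℓ.H * g ∧
    g + ℓ.b (k + 1) ≤ ℓ.lam (k + 1) * ℓ.Z.α / 2
  r_nonneg : ∀ k, 0 ≤ ℓ.r k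
  z_nonneg : ∀ k, 0 ≤ ℓ.z k

/-- Conditions on the stochastic subgradients. -/
structure Oracle (ℓ : Loop E F) : Prop where
  markov : IsMarkovKernel ℓ.γ
  e_nonneg : 0 ≤ ℓ.e
  sq : ∀ x ∈ ℓ.Z.X, ∫⁻ G, ‖G‖ₑ ^ 2 ∂(ℓ.γ x) ≤ ENNReal.ofReal (ℓ.Z.M ^ 2)
  sub : ∀ p ∈ ℓ.Z.X, ∀ x ∈ ℓ.Z.X, ℓ.Z.v p - ℓ.Z.v x + ∫ G, G (x - p) ∂(ℓ.γ p) ≤ ℓ.e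

/-- The updates are primal-dual steps, and depend measurably on the state. -/
structure Updates [MeasurableSpace F] [CompleteSpace F] (ℓ : Loop E F) : Prop where
  meas : ∀ k, Measurable (Function.uncurry (ℓ.upd (k + 1)))
  spec : ∀ k st G, st.1 ∈ ℓ.Z.X →
    ℓ.Z.IsStep (ℓ.w k) (ℓ.w (k + 1)) (ℓ.τ (k + 1)) (ℓ.η (k + 1)) st G (ℓ.upd (k + 1) st G)
  x0_mem : ℓ.x0 ∈ ℓ.Z.X

/-- The initial state. -/
def init (ℓ : Loop E F) : LoopState E F := (ℓ.x0, ℓ.y0, ℓ.y0, 0, 0)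

/-- Law of the state after `k` steps. -/
def law [MeasurableSpace F] (ℓ : Loop E F) (k : ℕ) : Measure (LoopState E F) :=
  iterateLaw (fun k st => (ℓ.γ st.1).map (ℓ.upd k st)) ℓ.init k

/-- Total weight of the first `k` steps. -/
def W (ℓ : Loop E F) (k : ℕ) : ℝ := ∑ i ∈ Finset.Icc 1 k, ℓ.w i

theorem W_zero (ℓ : Loop E F) : ℓ.W 0 = 0 := by simp [W]

theorem W_succ (ℓ : Loop E F) (k : ℕ) : ℓ.W (k + 1) = ℓ.W k + ℓ.w (k + 1) :=
  Finset.sum_Icc_succ_top (by omega) _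

theorem Admissible.W_nonneg {ℓ : Loop E F} (h : ℓ.Admissible) (k : ℕ) : 0 ≤ ℓ.W k := by
  induction k with
  | zero => rw [W_zero]
  | succ k ih => rw [W_succ]; linarith [h.w_pos k]

theorem Admissible.W_pos {ℓ : Loop E F} (h : ℓ.Admissible) (k : ℕ) : 0 < ℓ.W (k + 1) := by
  rw [W_succ]; linarith [h.w_pos k, h.W_nonneg k]

theorem Admissible.w_nonneg {ℓ : Loop E F} (h : ℓ.Admissible) (k : ℕ) : 0 ≤ ℓ.w k := by
  cases k with
  | zero => exact h.w_zero
  | succ k => exact (h.w_pos k).le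

theorem Admissible.H_nonneg {ℓ : Loop E F} (h : ℓ.Admissible) : 0 ≤ ℓ.H := by
  by_cases hA : ℓ.Z.A = 0
  · exact (h.H_zero hA).ge
  · exact (h.H_pos hA).le

/-- Error made in the `k`-th step. -/
def err (ℓ : Loop E F) (k : ℕ) : ℝ := 4 * ℓ.r k * ℓ.Z.M ^ 2 + 2 * ℓ.z k * ℓ.Z.M

section
variable [FiniteDimensional ℝ E] [BorelSpace E] [FiniteDimensional ℝ F] [MeasurableSpace F]
  [BorelSpace F] {ℓ : Loop E F}

/-- Properties of the state after `k` steps that hold almost surely. -/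
def Inv (ℓ : Loop E F) (R : ℝ) (k : ℕ) (st : LoopState E F) : Prop :=
  st.1 ∈ ℓ.Z.X ∧ ℓ.Z.SumsIn (ℓ.W k) st ∧ (1 ≤ k → st.2.1 ∈ ℓ.Z.C) ∧
    ℓ.Z.A st.2.2.2.1 - ℓ.W k • ℓ.Z.q + ℓ.H • (st.2.1 - ℓ.y0) ∈ ℓ.Z.K ∧
    (ℓ.Z.A = 0 → inner ℝ ℓ.Z.q st.2.2.2.2 = 0) ∧
    (ℓ.Z.A ≠ 0 → ‖st.2.1‖ ≤ R ∧ ‖st.2.2.2.2‖ ≤ R)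

/-- Almost sure statements pass through Dirac laws and image measures only for measurable events. -/
theorem measurableSet_inv (hZ : ℓ.Z.Valid) (R : ℝ) (k : ℕ) :
    MeasurableSet {st | ℓ.Inv R k st} := by
  have hX : IsClosed ℓ.Z.X := hZ.compact.isClosed
  have hC : IsClosed (ℓ.Z.C : Set F) := ℓ.Z.C.isClosed
  have hK : IsClosed (ℓ.Z.K : Set F) := ℓ.Z.K.isClosed
  have m1 : Measurable fun st : LoopState E F => st.1 := by fun_prop
  have m2 : Measurable fun st : LoopState E F => st.2.1 := by fun_prop
  have m4 : Measurable fun st : LoopState E F => st.2.2.2.1 := by fun_prop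
  have m5 : Measurable fun st : LoopState E F => st.2.2.2.2 := by fun_prop
  refine measurableSet_setOfPred.2 ?_
  refine Measurable.and (measurableSet_setOfPred.1 (m1 hX.measurableSet)) ?_
  refine Measurable.and ?_ ?_
  · refine Measurable.or ?_ ?_
    · refine Measurable.and measurable_const (Measurable.and ?_ ?_)
      · exact measurableSet_setOfPred.1 (m4 (measurableSet_singleton 0))
      · exact measurableSet_setOfPred.1 (m5 (measurableSet_singleton 0))
    · refine Measurable.and measurable_const (Measurable.and ?_ ?_)
      · exact measurableSet_setOfPred.1 ((m4.const_smul _) hX.measurableSet)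
      · exact measurableSet_setOfPred.1 (m5 hC.measurableSet)
  refine Measurable.and (Measurable.imp measurable_const
    (measurableSet_setOfPred.1 (m2 hC.measurableSet))) ?_
  refine Measurable.and (measurableSet_setOfPred.1 (?_ : MeasurableSet
    ((fun st : LoopState E F => ℓ.Z.A st.2.2.2.1 - ℓ.W k • ℓ.Z.q + ℓ.H • (st.2.1 - ℓ.y0)) ⁻¹'
      (ℓ.Z.K : Set F)))) ?_
  · have : Measurable fun st : LoopState E F =>
        ℓ.Z.A st.2.2.2.1 - ℓ.W k • ℓ.Z.q + ℓ.H • (st.2.1 - ℓ.y0) :=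
      ((ℓ.Z.A.continuous.measurable.comp m4).sub_const _).add ((m2.sub_const _).const_smul _)
    exact this hK.measurableSet
  refine Measurable.and (Measurable.imp measurable_const (measurableSet_setOfPred.1
    (?_ : MeasurableSet ((fun st : LoopState E F => inner ℝ ℓ.Z.q st.2.2.2.2) ⁻¹' {0})))) ?_
  · exact (measurable_const.inner m5) (measurableSet_singleton 0)
  · refine Measurable.imp measurable_const (Measurable.and ?_ ?_)
    · exact measurableSet_setOfPred.1 (measurableSet_le m2.norm measurable_const)
    · exact measurableSet_setOfPred.1 (measurableSet_le m5.norm measurable_const)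

theorem law_succ (hO : ℓ.Oracle) (hU : ℓ.Updates) (k : ℕ) [SFinite (ℓ.law k)] :
    ℓ.law (k + 1) = (ℓ.law k ⊗ₘ (ℓ.γ.comap Prod.fst measurable_fst)).map
      (Function.uncurry (ℓ.upd (k + 1))) := by
  have := hO.markov
  exact bind_map_eq_map_compProd (ℓ.law k) (ℓ.γ.comap Prod.fst measurable_fst) (hU.meas k)

theorem isProbabilityMeasure_law (hO : ℓ.Oracle) (hU : ℓ.Updates) (k : ℕ) :
    IsProbabilityMeasure (ℓ.law k) := by
  have := hO.markov
  induction k with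
  | zero => exact Measure.dirac.isProbabilityMeasure
  | succ k ih =>
    rw [law_succ hO hU]
    exact Measure.isProbabilityMeasure_map (hU.meas k).aemeasurable

theorem ae_law_succ (hO : ℓ.Oracle) (hU : ℓ.Updates) {k : ℕ} {p q : LoopState E F → Prop}
    (hq : MeasurableSet {st | q st}) (hp : ∀ᵐ st ∂(ℓ.law k), p st)
    (h : ∀ st G, p st → q (ℓ.upd (k + 1) st G)) : ∀ᵐ st ∂(ℓ.law (k + 1)), q st := by
  have := hO.markov
  have := isProbabilityMeasure_law hO hU k
  rw [law_succ hO hU, ae_map_iff (hU.meas k).aemeasurable hq]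
  have h1 : ∀ᵐ a ∂(ℓ.law k ⊗ₘ (ℓ.γ.comap Prod.fst measurable_fst)), p a.1 := by
    refine ae_of_ae_map measurable_fst.aemeasurable (p := p) ?_
    have := Measure.fst_compProd (ℓ.law k) (ℓ.γ.comap Prod.fst measurable_fst)
    rw [Measure.fst] at this
    rwa [this]
  filter_upwards [h1] with a ha
  exact h a.1 a.2 ha

theorem inv_zero (hU : ℓ.Updates) :
    ℓ.Inv ‖ℓ.y0‖ 0 ℓ.init := by
  refine ⟨hU.x0_mem, Or.inl ⟨ℓ.W_zero, rfl, rfl⟩, fun h => by omega, ?_, fun _ => ?_, fun _ => ?_⟩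
  · simp [W_zero, init]
  · simp [init]
  · simp [init]

theorem norm_dual_le (hZ : ℓ.Z.Valid) :
    ∃ c, 0 ≤ c ∧ ∀ x ∈ ℓ.Z.X, ‖ℓ.Z.A x - ℓ.Z.q‖ ≤ c := by
  obtain ⟨c, hc⟩ := hZ.compact.exists_bound_of_continuousOn
    (f := fun x => ℓ.Z.A x - ℓ.Z.q) (by fun_prop)
  obtain ⟨x, hx⟩ := hZ.nonempty
  exact ⟨c, (norm_nonneg _).trans (hc x hx), hc⟩

/-- If `A ≠ 0`, then `η > 0` and the dual step is coercive, which gives deterministic bounds. If `A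
= 0`, then `η = 0` and the dual minimizer need not be bounded; but comparison with `0`, together
with `hq`, forces `⟨q, y⟩ = 0`, and the gap sees the dual average only through this product. -/
theorem inv_succ (hZ : ℓ.Z.Valid) (hA : ℓ.Admissible) (hU : ℓ.Updates)
    (hq : ∀ y ∈ ℓ.Z.C, ℓ.Z.A = 0 → inner ℝ ℓ.Z.q y ≤ 0) (R : ℝ) (k : ℕ) :
    ∃ R', ∀ st G, ℓ.Inv R k st → ℓ.Inv R' (k + 1) (ℓ.upd (k + 1) st G) := by
  obtain ⟨c, hc0, hc⟩ := ℓ.norm_dual_le hZ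
  -- One radius for both bounds: the first two terms bound the new dual iterate, the bracket bounds
  -- the new weighted sum.
  refine ⟨|R| + 2 * c / ℓ.η (k + 1) + (|R| + ℓ.w (k + 1) * (|R| + 2 * c / ℓ.η (k + 1))),
    fun st G hst => ?_⟩
  obtain ⟨h1, h2, h3, h4, h5, h6⟩ := hst
  have hs := hU.spec k st G h1
  set st' := ℓ.upd (k + 1) st G with hst'
  refine ⟨hs.prox.1, ?_, fun _ => hs.dual.1, ?_, fun h0 => ?_, fun h0 => ?_⟩
  · rw [W_succ]; exact hs.sumsIn hZ (hA.w_pos k) h2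
  · have := ℓ.Z.K.add_mem h4 (ℓ.Z.K.smul_mem hs.mem_K (hA.w_pos k).le)
    have e : ℓ.Z.A st'.2.2.2.1 - ℓ.W (k + 1) • ℓ.Z.q + ℓ.H • (st'.2.1 - ℓ.y0)
        = ℓ.Z.A st.2.2.2.1 - ℓ.W k • ℓ.Z.q + ℓ.H • (st.2.1 - ℓ.y0) + ℓ.w (k + 1) •
          (ℓ.Z.A st'.1 - ℓ.Z.q + ℓ.η (k + 1) • (st'.2.1 - st.2.1)) := by
      rw [smul_add, smul_smul, hA.η_eq, W_succ, hs.sumx, map_add, map_smul, add_smul, smul_sub,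
        smul_sub, smul_sub, smul_sub]
      abel
    rw [e]
    exact this
  · have hH := hA.H_zero h0
    have hη : ℓ.η (k + 1) = 0 := by
      have := hA.η_eq k
      rw [hH] at this
      exact (mul_eq_zero.1 this).resolve_left (hA.w_pos k).ne'
    have hmin := hs.dual.2 0 ℓ.Z.C.zero_mem
    simp only [h0, hη, zero_apply, zero_sub, inner_neg_left, inner_zero_right, zero_div, zero_mul,
      add_zero] at hmin
    have := hq _ hs.dual.1 h0
    rw [hs.sumy, inner_add_right, inner_smul_right, h5 h0,
      show inner ℝ ℓ.Z.q st'.2.1 = 0 by linarith]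
    simp
  · obtain ⟨h7, h8⟩ := h6 h0
    have hη : 0 < ℓ.η (k + 1) := by
      have := hA.H_pos h0
      rw [← hA.η_eq k] at this
      exact pos_of_mul_pos_right this (hA.w_pos k).le
    have hy : ‖st'.2.1‖ ≤ |R| + 2 * c / ℓ.η (k + 1) := by
      have h9 := hs.dual_le ℓ.Z.C.zero_mem
      simp only [sub_zero, zero_sub, norm_neg] at h9
      have h10 : -(c * ‖st'.2.1‖) ≤ inner ℝ (ℓ.Z.A st'.1 - ℓ.Z.q) st'.2.1 := by
        have a := neg_le_of_abs_le (abs_real_inner_le_norm (ℓ.Z.A st'.1 - ℓ.Z.q) st'.2.1)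
        have b := mul_le_mul_of_nonneg_right (hc _ hs.prox.1) (norm_nonneg st'.2.1)
        linarith
      have h11 : ‖st.2.1‖ ^ 2 ≤ |R| ^ 2 := by
        have := h7.trans (le_abs_self R)
        gcongr
      have h12 : c = (2 * c / ℓ.η (k + 1)) * ℓ.η (k + 1) / 2 := by field_simp
      set t := 2 * c / ℓ.η (k + 1) with ht
      have ht0 : 0 ≤ t := by positivity
      -- Comparison of the dual step with `y = 0`; a quadratic inequality of this kind forces `‖y_k‖
      -- ≤ |R| + t`.
      have h13 : ‖st'.2.1‖ ^ 2 ≤ |R| ^ 2 + t * ‖st'.2.1‖ := by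
        rw [h12] at h10
        have : ℓ.η (k + 1) / 2 * (‖st'.2.1‖ ^ 2 - |R| ^ 2 - t * ‖st'.2.1‖) ≤ 0 := by
          have e1 : 0 ≤ ℓ.η (k + 1) / 2 * ‖st'.2.1 - st.2.1‖ ^ 2 := by positivity
          have e2 : ℓ.η (k + 1) / 2 * ‖st.2.1‖ ^ 2 ≤ ℓ.η (k + 1) / 2 * |R| ^ 2 := by gcongr
          nlinarith
        nlinarith [nonpos_of_mul_nonpos_right this (by positivity : 0 < ℓ.η (k + 1) / 2)]
      by_contra! hlt
      nlinarith [abs_nonneg R, norm_nonneg st'.2.1]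
    have hw := hA.w_pos k
    have hS : ‖st'.2.2.2.2‖ ≤ |R| + ℓ.w (k + 1) * (|R| + 2 * c / ℓ.η (k + 1)) := by
      rw [hs.sumy]
      refine (norm_add_le _ _).trans (add_le_add (h8.trans (le_abs_self R)) ?_)
      rw [norm_smul, Real.norm_of_nonneg hw.le]
      gcongr
    have p1 : 0 ≤ |R| + 2 * c / ℓ.η (k + 1) := by positivity
    have p2 : 0 ≤ |R| + ℓ.w (k + 1) * (|R| + 2 * c / ℓ.η (k + 1)) := by positivity
    exact ⟨by linarith, by linarith⟩

theorem ae_inv (hZ : ℓ.Z.Valid) (hA : ℓ.Admissible) (hO : ℓ.Oracle) (hU : ℓ.Updates)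
    (hq : ∀ y ∈ ℓ.Z.C, ℓ.Z.A = 0 → inner ℝ ℓ.Z.q y ≤ 0) (k : ℕ) :
    ∃ R, ∀ᵐ st ∂(ℓ.law k), ℓ.Inv R k st := by
  induction k with
  | zero =>
    refine ⟨‖ℓ.y0‖, ?_⟩
    rw [law, iterateLaw, ae_dirac_iff (measurableSet_inv hZ _ _)]
    exact inv_zero hU
  | succ k ih =>
    obtain ⟨R, hR⟩ := ih
    obtain ⟨R', hR'⟩ := inv_succ hZ hA hU hq R k
    exact ⟨R', ae_law_succ hO hU (measurableSet_inv hZ _ _) hR hR'⟩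

end

end Loop

end DSA
end

/-! ### Expected potential and expected gap of a loop. -/

noncomputable section

namespace DSA

set_option linter.unusedSectionVars false

theorem integrable_integral_of_compProd {σ V : Type*} [MeasurableSpace σ] [MeasurableSpace V]
    {m : Measure σ} [SFinite m] {κ : Kernel σ V} [IsSFiniteKernel κ] {f : σ × V → ℝ}
    (hf : Integrable f (m ⊗ₘ κ)) : Integrable (fun s => ∫ G, f (s, G) ∂(κ s)) m := by
  have h : Integrable f ((Kernel.const Unit m ⊗ₖ Kernel.prodMkLeft Unit κ) ()) := hf
  simpa using h.integral_compProd

namespace Stage.Valid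

variable {E F : Type*} [NormedAddCommGroup E] [NormedSpace ℝ E]
  [NormedAddCommGroup F] [InnerProductSpace ℝ F] [CompleteSpace F] {Z : Stage E F}

theorem continuousOn_P (hZ : Z.Valid) (x : E) : ContinuousOn (fun p => Z.P p x) Z.X := by
  have h1 : ContinuousOn Z.ω Z.X := fun p hp => (hZ.ω_deriv p hp).continuousWithinAt
  exact (continuousOn_const.sub h1).sub (hZ.ω'_cont.clm_apply (by fun_prop))

theorem continuousOn_v (hZ : Z.Valid) : ContinuousOn Z.v Z.X := by
  have : LipschitzOnWith Z.M.toNNReal Z.v Z.X :=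
    LipschitzOnWith.of_dist_le_mul fun x hx y hy => by
      rw [Real.dist_eq, dist_eq_norm, Real.coe_toNNReal _ hZ.M_nonneg]
      exact hZ.v_lip y hy x hx
  exact this.continuousOn

theorem exists_le_h (hZ : Z.Valid) : ∃ c, ∀ x ∈ Z.X, c ≤ Z.h x := by
  obtain ⟨c, hc⟩ := hZ.h_closed.bddBelow_of_isCompact hZ.compact
  exact ⟨c, fun x hx => hc ⟨x, hx, rfl⟩⟩

end Stage.Valid

namespace Loop

variable {E F : Type*} [NormedAddCommGroup E] [NormedSpace ℝ E] [MeasurableSpace E]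
  [NormedAddCommGroup F] [InnerProductSpace ℝ F]
  [FiniteDimensional ℝ E] [BorelSpace E] [FiniteDimensional ℝ F] [MeasurableSpace F]
  [BorelSpace F] {ℓ : Loop E F}

theorem aemeasurable_wgap (hZ : ℓ.Z.Valid) {m : Measure (LoopState E F)} {W : ℝ}
    (h : ∀ᵐ st ∂m, W⁻¹ • st.2.2.2.1 ∈ ℓ.Z.X) (x : E) (y : F) :
    AEMeasurable (fun st => ℓ.Z.wgap W st x y) m := by
  have m4 : Measurable fun st : LoopState E F => st.2.2.2.1 := by fun_prop
  have m5 : Measurable fun st : LoopState E F => st.2.2.2.2 := by fun_prop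
  have hX := hZ.compact.isClosed
  have a1 : AEMeasurable (fun st : LoopState E F => ℓ.Z.h (W⁻¹ • st.2.2.2.1)) m :=
    aemeasurable_comp_of_ae_mem hX hZ.h_closed (m4.const_smul W⁻¹) h
  have a2 : AEMeasurable (fun st : LoopState E F => ℓ.Z.v (W⁻¹ • st.2.2.2.1)) m :=
    aemeasurable_comp_of_ae_mem hX hZ.continuousOn_v.lowerSemicontinuousOn (m4.const_smul W⁻¹) h
  have a3 : Measurable fun st : LoopState E F => inner ℝ (W • ℓ.Z.q - ℓ.Z.A st.2.2.2.1) y :=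
    ((ℓ.Z.A.continuous.measurable.comp m4).const_sub _).inner measurable_const
  have a4 : Measurable fun st : LoopState E F => inner ℝ (ℓ.Z.q - ℓ.Z.A x) st.2.2.2.2 :=
    measurable_const.inner m5
  exact (((((a1.add a2).sub_const _).sub_const _).const_mul W).add a3.aemeasurable).sub
    a4.aemeasurable

theorem aemeasurable_pot (hZ : ℓ.Z.Valid) {m : Measure (LoopState E F)} {W : ℝ}
    (h : ∀ᵐ st ∂m, W⁻¹ • st.2.2.2.1 ∈ ℓ.Z.X) (h1 : ∀ᵐ st ∂m, st.1 ∈ ℓ.Z.X) (lam H w b : ℝ)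
    (x : E) (y : F) : AEMeasurable (fun st => ℓ.Z.pot W lam H w b st x y) m := by
  have m1 : Measurable fun st : LoopState E F => st.1 := by fun_prop
  have m2 : Measurable fun st : LoopState E F => st.2.1 := by fun_prop
  have m3 : Measurable fun st : LoopState E F => st.2.2.1 := by fun_prop
  have a0 := aemeasurable_wgap (ℓ := ℓ) hZ h x y
  have a1 : AEMeasurable (fun st : LoopState E F => ℓ.Z.P st.1 x) m :=
    aemeasurable_comp_of_ae_mem (f := fun p => ℓ.Z.P p x) hZ.compact.isClosed
      (hZ.continuousOn_P x).lowerSemicontinuousOn m1 h1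
  have a2 : Measurable fun st : LoopState E F => ‖y - st.2.1‖ ^ 2 :=
    (m2.const_sub y).norm.pow_const 2
  have a3 : Measurable fun st : LoopState E F =>
      inner ℝ (ℓ.Z.A (st.1 - x)) (st.2.1 - st.2.2.1) :=
    (ℓ.Z.A.continuous.measurable.comp (m1.sub_const x)).inner (m2.sub m3)
  have a4 : Measurable fun st : LoopState E F => ‖st.2.1 - st.2.2.1‖ ^ 2 :=
    (m2.sub m3).norm.pow_const 2
  have a5 : Measurable fun st : LoopState E F => ‖x - st.1‖ ^ 2 :=
    (m1.const_sub x).norm.pow_const 2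
  exact ((((a0.add (a1.const_mul lam)).add (a2.const_mul (H / 2)).aemeasurable).add
    (a3.const_mul w).aemeasurable).add (a4.const_mul (H / 2)).aemeasurable).sub
    (a5.const_mul b).aemeasurable

theorem abs_inner_sumy_le (ℓ : Loop E F) (R : ℝ) (k : ℕ) (x : E) :
    ∃ c, ∀ st, ℓ.Inv R k st → |inner ℝ (ℓ.Z.q - ℓ.Z.A x) st.2.2.2.2| ≤ c := by
  refine ⟨‖ℓ.Z.q - ℓ.Z.A x‖ * |R|, fun st hst => ?_⟩
  obtain ⟨h1, h2, h3, h4, h5, h6⟩ := hst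
  by_cases hA : ℓ.Z.A = 0
  · have := h5 hA
    rw [hA] at *
    simp only [zero_apply, sub_zero, this, abs_zero]
    positivity
  · refine (abs_real_inner_le_norm _ _).trans ?_
    gcongr
    exact (h6 hA).2.trans (le_abs_self R)

theorem Inv.average_mem (hA : ℓ.Admissible) {R : ℝ} {k : ℕ} {st : LoopState E F}
    (h : ℓ.Inv R (k + 1) st) : (ℓ.W (k + 1))⁻¹ • st.2.2.2.1 ∈ ℓ.Z.X := by
  rcases h.2.1 with h' | h'
  · exact absurd h'.1 (hA.W_pos k).ne'
  · exact h'.2.1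

theorem Inv.sumy_mem (hA : ℓ.Admissible) {R : ℝ} {k : ℕ} {st : LoopState E F}
    (h : ℓ.Inv R (k + 1) st) : st.2.2.2.2 ∈ ℓ.Z.C := by
  rcases h.2.1 with h' | h'
  · exact absurd h'.1 (hA.W_pos k).ne'
  · exact h'.2.2

/-- The function `h` is bounded below on `X` by lower semicontinuity and compactness, but is not
assumed bounded above. Integrability therefore comes from squeezing the potential between this
constant and the right-hand side of the one-step inequality. -/
theorem exists_le_wgap (hZ : ℓ.Z.Valid) (hA : ℓ.Admissible) (R : ℝ) (k : ℕ) {x : E}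
    (hx : x ∈ ℓ.Z.X) (y : F) :
    ∃ c, ∀ st, ℓ.Inv R (k + 1) st → c ≤ ℓ.Z.wgap (ℓ.W (k + 1)) st x y := by
  obtain ⟨a, ha⟩ := hZ.exists_le_h
  obtain ⟨c, hc0, hc⟩ := ℓ.norm_dual_le hZ
  obtain ⟨d, hd⟩ := ℓ.abs_inner_sumy_le R (k + 1) x
  have hW := hA.W_pos k
  refine ⟨ℓ.W (k + 1) * (a - ℓ.Z.M * ℓ.D - ℓ.Z.h x) - ℓ.W (k + 1) * (c * ‖y‖) - d,
    fun st hst => ?_⟩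
  have hm := hst.average_mem hA
  have h1 := ha _ hm
  have h2 := neg_le_of_abs_le (hZ.v_lip x hx _ hm)
  have h3 := hA.diam x hx _ hm
  have h4 := le_of_abs_le (hd st hst)
  have h5 : ℓ.Z.M * ‖(ℓ.W (k + 1))⁻¹ • st.2.2.2.1 - x‖ ≤ ℓ.Z.M * ℓ.D := by
    have := hZ.M_nonneg; gcongr
  have h6 : -(c * ‖y‖) ≤ inner ℝ (ℓ.Z.q - ℓ.Z.A ((ℓ.W (k + 1))⁻¹ • st.2.2.2.1)) y := by
    have b1 := neg_le_of_abs_le (abs_real_inner_le_norm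
      (ℓ.Z.q - ℓ.Z.A ((ℓ.W (k + 1))⁻¹ • st.2.2.2.1)) y)
    have b2 := mul_le_mul_of_nonneg_right (hc _ hm) (norm_nonneg y)
    rw [norm_sub_rev] at b2
    linarith
  have e : W ℓ (k + 1) • ℓ.Z.q - ℓ.Z.A st.2.2.2.1
      = W ℓ (k + 1) • (ℓ.Z.q - ℓ.Z.A ((ℓ.W (k + 1))⁻¹ • st.2.2.2.1)) := by
    rw [map_smul, smul_sub, smul_smul, mul_inv_cancel₀ hW.ne', one_smul]
  unfold Stage.wgap
  rw [e, inner_smul_left]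
  simp only [conj_trivial]
  have h7 := mul_le_mul_of_nonneg_left h6 hW.le
  have h8 : ℓ.W (k + 1) * (a - ℓ.Z.M * ℓ.D - ℓ.Z.h x) ≤ ℓ.W (k + 1) *
      (ℓ.Z.h ((ℓ.W (k + 1))⁻¹ • st.2.2.2.1) + ℓ.Z.v ((ℓ.W (k + 1))⁻¹ • st.2.2.2.1)
        - ℓ.Z.h x - ℓ.Z.v x) := by
    apply mul_le_mul_of_nonneg_left _ hW.le
    linarith
  linarith

/-- Moments of the stochastic subgradient along the loop. -/
theorem moments (hZ : ℓ.Z.Valid) (hO : ℓ.Oracle) {m : Measure (LoopState E F)}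
    [IsProbabilityMeasure m] (h1 : ∀ᵐ st ∂m, st.1 ∈ ℓ.Z.X) :
    Integrable (fun a => ‖a.2‖) (m ⊗ₘ (ℓ.γ.comap Prod.fst measurable_fst)) ∧
    Integrable (fun a => ‖a.2‖ ^ 2) (m ⊗ₘ (ℓ.γ.comap Prod.fst measurable_fst)) ∧
    ∫ a, ‖a.2‖ ∂(m ⊗ₘ (ℓ.γ.comap Prod.fst measurable_fst)) ≤ ℓ.Z.M ∧
    ∫ a, ‖a.2‖ ^ 2 ∂(m ⊗ₘ (ℓ.γ.comap Prod.fst measurable_fst)) ≤ ℓ.Z.M ^ 2 := by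
  have := hO.markov
  refine moments_of_lintegral_sq_le hZ.M_nonneg measurable_snd.aestronglyMeasurable ?_
  rw [Measure.lintegral_compProd (measurable_snd.enorm.pow_const 2)]
  calc _ ≤ ∫⁻ _, ENNReal.ofReal (ℓ.Z.M ^ 2) ∂m := by
        refine lintegral_mono_ae ?_
        filter_upwards [h1] with st hst
        exact hO.sq _ hst
    _ = _ := by simp

/-- First and second moments of `‖G‖` are at most `M` and `M²`, so `(M + ‖G‖)²` has mean at most `4
M²`. -/
theorem integral_error_le (hZ : ℓ.Z.Valid) (hO : ℓ.Oracle) {m : Measure (LoopState E F)}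
    [IsProbabilityMeasure m] (h1 : ∀ᵐ st ∂m, st.1 ∈ ℓ.Z.X) {r z : ℝ} (hr : 0 ≤ r) (hz : 0 ≤ z) :
    Integrable (fun a => r * (ℓ.Z.M + ‖a.2‖) ^ 2 + z * (ℓ.Z.M + ‖a.2‖))
      (m ⊗ₘ (ℓ.γ.comap Prod.fst measurable_fst)) ∧
    ∫ a, (r * (ℓ.Z.M + ‖a.2‖) ^ 2 + z * (ℓ.Z.M + ‖a.2‖))
      ∂(m ⊗ₘ (ℓ.γ.comap Prod.fst measurable_fst)) ≤ 4 * r * ℓ.Z.M ^ 2 + 2 * z * ℓ.Z.M := by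
  have := hO.markov
  obtain ⟨i1, i2, b1, b2⟩ := ℓ.moments hZ hO h1
  have hM := hZ.M_nonneg
  have e : ∀ a : LoopState E F × (E →L[ℝ] ℝ),
      r * (ℓ.Z.M + ‖a.2‖) ^ 2 + z * (ℓ.Z.M + ‖a.2‖)
        = r * ‖a.2‖ ^ 2 + (2 * r * ℓ.Z.M + z) * ‖a.2‖ + (r * ℓ.Z.M ^ 2 + z * ℓ.Z.M) := fun a => by
    ring
  simp_rw [e]
  have j1 := i2.const_mul r
  have j2 := i1.const_mul (2 * r * ℓ.Z.M + z)
  refine ⟨(j1.add j2).add (integrable_const _), ?_⟩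
  rw [integral_add (f := fun a : LoopState E F × (E →L[ℝ] ℝ) =>
    r * ‖a.2‖ ^ 2 + (2 * r * ℓ.Z.M + z) * ‖a.2‖) (j1.add j2) (integrable_const _),
    integral_add j1 j2, integral_const_mul, integral_const_mul]
  simp only [integral_const, probReal_univ, smul_eq_mul, one_mul]
  have c1 := mul_le_mul_of_nonneg_left b2 hr
  have c2 := mul_le_mul_of_nonneg_left b1 (by positivity : 0 ≤ 2 * r * ℓ.Z.M + z)
  nlinarith

/-- The comparator `x` is deterministic, so integrating over `G` first, with the state fixed,
reduces the claim to the oracle inequality at the current point. -/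
theorem integral_inexact_le (hZ : ℓ.Z.Valid) (hA : ℓ.Admissible) (hO : ℓ.Oracle)
    {m : Measure (LoopState E F)}
    [IsProbabilityMeasure m] (h1 : ∀ᵐ st ∂m, st.1 ∈ ℓ.Z.X) {x : E} (hx : x ∈ ℓ.Z.X) :
    Integrable (fun a : LoopState E F × (E →L[ℝ] ℝ) =>
      ℓ.Z.v a.1.1 - ℓ.Z.v x + a.2 (x - a.1.1)) (m ⊗ₘ (ℓ.γ.comap Prod.fst measurable_fst)) ∧
    ∫ a, (ℓ.Z.v a.1.1 - ℓ.Z.v x + a.2 (x - a.1.1))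
      ∂(m ⊗ₘ (ℓ.γ.comap Prod.fst measurable_fst)) ≤ ℓ.e := by
  have := hO.markov
  obtain ⟨i1, i2, b1, b2⟩ := ℓ.moments hZ hO h1
  have hM := hZ.M_nonneg
  have h2 : ∀ᵐ a ∂(m ⊗ₘ (ℓ.γ.comap Prod.fst measurable_fst)), a.1.1 ∈ ℓ.Z.X := by
    refine ae_of_ae_map measurable_fst.aemeasurable (p := fun st : LoopState E F => st.1 ∈ ℓ.Z.X) ?_
    have := Measure.fst_compProd m (ℓ.γ.comap Prod.fst measurable_fst)
    rw [Measure.fst] at this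
    rwa [this]
  have a1 : AEMeasurable (fun a : LoopState E F × (E →L[ℝ] ℝ) => ℓ.Z.v a.1.1)
      (m ⊗ₘ (ℓ.γ.comap Prod.fst measurable_fst)) :=
    aemeasurable_comp_of_ae_mem hZ.compact.isClosed hZ.continuousOn_v.lowerSemicontinuousOn
      (measurable_fst.comp measurable_fst) h2
  have a2 : Measurable (fun a : LoopState E F × (E →L[ℝ] ℝ) => a.2 (x - a.1.1)) := by
    have : Continuous fun p : (E →L[ℝ] ℝ) × E => p.1 p.2 := by fun_prop
    exact this.measurable.comp (g := fun p : (E →L[ℝ] ℝ) × E => p.1 p.2)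
      (measurable_snd.prodMk ((measurable_fst.comp measurable_fst).const_sub x))
  have j : Integrable (fun a : LoopState E F × (E →L[ℝ] ℝ) =>
      ℓ.Z.v a.1.1 - ℓ.Z.v x + a.2 (x - a.1.1)) (m ⊗ₘ (ℓ.γ.comap Prod.fst measurable_fst)) := by
    refine Integrable.mono' ((i1.mul_const ℓ.D).add (integrable_const (ℓ.Z.M * ℓ.D)))
      ((a1.sub_const _).add a2.aemeasurable).aestronglyMeasurable ?_
    filter_upwards [h2] with a ha
    rw [Real.norm_eq_abs]
    have c1 := hZ.v_lip x hx _ ha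
    have c2 := a.2.le_opNorm (x - a.1.1)
    have c3 := hA.diam _ ha x hx
    have c4 := hA.diam _ hx _ ha
    have c5 : ℓ.Z.M * ‖a.1.1 - x‖ ≤ ℓ.Z.M * ℓ.D := by gcongr
    have c6 : ‖a.2‖ * ‖x - a.1.1‖ ≤ ‖a.2‖ * ℓ.D := by gcongr
    rw [Real.norm_eq_abs] at c2
    refine (abs_add_le _ _).trans ?_
    simp only [Pi.add_apply]
    linarith
  refine ⟨j, ?_⟩
  rw [Measure.integral_compProd j]
  calc _ ≤ ∫ _, ℓ.e ∂m := by
        refine integral_mono_ae (integrable_integral_of_compProd j) (integrable_const _) ?_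
        filter_upwards [h1, (Measure.integrable_compProd_iff j.1).1 j |>.1] with st hst hi
        have hlin : Integrable (fun G : E →L[ℝ] ℝ => G (x - st.1)) (ℓ.γ st.1) := by
          have := hi.sub (integrable_const (ℓ.Z.v st.1 - ℓ.Z.v x))
          refine this.congr (Filter.Eventually.of_forall fun G => ?_)
          simp
        have e1 : ∫ G, (ℓ.Z.v st.1 - ℓ.Z.v x + G (x - st.1)) ∂(ℓ.γ st.1)
            = ℓ.Z.v st.1 - ℓ.Z.v x + ∫ G, G (x - st.1) ∂(ℓ.γ st.1) := by
          rw [integral_add (integrable_const _) hlin]; simp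
        simp only [Kernel.comap_apply]
        rw [e1]
        exact hO.sub _ hst _ hx
    _ = _ := by simp

/-- Expected value of the potential after `k` steps. -/
theorem integral_pot_le (hZ : ℓ.Z.Valid) (hA : ℓ.Admissible) (hO : ℓ.Oracle) (hU : ℓ.Updates)
    (hq : ∀ y ∈ ℓ.Z.C, ℓ.Z.A = 0 → inner ℝ ℓ.Z.q y ≤ 0) {x : E} {y : F} (hx : x ∈ ℓ.Z.X)
    (hy : y ∈ ℓ.Z.C) {k : ℕ} (hk : k ≤ ℓ.N) :
    Integrable (fun st => ℓ.Z.pot (ℓ.W k) (ℓ.lam k) ℓ.H (ℓ.w k) (ℓ.b k) st x y) (ℓ.law k) ∧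
    ∫ st, ℓ.Z.pot (ℓ.W k) (ℓ.lam k) ℓ.H (ℓ.w k) (ℓ.b k) st x y ∂(ℓ.law k)
      ≤ ℓ.lam 0 * ℓ.Z.P ℓ.x0 x + ℓ.H / 2 * ‖y - ℓ.y0‖ ^ 2 + ∑ i ∈ Finset.Icc 1 k, ℓ.err i
        + ℓ.W k * ℓ.e := by
  have := hO.markov
  induction k with
  | zero =>
    rw [law, iterateLaw]
    refine ⟨integrable_dirac (by simp [enorm_lt_top]), ?_⟩
    rw [integral_dirac]
    simp [Stage.pot, Stage.wgap, init, W_zero, hA.b_zero]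
  | succ k ih =>
    obtain ⟨ih1, ih2⟩ := ih (by omega)
    have := isProbabilityMeasure_law hO hU k
    obtain ⟨R, hR⟩ := ae_inv hZ hA hO hU hq k
    obtain ⟨R', hR'⟩ := ae_inv hZ hA hO hU hq (k + 1)
    obtain ⟨c, hc⟩ := ℓ.exists_le_wgap hZ hA R' k hx y
    have h1 : ∀ᵐ st ∂(ℓ.law k), st.1 ∈ ℓ.Z.X := hR.mono fun st h => h.1
    set ν := ℓ.law k ⊗ₘ (ℓ.γ.comap Prod.fst measurable_fst) with hν
    have hfst : ν.map Prod.fst = ℓ.law k :=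
      Measure.fst_compProd (ℓ.law k) (ℓ.γ.comap Prod.fst measurable_fst)
    have hinv : ∀ᵐ a ∂ν, ℓ.Inv R k a.1 := by
      refine ae_of_ae_map measurable_fst.aemeasurable (p := fun st => ℓ.Inv R k st) ?_
      rwa [hfst]
    obtain ⟨i1, b1⟩ := ℓ.integral_error_le hZ hO h1 (hA.r_nonneg (k + 1)) (hA.z_nonneg (k + 1))
    obtain ⟨i2, b2⟩ := ℓ.integral_inexact_le hZ hA hO h1 hx
    have i3 : Integrable (fun a => ℓ.Z.pot (ℓ.W k) (ℓ.lam k) ℓ.H (ℓ.w k) (ℓ.b k) a.1 x y) ν := by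
      rw [← hfst] at ih1
      exact ih1.comp_measurable measurable_fst
    have b3 : ∫ a, ℓ.Z.pot (ℓ.W k) (ℓ.lam k) ℓ.H (ℓ.w k) (ℓ.b k) a.1 x y ∂ν
        = ∫ st, ℓ.Z.pot (ℓ.W k) (ℓ.lam k) ℓ.H (ℓ.w k) (ℓ.b k) st x y ∂(ℓ.law k) := by
      rw [← hfst] at ih1
      rw [← hfst, integral_map measurable_fst.aemeasurable ih1.1]
    -- `ξ` is the weight of the linearization error: `w_{k+1}` in a regular step, `0` in a first
    -- step without prox term. As its mean is at most `e ≥ 0`, the bound `w_{k+1} e` serves both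
    -- cases.
    obtain ⟨ξ, hξ0, hξw, hstep⟩ : ∃ ξ, 0 ≤ ξ ∧ ξ ≤ ℓ.w (k + 1) ∧ ∀ st G, ℓ.Inv R k st →
        ℓ.Z.pot (ℓ.W (k + 1)) (ℓ.lam (k + 1)) ℓ.H (ℓ.w (k + 1)) (ℓ.b (k + 1))
          (ℓ.upd (k + 1) st G) x y
        ≤ ℓ.Z.pot (ℓ.W k) (ℓ.lam k) ℓ.H (ℓ.w k) (ℓ.b k) st x y
          + ξ * (ℓ.Z.v st.1 - ℓ.Z.v x + G (x - st.1))
          + (ℓ.r (k + 1) * (ℓ.Z.M + ‖G‖) ^ 2 + ℓ.z (k + 1) * (ℓ.Z.M + ‖G‖)) := by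
      rcases hA.step k (by omega) with ⟨g, c, hg, hAg, hb, hr⟩ | ⟨h0, hw0, hτ0, hr⟩
      · refine ⟨ℓ.w (k + 1), (hA.w_pos k).le, le_rfl, fun st G hst => ?_⟩
        rw [W_succ]
        exact (hU.spec k st G hst.1).pot_le_regular hZ hst.2.1 (hA.w_nonneg k) (hA.w_pos k)
          (hA.lam_prev k) (hA.lam_next k) (hA.η_eq k) (hA.τ_nonneg k) hA.H_nonneg hg hAg
          (hA.b_nonneg k) hb hr hA.diam hst.1 hx hy
      · subst h0
        refine ⟨0, le_rfl, (hA.w_pos 0).le, fun st G hst => ?_⟩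
        have hs := hU.spec 0 st G hst.1
        simp only [zero_add] at hs ⊢
        have hl0 : ℓ.lam 0 = 0 := by rw [← hA.lam_prev 0, zero_add, hτ0, mul_zero]
        have hl1 : ℓ.lam 1 = ℓ.w 1 * ℓ.Z.μ := by
          have := hA.lam_next 0
          rwa [zero_add, hτ0, zero_add] at this
        rw [hw0, hτ0] at hs
        rw [hl0, hw0, hA.b_zero, zero_mul, add_zero,
          show ℓ.W 1 = ℓ.W 0 + ℓ.w 1 from W_succ ℓ 0]
        exact hs.pot_le_first hZ hst.2.1 (hA.w_pos 0) hl1 (hA.η_eq 0) hA.H_nonneg hr hA.diam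
          hst.1 hx hy
    have hlaw := law_succ hO hU (ℓ := ℓ) k
    have hmeas := (hU.meas k).aemeasurable (μ := ν)
    have i4 : Integrable (fun a : LoopState E F × (E →L[ℝ] ℝ) =>
        ℓ.Z.pot (ℓ.W k) (ℓ.lam k) ℓ.H (ℓ.w k) (ℓ.b k) a.1 x y
          + ξ * (ℓ.Z.v a.1.1 - ℓ.Z.v x + a.2 (x - a.1.1))
          + (ℓ.r (k + 1) * (ℓ.Z.M + ‖a.2‖) ^ 2 + ℓ.z (k + 1) * (ℓ.Z.M + ‖a.2‖))) ν :=
      (i3.add (i2.const_mul ξ)).add i1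
    have haem : AEStronglyMeasurable (fun st => ℓ.Z.pot (ℓ.W (k + 1)) (ℓ.lam (k + 1)) ℓ.H
        (ℓ.w (k + 1)) (ℓ.b (k + 1)) st x y) (ℓ.law (k + 1)) :=
      (ℓ.aemeasurable_pot hZ (hR'.mono fun st h => h.average_mem hA) (hR'.mono fun st h => h.1)
        _ _ _ _ x y).aestronglyMeasurable
    have hlow : ∀ᵐ st ∂(ℓ.law (k + 1)), c ≤ ℓ.Z.pot (ℓ.W (k + 1)) (ℓ.lam (k + 1)) ℓ.H
        (ℓ.w (k + 1)) (ℓ.b (k + 1)) st x y := by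
      filter_upwards [hR'] with st hst
      obtain ⟨g, hg, hAg, hfin⟩ := hA.final k hk
      have hl : 0 ≤ ℓ.lam (k + 1) := by
        rw [hA.lam_next]
        have := hA.τ_nonneg k
        have := hZ.μ_nonneg
        have := hA.w_pos k
        positivity
      have := Stage.le_pot hZ (W := ℓ.W (k + 1)) (hA.w_nonneg (k + 1)) hA.H_nonneg hg hAg hl hfin
        hst.1 hx y
      have h2 := hc st hst
      have h3 := hA.H_nonneg
      have h4 : 0 ≤ ℓ.H / 2 * ‖y - st.2.1‖ ^ 2 := by positivity
      linarith
    rw [hlaw] at haem hlow ⊢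
    have hlow' := ae_of_ae_map hmeas hlow
    have hupp : ∀ᵐ a ∂ν, ℓ.Z.pot (ℓ.W (k + 1)) (ℓ.lam (k + 1)) ℓ.H
        (ℓ.w (k + 1)) (ℓ.b (k + 1)) (Function.uncurry (ℓ.upd (k + 1)) a) x y ≤
        ℓ.Z.pot (ℓ.W k) (ℓ.lam k) ℓ.H (ℓ.w k) (ℓ.b k) a.1 x y
          + ξ * (ℓ.Z.v a.1.1 - ℓ.Z.v x + a.2 (x - a.1.1))
          + (ℓ.r (k + 1) * (ℓ.Z.M + ‖a.2‖) ^ 2 + ℓ.z (k + 1) * (ℓ.Z.M + ‖a.2‖)) := by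
      filter_upwards [hinv] with a ha
      exact hstep a.1 a.2 ha
    have i5 := integrable_of_le_of_le (haem.comp_aemeasurable hmeas) hlow' hupp
      (integrable_const c) i4
    refine ⟨(integrable_map_measure haem hmeas).2 i5, ?_⟩
    rw [integral_map hmeas haem]
    refine (integral_mono_ae i5 i4 hupp).trans ?_
    have e1 : ∫ a, (ℓ.Z.pot (ℓ.W k) (ℓ.lam k) ℓ.H (ℓ.w k) (ℓ.b k) a.1 x y
          + ξ * (ℓ.Z.v a.1.1 - ℓ.Z.v x + a.2 (x - a.1.1))
          + (ℓ.r (k + 1) * (ℓ.Z.M + ‖a.2‖) ^ 2 + ℓ.z (k + 1) * (ℓ.Z.M + ‖a.2‖))) ∂ν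
        = ∫ a, ℓ.Z.pot (ℓ.W k) (ℓ.lam k) ℓ.H (ℓ.w k) (ℓ.b k) a.1 x y ∂ν
          + ξ * ∫ a, (ℓ.Z.v a.1.1 - ℓ.Z.v x + a.2 (x - a.1.1)) ∂ν
          + ∫ a, (ℓ.r (k + 1) * (ℓ.Z.M + ‖a.2‖) ^ 2 + ℓ.z (k + 1) * (ℓ.Z.M + ‖a.2‖)) ∂ν := by
      rw [← integral_const_mul, ← integral_add i3 (i2.const_mul ξ), ← integral_add _ i1]
      exact i3.add (i2.const_mul ξ)
    rw [e1, b3, Finset.sum_Icc_succ_top (by omega), W_succ]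
    have h5 : ξ * ∫ a, (ℓ.Z.v a.1.1 - ℓ.Z.v x + a.2 (x - a.1.1)) ∂ν ≤ ℓ.w (k + 1) * ℓ.e :=
      (mul_le_mul_of_nonneg_left b2 hξ0).trans (mul_le_mul_of_nonneg_right hξw hO.e_nonneg)
    unfold err at ih2 ⊢
    linarith

/-- Convergence of the loop: the expected gap function against a fixed comparator. -/
theorem integral_wgap_le (hZ : ℓ.Z.Valid) (hA : ℓ.Admissible) (hO : ℓ.Oracle) (hU : ℓ.Updates)
    (hq : ∀ y ∈ ℓ.Z.C, ℓ.Z.A = 0 → inner ℝ ℓ.Z.q y ≤ 0) {x : E} {y : F} (hx : x ∈ ℓ.Z.X)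
    (hy : y ∈ ℓ.Z.C) {k : ℕ} (hk : k + 1 ≤ ℓ.N) :
    Integrable (fun st => ℓ.Z.wgap (ℓ.W (k + 1)) st x y) (ℓ.law (k + 1)) ∧
    Integrable (fun st => ℓ.H / 2 * ‖y - st.2.1‖ ^ 2) (ℓ.law (k + 1)) ∧
    ∫ st, ℓ.Z.wgap (ℓ.W (k + 1)) st x y ∂(ℓ.law (k + 1))
        + ∫ st, ℓ.H / 2 * ‖y - st.2.1‖ ^ 2 ∂(ℓ.law (k + 1))
      ≤ ℓ.lam 0 * ℓ.Z.P ℓ.x0 x + ℓ.H / 2 * ‖y - ℓ.y0‖ ^ 2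
        + ∑ i ∈ Finset.Icc 1 (k + 1), ℓ.err i + ℓ.W (k + 1) * ℓ.e := by
  have := isProbabilityMeasure_law hO hU (ℓ := ℓ) (k + 1)
  obtain ⟨hint, hle⟩ := integral_pot_le hZ hA hO hU hq hx hy hk
  obtain ⟨R, hR⟩ := ae_inv hZ hA hO hU hq (k + 1)
  obtain ⟨c, hc⟩ := ℓ.exists_le_wgap hZ hA R k hx y
  have hH := hA.H_nonneg
  have hpot : ∀ᵐ st ∂(ℓ.law (k + 1)), ℓ.Z.wgap (ℓ.W (k + 1)) st x y
      + ℓ.H / 2 * ‖y - st.2.1‖ ^ 2 ≤ ℓ.Z.pot (ℓ.W (k + 1)) (ℓ.lam (k + 1)) ℓ.H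
        (ℓ.w (k + 1)) (ℓ.b (k + 1)) st x y := by
    filter_upwards [hR] with st hst
    obtain ⟨g, hg, hAg, hfin⟩ := hA.final k hk
    have hl : 0 ≤ ℓ.lam (k + 1) := by
      rw [hA.lam_next]
      have := hA.τ_nonneg k
      have := hZ.μ_nonneg
      have := hA.w_pos k
      positivity
    exact Stage.le_pot hZ (hA.w_nonneg (k + 1)) hA.H_nonneg hg hAg hl hfin hst.1 hx y
  have m1 := (ℓ.aemeasurable_wgap hZ (hR.mono fun st h => h.average_mem hA) x
    y).aestronglyMeasurable
  have m2 : AEStronglyMeasurable (fun st : LoopState E F => ℓ.H / 2 * ‖y - st.2.1‖ ^ 2)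
      (ℓ.law (k + 1)) := by
    have : Measurable fun st : LoopState E F => st.2.1 := by fun_prop
    exact (((this.const_sub y).norm.pow_const 2).const_mul _).aestronglyMeasurable
  have i1 : Integrable (fun st => ℓ.Z.wgap (ℓ.W (k + 1)) st x y) (ℓ.law (k + 1)) := by
    refine integrable_of_le_of_le m1 (hR.mono hc) ?_ (integrable_const c) hint
    filter_upwards [hpot] with st hst
    have : 0 ≤ ℓ.H / 2 * ‖y - st.2.1‖ ^ 2 := by positivity
    linarith
  have i2 : Integrable (fun st : LoopState E F => ℓ.H / 2 * ‖y - st.2.1‖ ^ 2)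
      (ℓ.law (k + 1)) := by
    refine integrable_of_le_of_le m2 (Filter.Eventually.of_forall fun st => ?_) ?_
      (integrable_const 0) (hint.sub (integrable_const c))
    · positivity
    · filter_upwards [hpot, hR] with st hst hst'
      have := hc st hst'
      simp only [Pi.sub_apply]
      linarith
  refine ⟨i1, i2, le_trans ?_ hle⟩
  rw [← integral_add i1 i2]
  exact integral_mono_ae (i1.add i2) hint hpot

end Loop

end DSA
end

/-! ### Measurability of the recursive procedure. -/

noncomputable section

namespace DSA

set_option linter.unusedSectionVars false

theorem measurable_map_kernel {A B C : Type*} [MeasurableSpace A] [MeasurableSpace B]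
    [MeasurableSpace C] (κ : Kernel A B) [IsSFiniteKernel κ] {f : A → B → C}
    (hf : Measurable (Function.uncurry f)) : Measurable fun a => (κ a).map (f a) := by
  refine Measure.measurable_of_measurable_coe _ fun u hu => ?_
  have : ∀ s, (κ s).map (f s) u = κ s (Prod.mk s ⁻¹' (Function.uncurry f ⁻¹' u)) := fun s => by
    rw [Measure.map_apply (hf.of_uncurry_left (x := s)) hu]; rfl
  simp_rw [this]
  exact Kernel.measurable_kernel_prodMk_left (hf hu)

theorem measurable_bind_kernel {A B C : Type*} [MeasurableSpace A] [MeasurableSpace B]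
    [MeasurableSpace C] (κ : Kernel A B) [IsSFiniteKernel κ] {f : A → B → Measure C}
    (hf : Measurable (Function.uncurry f)) : Measurable fun a => (κ a).bind (f a) := by
  refine Measure.measurable_of_measurable_coe _ fun u hu => ?_
  have : ∀ a, (κ a).bind (f a) u = ∫⁻ b, f a b u ∂(κ a) := fun a =>
    Measure.bind_apply hu (hf.of_uncurry_left (x := a)).aemeasurable
  simp_rw [this]
  exact Measurable.lintegral_kernel_prod_right' (f := fun p : A × B => f p.1 p.2 u)
    ((Measure.measurable_coe hu).comp hf)

theorem isProbabilityMeasure_bind {B C : Type*} [MeasurableSpace B]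
    [MeasurableSpace C] {μ : Measure B} [IsProbabilityMeasure μ] {f : B → Measure C}
    (hf : Measurable f) (h : ∀ b, IsProbabilityMeasure (f b)) :
    IsProbabilityMeasure (μ.bind f) := by
  constructor
  rw [Measure.bind_apply .univ hf.aemeasurable]
  simp

theorem map_bind {A B C : Type*} [MeasurableSpace A] [MeasurableSpace B]
    [MeasurableSpace C] {μ : Measure A} {f : A → Measure B} (hf : Measurable f) {g : B → C}
    (hg : Measurable g) : (μ.bind f).map g = μ.bind fun a => (f a).map g := by
  ext u hu
  have h : Measurable fun a => (f a).map g := (Measure.measurable_map g hg).comp hf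
  rw [Measure.map_apply hg hu, Measure.bind_apply (hg hu) hf.aemeasurable,
    Measure.bind_apply hu h.aemeasurable]
  exact lintegral_congr fun a => (Measure.map_apply hg hu).symm

theorem measurable_iterateLaw {A σ : Type*} [MeasurableSpace A] [MeasurableSpace σ]
    {step : A → ℕ → σ → Measure σ}
    (hs : ∀ k, Measurable fun p : A × σ => step p.1 (k + 1) p.2)
    (hp : ∀ a k st, IsProbabilityMeasure (step a (k + 1) st)) (init : σ) (n : ℕ) :
    Measurable (fun a => iterateLaw (step a) init n) ∧
      ∀ a, IsProbabilityMeasure (iterateLaw (step a) init n) := by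
  induction n with
  | zero => exact ⟨measurable_const, fun a => Measure.dirac.isProbabilityMeasure⟩
  | succ n ih =>
    refine ⟨?_, fun a => ?_⟩
    · let κ : Kernel A σ := ⟨fun a => iterateLaw (step a) init n, ih.1⟩
      have : IsMarkovKernel κ := ⟨ih.2⟩
      exact measurable_bind_kernel κ (f := fun a st => step a (n + 1) st) (hs n)
    · have := ih.2 a
      exact isProbabilityMeasure_bind ((hs n).comp measurable_prodMk_left) (hp a n)

/-- The number of iterations depends on the scenario and on the right-hand side; it takes countably
many values. -/
theorem measurable_comp_nat {A C : Type*} [MeasurableSpace A] [MeasurableSpace C]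
    {f : ℕ → A → C} (hf : ∀ n, Measurable (f n)) {N : A → ℕ} (hN : Measurable N) :
    Measurable fun a => f (N a) a :=
  (measurable_from_prod_countable_right (f := fun p : ℕ × A => f p.1 p.2) hf).comp
    (hN.prodMk measurable_id)

/-- The parameters depend measurably on the scenario and the right-hand side. -/
structure Params.Meas {S : ℕ → Type*} [∀ t, MeasurableSpace (S t)] {m : ℕ → ℕ}
    (par : Params S m) (T : ℕ) : Prop where
  N : ∀ t, 1 ≤ t → t ≤ T → Measurable fun p : S t × Y m t => par.N t p.1 p.2
  w : ∀ t, 1 ≤ t → t ≤ T → ∀ k, Measurable fun p : S t × Y m t => par.w t p.1 p.2 k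
  τ : ∀ t, 1 ≤ t → t ≤ T → ∀ k, Measurable fun p : S t × Y m t => par.τ t p.1 p.2 k
  η : ∀ t, 1 ≤ t → t ≤ T → ∀ k, Measurable fun p : S t × Y m t => par.η t p.1 p.2 k

variable {S : ℕ → Type*} [∀ t, MeasurableSpace (S t)]
  {E : ℕ → Type*} [∀ t, NormedAddCommGroup (E t)] [∀ t, NormedSpace ℝ (E t)]
  [∀ t, FiniteDimensional ℝ (E t)] [∀ t, MeasurableSpace (E t)] [∀ t, BorelSpace (E t)]
  {m : ℕ → ℕ} {P : Problem S E m} {Q : Method S E m} {par : Params S m}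

theorem measurable_spdt (hQ : P.Admissible Q) (hpar : par.Meas P.T) {t : ℕ} (h1 : 1 ≤ t)
    (hT : t ≤ P.T) (k : ℕ) :
    Measurable fun p : (S t × Y m t) × State E m t × (E t →L[ℝ] ℝ) =>
      spdt Q par t p.1.1 p.1.2 k p.2.1 p.2.2 := by
  have hprox := hQ.meas_prox t h1 hT
  have hdual := hQ.meas_dual t h1 hT
  have hw0 := (hpar.w t h1 hT (k - 1)).comp
    (measurable_fst : Measurable (Prod.fst : (S t × Y m t) × State E m t × (E t →L[ℝ] ℝ) → _))
  have hw := (hpar.w t h1 hT k).comp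
    (measurable_fst : Measurable (Prod.fst : (S t × Y m t) × State E m t × (E t →L[ℝ] ℝ) → _))
  have hτ := (hpar.τ t h1 hT k).comp
    (measurable_fst : Measurable (Prod.fst : (S t × Y m t) × State E m t × (E t →L[ℝ] ℝ) → _))
  have hη := (hpar.η t h1 hT k).comp
    (measurable_fst : Measurable (Prod.fst : (S t × Y m t) × State E m t × (E t →L[ℝ] ℝ) → _))
  have ms : Measurable fun p : (S t × Y m t) × State E m t × (E t →L[ℝ] ℝ) => p.1.1 := by fun_prop
  have mq : Measurable fun p : (S t × Y m t) × State E m t × (E t →L[ℝ] ℝ) => p.1.2 := by fun_prop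
  have mx : Measurable fun p : (S t × Y m t) × State E m t × (E t →L[ℝ] ℝ) => p.2.1.1 := by
    fun_prop
  have my : Measurable fun p : (S t × Y m t) × State E m t × (E t →L[ℝ] ℝ) => p.2.1.2.1 := by
    fun_prop
  have mz : Measurable fun p : (S t × Y m t) × State E m t × (E t →L[ℝ] ℝ) => p.2.1.2.2.1 := by
    fun_prop
  have msx : Measurable fun p : (S t × Y m t) × State E m t × (E t →L[ℝ] ℝ) => p.2.1.2.2.2.1 := by
    fun_prop
  have msy : Measurable fun p : (S t × Y m t) × State E m t × (E t →L[ℝ] ℝ) => p.2.1.2.2.2.2 := by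
    fun_prop
  have mG : Measurable fun p : (S t × Y m t) × State E m t × (E t →L[ℝ] ℝ) => p.2.2 := by
    fun_prop
  have myt := ((hw0.div hw).smul (my.sub mz)).add my
  have mxn := hprox.comp (ms.prodMk (mq.prodMk (mx.prodMk (myt.prodMk (mG.prodMk hτ)))))
  have myn := hdual.comp (ms.prodMk (mq.prodMk (mxn.prodMk (my.prodMk hη))))
  exact mxn.prodMk (myn.prodMk (my.prodMk ((msx.add (hw.smul mxn)).prodMk
    (msy.add (hw.smul myn)))))

theorem measurable_rhs (hP : P.Regular) {t : ℕ} (h1 : 1 ≤ t) (hT : t < P.T) :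
    Measurable fun p : S (t + 1) × E t => P.rhs t p.1 p.2 := by
  have hb := hP.meas_b (t + 1) (by omega) (by omega)
  have hB := hP.meas_B t h1 hT
  have : Continuous fun p : (E t →L[ℝ] Y m (t + 1)) × E t => p.1 p.2 := by fun_prop
  exact (hb.comp measurable_fst).add (this.measurable.comp
    (g := fun p : (E t →L[ℝ] Y m (t + 1)) × E t => p.1 p.2)
    ((hB.comp measurable_fst).prodMk measurable_snd))

theorem measurable_ybar (hpar : par.Meas P.T) {t : ℕ} (h1 : 1 ≤ t) (hT : t ≤ P.T) :
    Measurable fun p : (S t × Y m t) × State E m t => ybar par t p.1.1 p.1.2 p.2 := by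
  have hN := hpar.N t h1 hT
  have hsum : Measurable fun p : S t × Y m t =>
      ∑ k ∈ Finset.Icc 1 (par.N t p.1 p.2), par.w t p.1 p.2 k :=
    measurable_comp_nat (f := fun n (p : S t × Y m t) => ∑ k ∈ Finset.Icc 1 n, par.w t p.1 p.2 k)
      (fun n => Finset.measurable_sum _ fun k _ => hpar.w t h1 hT k) hN
  have msy : Measurable fun p : (S t × Y m t) × State E m t => p.2.2.2.2.2 := by
    fun_prop
  exact (hsum.comp measurable_fst).inv.smul msy

theorem measurable_stochGrad (hP : P.Regular) (hpar : par.Meas P.T) {t : ℕ} (h1 : 1 ≤ t)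
    (hT : t < P.T) :
    Measurable fun p : ((S t × E t) × S (t + 1)) × State E m (t + 1) =>
      stochGrad P par t p.1.1.1 p.1.1.2 p.1.2 p.2 := by
  have hF := (hP.meas_F' t h1 hT).comp ((measurable_fst.comp measurable_fst) :
    Measurable fun p : ((S t × E t) × S (t + 1)) × State E m (t + 1) => p.1.1)
  have hB := (hP.meas_B t h1 hT).comp ((measurable_snd.comp measurable_fst) :
    Measurable fun p : ((S t × E t) × S (t + 1)) × State E m (t + 1) => p.1.2)
  have ms' : Measurable fun p : ((S t × E t) × S (t + 1)) × State E m (t + 1) => p.1.2 := by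
    fun_prop
  have mx : Measurable fun p : ((S t × E t) × S (t + 1)) × State E m (t + 1) => p.1.1.2 := by
    fun_prop
  have hr := (measurable_rhs hP h1 hT).comp (ms'.prodMk mx)
  have hy := (measurable_ybar (E := E) hpar (t := t + 1) (by omega) (by omega)).comp
    ((ms'.prodMk hr).prodMk measurable_snd)
  have hc : Continuous fun p : Y m (t + 1) × (E t →L[ℝ] Y m (t + 1)) =>
      (innerSL ℝ p.1).comp p.2 := by fun_prop
  have hG := (hc.measurable.comp
    (g := fun p : Y m (t + 1) × (E t →L[ℝ] Y m (t + 1)) => (innerSL ℝ p.1).comp p.2)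
    (hy.prodMk hB))
  have := hF.add hG
  exact this

/-- Law of the stochastic subgradient at `x`, when `r` stages follow stage `t`. -/
def gradLaw (P : Problem S E m) (Q : Method S E m) (par : Params S m) :
    ℕ → ∀ t, S t → E t → Measure (E t →L[ℝ] ℝ)
  | 0, _ => fun _ _ => Measure.dirac 0
  | r + 1, t => fun s x => (P.κ t s).bind fun s' =>
      (run P Q par r (t + 1) s' (P.rhs t s' x)).map (stochGrad P par t s x s')

/-- One transition of the loop of stage `t`. -/
def transition (P : Problem S E m) (Q : Method S E m) (par : Params S m) (r t : ℕ) (s : S t)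
    (q : Y m t) (k : ℕ) (st : State E m t) : Measure (State E m t) :=
  (gradLaw P Q par r t s st.1).map (spdt Q par t s q k st)

theorem measurable_gradLaw_of_run (hP : P.Regular) (hpar : par.Meas P.T)
    {r t : ℕ} (h1 : 1 ≤ t) (hT : t < P.T)
    (hrun : Measurable fun p : S (t + 1) × Y m (t + 1) => run P Q par r (t + 1) p.1 p.2)
    (hprob : ∀ s q, IsProbabilityMeasure (run P Q par r (t + 1) s q)) :
    (Measurable fun p : S t × E t => gradLaw P Q par (r + 1) t p.1 p.2) ∧
      (∀ s x, IsProbabilityMeasure (gradLaw P Q par (r + 1) t s x)) ∧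
      (∀ s x, Measurable fun s' =>
        (run P Q par r (t + 1) s' (P.rhs t s' x)).map (stochGrad P par t s x s')) := by
  have hκ := hP.markov t h1 hT
  have hm := measurable_stochGrad hP hpar h1 hT
  let κ₁ : Kernel ((S t × E t) × S (t + 1)) (State E m (t + 1)) :=
    ⟨fun p => run P Q par r (t + 1) p.2 (P.rhs t p.2 p.1.2),
      hrun.comp (measurable_snd.prodMk ((measurable_rhs hP h1 hT).comp
        (measurable_snd.prodMk (measurable_snd.comp measurable_fst))))⟩
  have : IsMarkovKernel κ₁ := ⟨fun p => hprob _ _⟩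
  have hmap : Measurable fun p : (S t × E t) × S (t + 1) =>
      (run P Q par r (t + 1) p.2 (P.rhs t p.2 p.1.2)).map (stochGrad P par t p.1.1 p.1.2 p.2) :=
    measurable_map_kernel κ₁ (f := fun p st => stochGrad P par t p.1.1 p.1.2 p.2 st) hm
  have hsec : ∀ s x, Measurable fun s' =>
      (run P Q par r (t + 1) s' (P.rhs t s' x)).map (stochGrad P par t s x s') := fun s x =>
    hmap.comp (measurable_prodMk_left (x := (s, x)))
  refine ⟨?_, fun s x => ?_, hsec⟩
  · exact measurable_bind_kernel ((P.κ t).comap Prod.fst measurable_fst)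
      (f := fun (p : S t × E t) s' =>
        (run P Q par r (t + 1) s' (P.rhs t s' p.2)).map (stochGrad P par t p.1 p.2 s')) hmap
  · refine isProbabilityMeasure_bind (hsec s x) fun s' => ?_
    have := hprob s' (P.rhs t s' x)
    exact Measure.isProbabilityMeasure_map
      (hm.comp (measurable_prodMk_left (x := ((s, x), s')))).aemeasurable

/-- All randomness of an iteration enters through `G`. Collecting the nested draws into the law of
`G` turns the procedure into the Markov chain studied above; measurability of the next stage is
needed to interchange the binds with the update. -/
theorem run_eq_of_run (hP : P.Regular) (hQ : P.Admissible Q) (hpar : par.Meas P.T)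
    {r t : ℕ} (h1 : 1 ≤ t) (hT : t + r ≤ P.T)
    (hrun : ∀ r', r = r' + 1 →
      (Measurable fun p : S (t + 1) × Y m (t + 1) => run P Q par r' (t + 1) p.1 p.2) ∧
      ∀ s q, IsProbabilityMeasure (run P Q par r' (t + 1) s q)) (s : S t) (q : Y m t) :
    run P Q par r t s q
      = iterateLaw (transition P Q par r t s q) (initState Q t) (par.N t s q) := by
  have hsp : ∀ k st, Measurable (spdt Q par t s q k st) := fun k st =>
    (measurable_spdt hQ hpar h1 (by omega) k).comp
      ((measurable_const (a := (s, q))).prodMk ((measurable_const (a := st)).prodMk measurable_id))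
  cases r with
  | zero =>
    unfold run
    congr 1
    ext1 k
    ext1 st
    rw [transition, gradLaw, Measure.map_dirac' (hsp k st)]
  | succ r =>
    obtain ⟨hr1, hr2⟩ := hrun r rfl
    unfold run
    congr 1
    ext1 k
    ext1 st
    unfold transition gradLaw
    have hsec := (measurable_gradLaw_of_run hP hpar h1 (by omega) hr1 hr2).2.2 s st.1
    rw [map_bind hsec (hsp k st)]
    congr 1
    ext1 s'
    have hg : Measurable (stochGrad P par t s st.1 s') :=
      (measurable_stochGrad hP hpar h1 (by omega)).comp (measurable_prodMk_left (x := ((s, st.1), s')))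
    rw [Measure.map_map (hsp k st) hg]
    exact Measure.bind_dirac_eq_map _ ((hsp k st).comp hg)

/-- The claims are proved jointly because they feed each other: the law of `G` at stage `t` needs
the run of stage `t + 1`, and the run of stage `t` needs the law of `G` at stage `t`. -/
theorem measurable_run (hP : P.Regular) (hQ : P.Admissible Q) (hpar : par.Meas P.T) (r : ℕ) :
    ∀ t, 1 ≤ t → t + r = P.T →
      (Measurable fun p : S t × Y m t => run P Q par r t p.1 p.2) ∧
      (∀ s q, IsProbabilityMeasure (run P Q par r t s q)) ∧
      (Measurable fun p : S t × E t => gradLaw P Q par r t p.1 p.2) ∧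
      (∀ s x, IsProbabilityMeasure (gradLaw P Q par r t s x)) ∧
      ∀ s q, run P Q par r t s q
        = iterateLaw (transition P Q par r t s q) (initState Q t) (par.N t s q) := by
  induction r with
  | zero =>
    intro t h1 hT
    have heq := run_eq_of_run hP hQ hpar h1 hT.le (fun r' h => by omega)
    have hg : Measurable fun p : S t × E t => gradLaw P Q par 0 t p.1 p.2 := measurable_const
    have hgp : ∀ s x, IsProbabilityMeasure (gradLaw P Q par 0 t s x) := fun s x =>
      Measure.dirac.isProbabilityMeasure
    exact aux hQ hpar h1 (by omega) hg hgp heq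
  | succ r ih =>
    intro t h1 hT
    obtain ⟨i1, i2, -⟩ := ih (t + 1) (by omega) (by omega)
    have heq := run_eq_of_run hP hQ hpar h1 hT.le (fun r' h => by
      obtain rfl : r = r' := by omega
      exact ⟨i1, i2⟩)
    obtain ⟨hg, hgp, -⟩ := measurable_gradLaw_of_run hP hpar h1 (by omega) i1 i2
    exact aux hQ hpar h1 (by omega) hg hgp heq
where
  aux {r t : ℕ} (hQ : P.Admissible Q) (hpar : par.Meas P.T) (h1 : 1 ≤ t) (hT : t ≤ P.T)
      (hg : Measurable fun p : S t × E t => gradLaw P Q par r t p.1 p.2)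
      (hgp : ∀ s x, IsProbabilityMeasure (gradLaw P Q par r t s x))
      (heq : ∀ s q, run P Q par r t s q
        = iterateLaw (transition P Q par r t s q) (initState Q t) (par.N t s q)) :
      (Measurable fun p : S t × Y m t => run P Q par r t p.1 p.2) ∧
      (∀ s q, IsProbabilityMeasure (run P Q par r t s q)) ∧
      (Measurable fun p : S t × E t => gradLaw P Q par r t p.1 p.2) ∧
      (∀ s x, IsProbabilityMeasure (gradLaw P Q par r t s x)) ∧
      ∀ s q, run P Q par r t s q
        = iterateLaw (transition P Q par r t s q) (initState Q t) (par.N t s q) := by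
    have hsp := fun k => measurable_spdt hQ hpar h1 hT k
    let κ₁ : Kernel ((S t × Y m t) × State E m t) (E t →L[ℝ] ℝ) :=
      ⟨fun p => gradLaw P Q par r t p.1.1 p.2.1,
        hg.comp ((measurable_fst.comp measurable_fst).prodMk (measurable_fst.comp measurable_snd))⟩
    have : IsMarkovKernel κ₁ := ⟨fun p => hgp _ _⟩
    have htr : ∀ k, Measurable fun p : (S t × Y m t) × State E m t =>
        transition P Q par r t p.1.1 p.1.2 (k + 1) p.2 := fun k =>
      measurable_map_kernel κ₁ (f := fun p G => spdt Q par t p.1.1 p.1.2 (k + 1) p.2 G)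
        ((hsp (k + 1)).comp ((measurable_fst.comp measurable_fst).prodMk
          ((measurable_snd.comp measurable_fst).prodMk measurable_snd)))
    have htp : ∀ (p : S t × Y m t) k st,
        IsProbabilityMeasure (transition P Q par r t p.1 p.2 (k + 1) st) := fun p k st => by
      have := hgp p.1 st.1
      exact Measure.isProbabilityMeasure_map ((hsp (k + 1)).comp
        ((measurable_const (a := p)).prodMk
          ((measurable_const (a := st)).prodMk measurable_id))).aemeasurable
    have hit := measurable_iterateLaw
      (step := fun (p : S t × Y m t) => transition P Q par r t p.1 p.2) htr htp (initState Q t)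
    refine ⟨?_, fun s q => ?_, hg, hgp, heq⟩
    · simp_rw [heq]
      exact measurable_comp_nat (fun n => (hit n).1) (hpar.N t h1 hT)
    · rw [heq]
      exact (hit _).2 (s, q)

end DSA
end

/-! ### Value functions: convexity, and inexact subgradients from dual outputs. -/

noncomputable section

namespace DSA

set_option linter.unusedSectionVars false

variable {S : ℕ → Type*} [∀ t, MeasurableSpace (S t)]
  {E : ℕ → Type*} [∀ t, NormedAddCommGroup (E t)] [∀ t, NormedSpace ℝ (E t)]
  [∀ t, FiniteDimensional ℝ (E t)] [∀ t, MeasurableSpace (E t)] [∀ t, BorelSpace (E t)]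
  {m : ℕ → ℕ} {P : Problem S E m} {Q : Method S E m} {par : Params S m}

namespace Problem

/-- The stage problem of stage `t` with scenario `s` and right-hand side `q`. -/
def stage (P : Problem S E m) (t : ℕ) (s : S t) (q : Y m t) (μ M : ℝ) : Stage (E t) (Y m t) where
  X := P.X t
  K := P.K t
  A := P.A t s
  q := q
  h := P.h t s
  v := P.v t s
  ω := P.ω t
  ω' := P.ω' t
  α := P.α t
  μ := μ
  M := M

theorem IsSaddle.stage {t : ℕ} {s : S t} {q : Y m t} {x : E t} {y : Y m t}
    (h : P.IsSaddle t s q x y) (μ M : ℝ) : (P.stage t s q μ M).IsSaddle x y := h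

theorem IsSaddle.V_eq {t : ℕ} {s : S t} {q : Y m t} {x : E t} {y : Y m t}
    (h : P.IsSaddle t s q x y) : P.V t s q = P.h t s x + P.v t s x :=
  (h.stage 0 0).sInf_eq

theorem lagrangian_rhs (t : ℕ) (s : S t) (q q' : Y m t) (x : E t) (y : Y m t) :
    P.lagrangian t s q' x y = P.lagrangian t s q x y + inner ℝ (q' - q) y := by
  unfold lagrangian
  simp only [inner_sub_left]; ring

theorem IsSaddle.V_eq_lagrangian {t : ℕ} {s : S t} {q : Y m t} {x : E t} {y : Y m t}
    (h : P.IsSaddle t s q x y) : P.V t s q = P.lagrangian t s q x y := by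
  rw [h.V_eq]; exact (h.stage 0 0).L_eq.symm

theorem IsSaddle.lagrangian_le_V {t : ℕ} {s : S t} {q : Y m t} {x : E t} {y y' : Y m t}
    (h : P.IsSaddle t s q x y) (hy' : y' ∈ P.Kdual t) : P.lagrangian t s q x y' ≤ P.V t s q := by
  rw [h.V_eq_lagrangian]; exact h.2.2.1 y' hy'

/-- An approximate dual solution `ȳ` yields an inexact subgradient of the value function. -/
theorem IsSaddle.V_add_inner_le {t : ℕ} {s : S t} {q q' : Y m t} {x x' xb : E t}
    {y y' yb : Y m t} (h : P.IsSaddle t s q x y) (h' : P.IsSaddle t s q' x' y') (hx : xb ∈ P.X t)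
    (hy : yb ∈ P.Kdual t) :
    P.V t s q + inner ℝ (q' - q) yb - P.V t s q'
      ≤ P.lagrangian t s q xb y - P.lagrangian t s q x' yb := by
  have h1 := h'.lagrangian_le_V hy
  rw [lagrangian_rhs t s q q'] at h1
  have h2 := h.2.2.2 xb hx
  rw [← h.V_eq_lagrangian] at h2
  linarith

/-- For an exact saddle point the gap in the inexact inequality is nonpositive, so dual solutions
are genuine subgradients of `V` with respect to the right-hand side. -/
theorem IsSaddle.V_add_inner_saddle_le {t : ℕ} {s : S t} {q q' : Y m t} {x x' : E t}
    {y y' : Y m t} (h : P.IsSaddle t s q x y) (h' : P.IsSaddle t s q' x' y') :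
    P.V t s q + inner ℝ (q' - q) y ≤ P.V t s q' := by
  have h1 := h.V_add_inner_le h' h.1 h.2.1
  have h2 := h.2.2.2 x' h'.1
  linarith

theorem rhs_sub (t : ℕ) (s' : S (t + 1)) (x x' : E t) :
    P.rhs t s' x' - P.rhs t s' x = P.B t s' (x' - x) := by
  simp [rhs]

theorem v_of_lt {t : ℕ} (ht : t < P.T) (s : S t) (x : E t) :
    P.v t s x = P.F t s x + ∫ s', P.V (t + 1) s' (P.rhs t s' x) ∂(P.κ t s) := by
  have : P.T - t = (P.T - (t + 1)) + 1 := by omega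
  unfold v
  rw [this]
  rfl

theorem v_last (s : S P.T) (x : E P.T) : P.v P.T s x = 0 := by
  unfold v
  rw [Nat.sub_self]
  rfl

/-- Properties of the scenario `s` of stage `t` that hold almost surely. -/
structure GoodAt (P : Problem S E m) (Q : Method S E m) (t : ℕ) (s : S t) : Prop where
  h_convex : ConvexOn ℝ (P.X t) (P.h t s)
  h_closed : LowerSemicontinuousOn (P.h t s) (P.X t)
  prox_spec : ∀ (q : Y m t), ∀ p ∈ P.X t,
    ∀ (d : Y m t) (G : E t →L[ℝ] ℝ) (τ : ℝ), 0 ≤ τ →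
      IsArgmin (fun x => inner ℝ (q - P.A t s x) d + P.h t s x + G x + τ * P.bregman t p x)
        (P.X t) (Q.prox t (s, q, p, d, G, τ))
  dual_spec : ∀ (q : Y m t), ∀ p ∈ P.X t,
    ∀ (d : Y m t) (η : ℝ), 0 ≤ η →
      (∃ y, IsArgmin (fun y => inner ℝ (P.A t s p - q) y + η / 2 * ‖y - d‖ ^ 2) (P.Kdual t) y) →
      IsArgmin (fun y => inner ℝ (P.A t s p - q) y + η / 2 * ‖y - d‖ ^ 2)
        (P.Kdual t) (Q.dual t (s, q, p, d, η))
  F_convex : t < P.T → ConvexOn ℝ (P.X t) (P.F t s)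
  F_sub : t < P.T → ∀ x ∈ P.X t, ∀ x' ∈ P.X t,
    P.F t s x + P.F' t s x (x' - x) ≤ P.F t s x'
  next : t < P.T → ∀ᵐ s' ∂(P.κ t s), ∀ u ∈ P.X t,
    ∃ x, P.IsSaddle (t + 1) s' (P.rhs t s' u) x (Q.ystar (t + 1) (s', P.rhs t s' u))
  fin : t < P.T → ∀ x ∈ P.X t,
    Integrable (fun s' => P.V (t + 1) s' (P.rhs t s' x)) (P.κ t s)

/-- From `t = 1` on, the law of stage `t + 1` is the law of stage `t` composed with the kernel; `law
1` is a Dirac measure and not of this form, hence `1 ≤ t`. -/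
theorem ae_ae_of_ae_law {t : ℕ} (h1 : 1 ≤ t) {p : S (t + 1) → Prop}
    (h : ∀ᵐ s' ∂(P.law (t + 1)), p s') : ∀ᵐ s ∂(P.law t), ∀ᵐ s' ∂(P.κ t s), p s' := by
  obtain ⟨t, rfl⟩ : ∃ t', t = t' + 1 := ⟨t - 1, by omega⟩
  exact Measure.ae_ae_of_ae_bind (P.κ (t + 1)).measurable.aemeasurable h

theorem ae_goodAt (hP : P.Regular) (hQ : P.Admissible Q) {t : ℕ} (h1 : 1 ≤ t) (hT : t ≤ P.T) :
    ∀ᵐ s ∂(P.law t), P.GoodAt Q t s := by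
  have a : ∀ᵐ s ∂(P.law t), t < P.T → ∃ L : ℝ, ConvexOn ℝ (P.X t) (P.F t s) ∧
    ∀ x ∈ P.X t, ‖P.F' t s x‖ ≤ L ∧
      ∀ x' ∈ P.X t, |P.F t s x' - P.F t s x| ≤ L * ‖x' - x‖ ∧
        P.F t s x + P.F' t s x (x' - x) ≤ P.F t s x' := by
    by_cases h : t < P.T
    · obtain ⟨L, hL⟩ := hP.F_lipschitz t h1 h
      exact hL.mono fun s hs _ => ⟨L, hs⟩
    · exact Filter.Eventually.of_forall fun s h' => absurd h' h
  have b : ∀ᵐ s ∂(P.law t), t < P.T → ∀ᵐ s' ∂(P.κ t s), ∀ u ∈ P.X t,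
      ∃ x, P.IsSaddle (t + 1) s' (P.rhs t s' u) x (Q.ystar (t + 1) (s', P.rhs t s' u)) := by
    by_cases h : t < P.T
    · exact (ae_ae_of_ae_law h1 (hQ.ystar_spec t h1 h)).mono fun s hs _ => hs
    · exact Filter.Eventually.of_forall fun s h' => absurd h' h
  have c : ∀ᵐ s ∂(P.law t), t < P.T → ∀ x ∈ P.X t,
      Integrable (fun s' => P.V (t + 1) s' (P.rhs t s' x)) (P.κ t s) := by
    by_cases h : t < P.T
    · exact (hP.v_finite t h1 h).mono fun s hs _ => hs
    · exact Filter.Eventually.of_forall fun s h' => absurd h' h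
  filter_upwards [hP.h_convex t h1 hT, hP.h_closed t h1 hT, hQ.prox_spec t h1 hT,
    hQ.dual_spec t h1 hT, a, b, c] with s c1 c2 c3 c4 c5 c6 c7
  exact ⟨c1, c2, c3, c4, fun h => (c5 h).choose_spec.1,
    fun h x hx x' hx' => (((c5 h).choose_spec.2 x hx).2 x' hx').2, c6, c7⟩

/-- The dual solution at the convex combination gives a subgradient inequality at each endpoint; in
their weighted sum the linear terms cancel. Only integrability of `V` at fixed decisions is then
needed to integrate. -/
theorem GoodAt.v_convex (hP : P.Regular) {t : ℕ} {s : S t} (hs : P.GoodAt Q t s) (h1 : 1 ≤ t)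
    (hT : t ≤ P.T) : ConvexOn ℝ (P.X t) (P.v t s) := by
  rcases hT.lt_or_eq with hlt | rfl
  · have hX := hP.X_convex t h1 hT
    refine ⟨hX, fun u₁ hu₁ u₂ hu₂ a b ha hb hab => ?_⟩
    have hu := hX hu₁ hu₂ ha hb hab
    rw [v_of_lt hlt, v_of_lt hlt, v_of_lt hlt]
    have hF := (hs.F_convex hlt).2 hu₁ hu₂ ha hb hab
    have i1 := hs.fin hlt u₁ hu₁
    have i2 := hs.fin hlt u₂ hu₂
    have hV : ∫ s', P.V (t + 1) s' (P.rhs t s' (a • u₁ + b • u₂)) ∂(P.κ t s)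
        ≤ ∫ s', (a * P.V (t + 1) s' (P.rhs t s' u₁) + b * P.V (t + 1) s' (P.rhs t s' u₂))
          ∂(P.κ t s) := by
      refine integral_mono_ae (hs.fin hlt _ hu) ((i1.const_mul a).add (i2.const_mul b)) ?_
      filter_upwards [hs.next hlt] with s' hs'
      obtain ⟨x, hx⟩ := hs' _ hu
      obtain ⟨x₁, hx₁⟩ := hs' _ hu₁
      obtain ⟨x₂, hx₂⟩ := hs' _ hu₂
      have e1 := mul_le_mul_of_nonneg_left (hx.V_add_inner_saddle_le hx₁) ha
      have e2 := mul_le_mul_of_nonneg_left (hx.V_add_inner_saddle_le hx₂) hb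
      rw [rhs_sub] at e1 e2
      set y := Q.ystar (t + 1) (s', P.rhs t s' (a • u₁ + b • u₂))
      set V := P.V (t + 1) s' (P.rhs t s' (a • u₁ + b • u₂))
      have e3 : a * inner ℝ (P.B t s' (u₁ - (a • u₁ + b • u₂))) y
          + b * inner ℝ (P.B t s' (u₂ - (a • u₁ + b • u₂))) y = 0 := by
        have e4 : a • (u₁ - (a • u₁ + b • u₂)) + b • (u₂ - (a • u₁ + b • u₂)) = 0 := by
          have : a • (u₁ - (a • u₁ + b • u₂)) + b • (u₂ - (a • u₁ + b • u₂))
            = (a • u₁ + b • u₂) - (a + b) • (a • u₁ + b • u₂) := by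
            rw [add_smul, smul_sub, smul_sub]; abel
          rw [this, hab, one_smul, sub_self]
        have e5 := congrArg (fun z => inner ℝ (P.B t s' z) y) e4
        simpa only [map_add, map_smul, inner_add_left, inner_smul_left, conj_trivial, map_zero,
          inner_zero_left] using e5
      have e6 : a * V + b * V = V := by rw [← add_mul, hab, one_mul]
      linarith
    rw [integral_add (i1.const_mul a) (i2.const_mul b), integral_const_mul,
      integral_const_mul] at hV
    simp only [smul_eq_mul] at hF ⊢
    linarith
  · have : P.v P.T s = fun _ => 0 := by ext x; exact v_last s x
    rw [this]
    exact convexOn_const 0 (hP.X_convex _ h1 le_rfl)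

/-- The validity of the constant `M (t + 1)` for the scenario `s` of stage `t`. -/
def ValidAt (P : Problem S E m) (Q : Method S E m) (par : Params S m) (M : ℕ → ℝ) (t : ℕ)
    (s : S t) : Prop :=
  ∀ x ∈ P.X t,
    (∀ x' ∈ P.X t, |P.v t s x' - P.v t s x| ≤ M (t + 1) * ‖x' - x‖) ∧
    ∫⁻ s', ∫⁻ st, ‖stochGrad P par t s x s' st‖ₑ ^ 2
        ∂(run P Q par (P.T - (t + 1)) (t + 1) s' (P.rhs t s' x)) ∂(P.κ t s)
      ≤ ENNReal.ofReal (M (t + 1) ^ 2)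

/-- The gap function of the averaged iterates has expectation at most `e`. -/
def GapBound (P : Problem S E m) (Q : Method S E m) (par : Params S m) (t : ℕ) (s : S t)
    (q : Y m t) (e : ℝ) : Prop :=
  (∀ᵐ st ∂(run P Q par (P.T - t) t s q), xbar par t s q st ∈ P.X t ∧
    ybar par t s q st ∈ P.Kdual t) ∧
  ∀ x ∈ P.X t,
    Integrable (fun st => P.lagrangian t s q (xbar par t s q st) (Q.ystar t (s, q))
      - P.lagrangian t s q x (ybar par t s q st)) (run P Q par (P.T - t) t s q) ∧
    ∫ st, (P.lagrangian t s q (xbar par t s q st) (Q.ystar t (s, q))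
      - P.lagrangian t s q x (ybar par t s q st)) ∂(run P Q par (P.T - t) t s q) ≤ e

theorem gradLaw_moment (hP : P.Regular) (hQ : P.Admissible Q) (hpar : par.Meas P.T) {t : ℕ}
    (h1 : 1 ≤ t) (hT : t < P.T) (s : S t) (x : E t) :
    ∫⁻ G, ‖G‖ₑ ^ 2 ∂(gradLaw P Q par (P.T - t) t s x)
      = ∫⁻ s', ∫⁻ st, ‖stochGrad P par t s x s' st‖ₑ ^ 2
        ∂(run P Q par (P.T - (t + 1)) (t + 1) s' (P.rhs t s' x)) ∂(P.κ t s) := by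
  obtain ⟨r1, r2, -⟩ := measurable_run hP hQ hpar (P.T - (t + 1)) (t + 1) (by omega) (by omega)
  obtain ⟨-, -, g3⟩ := measurable_gradLaw_of_run hP hpar h1 hT r1 r2
  have hr : P.T - t = (P.T - (t + 1)) + 1 := by omega
  rw [hr, gradLaw, Measure.lintegral_bind (g3 s x).aemeasurable
    (by fun_prop)]
  refine lintegral_congr fun s' => ?_
  have hg : Measurable (stochGrad P par t s x s') :=
    (measurable_stochGrad hP hpar h1 hT).comp (measurable_prodMk_left (x := ((s, x), s')))
  rw [lintegral_map (by fun_prop) hg]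

/-- The stochastic subgradient of the value function is an inexact subgradient in expectation. -/
theorem inexact_subgradient (hP : P.Regular) (hQ : P.Admissible Q) (hpar : par.Meas P.T)
    {M : ℕ → ℝ} {t : ℕ} (h1 : 1 ≤ t) (hT : t < P.T) {s : S t} (hs : P.GoodAt Q t s)
    (hM : 0 ≤ M (t + 1)) (hv : P.ValidAt Q par M t s) {e : ℝ}
    (hgap : ∀ᵐ s' ∂(P.κ t s), ∀ u ∈ P.X t, P.GapBound Q par (t + 1) s' (P.rhs t s' u) e)
    {p x : E t} (hp : p ∈ P.X t) (hx : x ∈ P.X t) :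
    P.v t s p - P.v t s x + ∫ G, G (x - p) ∂(gradLaw P Q par (P.T - t) t s p) ≤ e := by
  have hκ := hP.markov t h1 hT
  obtain ⟨r1, r2, -⟩ := measurable_run hP hQ hpar (P.T - (t + 1)) (t + 1) (by omega) (by omega)
  obtain ⟨-, g2, g3⟩ := measurable_gradLaw_of_run hP hpar h1 hT r1 r2
  have hr : P.T - t = (P.T - (t + 1)) + 1 := by omega
  have hprob : IsProbabilityMeasure (gradLaw P Q par (P.T - t) t s p) := by
    rw [hr]; exact g2 s p
  have hmom := (gradLaw_moment hP hQ hpar h1 hT s p).le.trans (hv p hp).2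
  obtain ⟨m1, -, -, -⟩ := moments_of_lintegral_sq_le hM
    (measurable_id.aestronglyMeasurable) hmom
  have hlin : Integrable (fun G : E t →L[ℝ] ℝ => G (x - p))
      (gradLaw P Q par (P.T - t) t s p) := by
    refine Integrable.mono' (m1.mul_const ‖x - p‖) ?_ (Filter.Eventually.of_forall fun G => ?_)
    · have : Continuous fun G : E t →L[ℝ] ℝ => G (x - p) := by fun_prop
      exact this.measurable.aestronglyMeasurable
    · exact G.le_opNorm _
  let κ₂ : Kernel (S (t + 1)) (E t →L[ℝ] ℝ) := ⟨_, g3 s p⟩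
  have hlaw : gradLaw P Q par (P.T - t) t s p = (κ₂ ∘ₖ P.κ t) s := by
    rw [hr, Kernel.comp_apply]; rfl
  rw [hlaw] at hlin ⊢
  have hae := hlin.ae_of_comp
  rw [Kernel.integral_comp hlin, v_of_lt hT, v_of_lt hT]
  have i1 := hs.fin hT p hp
  have i2 := hs.fin hT x hx
  have hF := hs.F_sub hT p hp x hx
  have key : ∀ᵐ s' ∂(P.κ t s), ∫ G, G (x - p) ∂(κ₂ s')
      ≤ P.F t s x - P.F t s p + P.V (t + 1) s' (P.rhs t s' x) - P.V (t + 1) s' (P.rhs t s' p)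
        + e := by
    filter_upwards [hae, hs.next hT, hgap] with s' hi hn hg
    obtain ⟨x₀, hx₀⟩ := hn p hp
    obtain ⟨x₁, hx₁⟩ := hn x hx
    obtain ⟨ga, gb⟩ := hg p hp
    -- The comparator is a primal solution for the right-hand side generated by `x`. It depends on
    -- `s'` but not on the run at `p`, so a gap bound against fixed comparators suffices.
    obtain ⟨gi, gle⟩ := gb x₁ hx₁.1
    have hmg : Measurable (stochGrad P par t s p s') :=
      (measurable_stochGrad hP hpar h1 hT).comp (measurable_prodMk_left (x := ((s, p), s')))
    have hpr := r2 s' (P.rhs t s' p)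
    have hκ₂ : κ₂ s' = (run P Q par (P.T - (t + 1)) (t + 1) s' (P.rhs t s' p)).map
        (stochGrad P par t s p s') := rfl
    rw [hκ₂] at hi ⊢
    rw [integral_map hmg.aemeasurable hi.1]
    have hi' := (integrable_map_measure hi.1 hmg.aemeasurable).1 hi
    calc _ ≤ ∫ st, (P.F t s x - P.F t s p + P.V (t + 1) s' (P.rhs t s' x)
            - P.V (t + 1) s' (P.rhs t s' p)
            + (P.lagrangian (t + 1) s' (P.rhs t s' p) (xbar par (t + 1) s' (P.rhs t s' p) st)
              (Q.ystar (t + 1) (s', P.rhs t s' p))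
              - P.lagrangian (t + 1) s' (P.rhs t s' p) x₁
                (ybar par (t + 1) s' (P.rhs t s' p) st)))
            ∂(run P Q par (P.T - (t + 1)) (t + 1) s' (P.rhs t s' p)) := by
          refine integral_mono_ae hi' ((integrable_const _).add gi) ?_
          filter_upwards [ga] with st hst
          have h2 := hx₀.V_add_inner_le hx₁ hst.1 hst.2
          rw [rhs_sub, real_inner_comm] at h2
          have h3 : stochGrad P par t s p s' st (x - p) = P.F' t s p (x - p)
              + inner ℝ (ybar par (t + 1) s' (P.rhs t s' p) st) (P.B t s' (x - p)) := rfl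
          simp only [h3]
          linarith
      _ ≤ _ := by
          rw [integral_add (integrable_const _) gi]
          simp only [integral_const, probReal_univ, smul_eq_mul, one_mul]
          linarith
  have i3 : Integrable (fun s' => P.F t s x - P.F t s p + P.V (t + 1) s' (P.rhs t s' x)
      - P.V (t + 1) s' (P.rhs t s' p) + e) (P.κ t s) :=
    (((integrable_const _).add i2).sub i1).add (integrable_const _)
  have h4 := integral_mono_ae hlin.integral_comp i3 key
  have e5 : ∫ s', (P.F t s x - P.F t s p + P.V (t + 1) s' (P.rhs t s' x)
      - P.V (t + 1) s' (P.rhs t s' p) + e) ∂(P.κ t s)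
      = P.F t s x - P.F t s p + ∫ s', P.V (t + 1) s' (P.rhs t s' x) ∂(P.κ t s)
        - ∫ s', P.V (t + 1) s' (P.rhs t s' p) ∂(P.κ t s) + e := by
    rw [integral_add _ (integrable_const _), integral_sub _ i1, integral_add (integrable_const _) i2]
    · simp
    · exact (integrable_const _).add i2
    · exact ((integrable_const _).add i2).sub i1
  rw [e5] at h4
  linarith

end Problem

end DSA
end

/-! ### Second moments of the dual iterates. -/

noncomputable section

namespace DSA

set_option linter.unusedSectionVars false

/-- The Cauchy–Schwarz inequality with weights `W` and `w`. For `W = 0` the quotient is read as `0`,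
which is harmless since then `a = 0`. -/
theorem norm_add_smul_sq_le {F : Type*} [NormedAddCommGroup F] [InnerProductSpace ℝ F] {W w : ℝ}
    (hW : 0 ≤ W) (hw : 0 < w) {a b : F} (ha : W = 0 → a = 0) :
    ‖a + w • b‖ ^ 2 ≤ (W + w) / W * ‖a‖ ^ 2 + w * (W + w) * ‖b‖ ^ 2 := by
  have h1 : ‖a + w • b‖ ≤ ‖a‖ + w * ‖b‖ := by
    refine (norm_add_le _ _).trans ?_
    rw [norm_smul, Real.norm_of_nonneg hw.le]
  have h2 : ‖a + w • b‖ ^ 2 ≤ (‖a‖ + w * ‖b‖) ^ 2 := by gcongr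
  refine h2.trans ?_
  rcases hW.eq_or_lt with h | h
  · rw [ha h.symm, ← h]
    simp only [norm_zero]
    nlinarith
  · have : (W + w) / W * ‖a‖ ^ 2 + w * (W + w) * ‖b‖ ^ 2 - (‖a‖ + w * ‖b‖) ^ 2
        = w / W * (‖a‖ - W * ‖b‖) ^ 2 := by
      field_simp
      ring
    have h3 : 0 ≤ w / W * (‖a‖ - W * ‖b‖) ^ 2 := by positivity
    linarith

namespace Loop

variable {E F : Type*} [NormedAddCommGroup E] [NormedSpace ℝ E] [MeasurableSpace E]
  [NormedAddCommGroup F] [InnerProductSpace ℝ F] [FiniteDimensional ℝ E] [BorelSpace E]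
  [FiniteDimensional ℝ F] [MeasurableSpace F] [BorelSpace F] {ℓ : Loop E F}

/-- Second moments of the dual iterates, for the dual component of a saddle point. -/
theorem lintegral_dual_le (hZ : ℓ.Z.Valid) (hA : ℓ.Admissible) (hO : ℓ.Oracle) (hU : ℓ.Updates)
    (hq : ∀ y ∈ ℓ.Z.C, ℓ.Z.A = 0 → inner ℝ ℓ.Z.q y ≤ 0) {x : E} {y : F} (hs : ℓ.Z.IsSaddle x y)
    {k : ℕ} (hk : k + 1 ≤ ℓ.N) (hH : 0 < ℓ.H) {B : ℝ}
    (hB : ℓ.lam 0 * ℓ.Z.P ℓ.x0 x + ℓ.H / 2 * ‖y - ℓ.y0‖ ^ 2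
        + ∑ i ∈ Finset.Icc 1 (k + 1), ℓ.err i + ℓ.W (k + 1) * ℓ.e ≤ ℓ.H / 2 * B) :
    ∫⁻ st, ENNReal.ofReal (‖y - st.2.1‖ ^ 2) ∂(ℓ.law (k + 1)) ≤ ENNReal.ofReal B := by
  obtain ⟨-, i2, hle⟩ := integral_wgap_le hZ hA hO hU hq hs.1 hs.2.1 hk
  obtain ⟨R, hR⟩ := ae_inv hZ hA hO hU hq (k + 1)
  -- Against a saddle point the gap is nonnegative and is dropped; what is left of the loop estimate
  -- bounds the dual distance.
  have h0 : 0 ≤ ∫ st, ℓ.Z.wgap (ℓ.W (k + 1)) st x y ∂(ℓ.law (k + 1)) :=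
    integral_nonneg_of_ae (hR.mono fun st h => Stage.wgap_saddle_nonneg hs h.2.1)
  have i3 : Integrable (fun st : LoopState E F => ‖y - st.2.1‖ ^ 2) (ℓ.law (k + 1)) := by
    refine (i2.const_mul (ℓ.H / 2)⁻¹).congr (Filter.Eventually.of_forall fun st => ?_)
    simp only
    rw [inv_mul_cancel_left₀ (by positivity)]
  rw [← ofReal_integral_eq_lintegral_ofReal i3
    (Filter.Eventually.of_forall fun st => by positivity)]
  refine ENNReal.ofReal_le_ofReal ?_
  rw [integral_const_mul] at hle
  refine le_of_mul_le_mul_left ?_ (by positivity : 0 < ℓ.H / 2)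
  linarith

/-- Second moment of the weighted sum of the dual iterates. -/
theorem lintegral_sumy_le (hZ : ℓ.Z.Valid) (hA : ℓ.Admissible) (hO : ℓ.Oracle) (hU : ℓ.Updates)
    (hq : ∀ y ∈ ℓ.Z.C, ℓ.Z.A = 0 → inner ℝ ℓ.Z.q y ≤ 0) {x : E} {y : F} (hs : ℓ.Z.IsSaddle x y)
    (hH : 0 < ℓ.H) {B : ℝ} (hB0 : 0 ≤ B)
    (hB : ∀ k, k + 1 ≤ ℓ.N → ℓ.lam 0 * ℓ.Z.P ℓ.x0 x + ℓ.H / 2 * ‖y - ℓ.y0‖ ^ 2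
        + ∑ i ∈ Finset.Icc 1 (k + 1), ℓ.err i + ℓ.W (k + 1) * ℓ.e ≤ ℓ.H / 2 * B)
    {k : ℕ} (hk : k ≤ ℓ.N) :
    ∫⁻ st, ENNReal.ofReal (‖st.2.2.2.2 - ℓ.W k • y‖ ^ 2) ∂(ℓ.law k)
      ≤ ENNReal.ofReal (ℓ.W k ^ 2 * B) := by
  have := hO.markov
  have m2 : Measurable fun st : LoopState E F => st.2.1 := by fun_prop
  have m5 : Measurable fun st : LoopState E F => st.2.2.2.2 := by fun_prop
  induction k with
  | zero =>
    rw [law, iterateLaw, lintegral_dirac' _ (by fun_prop)]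
    simp [init, W_zero]
  | succ k ih =>
    have ih := ih (by omega)
    have := isProbabilityMeasure_law hO hU k
    obtain ⟨R, hR⟩ := ae_inv hZ hA hO hU hq k
    have hW := hA.W_nonneg k
    have hw := hA.w_pos k
    set ν := ℓ.law k ⊗ₘ (ℓ.γ.comap Prod.fst measurable_fst) with hν
    have hfst : ν.map Prod.fst = ℓ.law k :=
      Measure.fst_compProd (ℓ.law k) (ℓ.γ.comap Prod.fst measurable_fst)
    have hinv : ∀ᵐ a ∂ν, ℓ.Inv R k a.1 := by
      refine ae_of_ae_map measurable_fst.aemeasurable (p := fun st => ℓ.Inv R k st) ?_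
      rwa [hfst]
    have hd := lintegral_dual_le hZ hA hO hU hq hs hk hH (hB k hk)
    rw [law_succ hO hU, lintegral_map (by fun_prop) (hU.meas k)] at hd ⊢
    rw [← hfst, lintegral_map (by fun_prop) measurable_fst] at ih
    have hpt : ∀ᵐ a ∂ν, ENNReal.ofReal
        (‖(Function.uncurry (ℓ.upd (k + 1)) a).2.2.2.2 - ℓ.W (k + 1) • y‖ ^ 2)
        ≤ ENNReal.ofReal ((ℓ.W k + ℓ.w (k + 1)) / ℓ.W k)
          * ENNReal.ofReal (‖a.1.2.2.2.2 - ℓ.W k • y‖ ^ 2)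
        + ENNReal.ofReal (ℓ.w (k + 1) * (ℓ.W k + ℓ.w (k + 1)))
          * ENNReal.ofReal (‖y - (Function.uncurry (ℓ.upd (k + 1)) a).2.1‖ ^ 2) := by
      filter_upwards [hinv] with a ha
      rw [← ENNReal.ofReal_mul (by positivity), ← ENNReal.ofReal_mul (by positivity),
        ← ENNReal.ofReal_add (by positivity) (by positivity)]
      refine ENNReal.ofReal_le_ofReal ?_
      have h1 := (hU.spec k a.1 a.2 ha.1).sumy
      have h2 : (Function.uncurry (ℓ.upd (k + 1)) a).2.2.2.2 - ℓ.W (k + 1) • y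
          = (a.1.2.2.2.2 - ℓ.W k • y)
            + ℓ.w (k + 1) • ((Function.uncurry (ℓ.upd (k + 1)) a).2.1 - y) := by
        rw [Function.uncurry_def]
        simp only
        rw [h1, W_succ, add_smul, smul_sub]
        abel
      rw [h2, norm_sub_rev y]
      refine norm_add_smul_sq_le hW hw fun h0 => ?_
      rcases ha.2.1 with ⟨-, -, h⟩ | ⟨h, -⟩
      · rw [h, h0, zero_smul, sub_zero]
      · exact absurd h0 h.ne'
    refine (lintegral_mono_ae hpt).trans ?_
    have m6 : Measurable fun a : LoopState E F × (E →L[ℝ] ℝ) =>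
        ENNReal.ofReal (‖a.1.2.2.2.2 - ℓ.W k • y‖ ^ 2) := by fun_prop
    have m7 : Measurable fun a : LoopState E F × (E →L[ℝ] ℝ) =>
        ENNReal.ofReal (‖y - (Function.uncurry (ℓ.upd (k + 1)) a).2.1‖ ^ 2) :=
      (((m2.comp (hU.meas k)).const_sub y).norm.pow_const 2).ennreal_ofReal
    rw [lintegral_add_left (m6.const_mul _), lintegral_const_mul _ m6, lintegral_const_mul _ m7]
    refine (add_le_add (mul_le_mul_right ih _) (mul_le_mul_right hd _)).trans ?_
    rw [← ENNReal.ofReal_mul (by positivity), ← ENNReal.ofReal_mul (by positivity),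
      ← ENNReal.ofReal_add (by positivity) (by positivity)]
    refine ENNReal.ofReal_le_ofReal (le_of_eq ?_)
    rw [W_succ]
    rcases hW.eq_or_lt with h | h
    · rw [← h]
      simp only [div_zero, zero_mul, zero_add]
      ring
    · field_simp

end Loop

end DSA
end

/-! ### From abstract loops to stages: certificates and backward recursion of the gap bounds. -/

noncomputable section

namespace DSA

set_option linter.unusedSectionVars false

/-- Quantities that enter the analysis of a loop, besides the step sizes. -/
structure Cert where
  H : ℝ
  D : ℝ
  lam : ℕ → ℝ
  b : ℕ → ℝ
  r : ℕ → ℝ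
  z : ℕ → ℝ

/-- The total error of the first `k` steps. -/
def Cert.err (c : Cert) (M : ℝ) (k : ℕ) : ℝ :=
  ∑ i ∈ Finset.Icc 1 k, (4 * c.r i * M ^ 2 + 2 * c.z i * M)

variable {S : ℕ → Type*} [∀ t, MeasurableSpace (S t)]
  {E : ℕ → Type*} [∀ t, NormedAddCommGroup (E t)] [∀ t, NormedSpace ℝ (E t)]
  [∀ t, FiniteDimensional ℝ (E t)] [∀ t, MeasurableSpace (E t)] [∀ t, BorelSpace (E t)]
  {m : ℕ → ℕ} {P : Problem S E m} {Q : Method S E m} {par : Params S m}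

open Classical in
/-- `gradLaw` as a kernel. -/
def gradKernel (P : Problem S E m) (Q : Method S E m) (par : Params S m) (t : ℕ) (s : S t) :
    Kernel (E t) (E t →L[ℝ] ℝ) :=
  if h : Measurable (gradLaw P Q par (P.T - t) t s) then ⟨_, h⟩ else 0

namespace Problem

/-- The loop of stage `t` with scenario `s` and right-hand side `q`. -/
def loop (P : Problem S E m) (Q : Method S E m) (par : Params S m) (t : ℕ) (s : S t) (q : Y m t)
    (μ M e : ℝ) (c : Cert) : Loop (E t) (Y m t) where
  Z := P.stage t s q μ M
  γ := gradKernel P Q par t s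
  upd := spdt Q par t s q
  x0 := Q.x0 t
  y0 := Q.y0 t
  N := par.N t s q
  w := par.w t s q
  τ := par.τ t s q
  η := par.η t s q
  e := e
  H := c.H
  D := c.D
  lam := c.lam
  b := c.b
  r := c.r
  z := c.z

theorem gradKernel_apply (hP : P.Regular) (hQ : P.Admissible Q) (hpar : par.Meas P.T) {t : ℕ}
    (h1 : 1 ≤ t) (hT : t ≤ P.T) (s : S t) (x : E t) :
    gradKernel P Q par t s x = gradLaw P Q par (P.T - t) t s x := by
  obtain ⟨-, -, hg, -⟩ := measurable_run hP hQ hpar (P.T - t) t h1 (by omega)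
  have : Measurable (gradLaw P Q par (P.T - t) t s) :=
    hg.comp (measurable_prodMk_left (x := s))
  rw [gradKernel, dif_pos this]
  rfl

theorem law_loop (hP : P.Regular) (hQ : P.Admissible Q) (hpar : par.Meas P.T) {t : ℕ}
    (h1 : 1 ≤ t) (hT : t ≤ P.T) (s : S t) (q : Y m t) (μ M e : ℝ) (c : Cert) :
    (P.loop Q par t s q μ M e c).law (par.N t s q) = run P Q par (P.T - t) t s q := by
  obtain ⟨-, -, -, -, heq⟩ := measurable_run hP hQ hpar (P.T - t) t h1 (by omega)
  rw [heq, Loop.law]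
  have : (fun k (st : LoopState (E t) (Y m t)) =>
      ((P.loop Q par t s q μ M e c).γ st.1).map ((P.loop Q par t s q μ M e c).upd k st))
      = transition P Q par (P.T - t) t s q := by
    ext1 k
    ext1 st
    unfold transition
    rw [← gradKernel_apply hP hQ hpar h1 hT]
    rfl
  rw [this]
  rfl

theorem bregman_bddAbove (hP : P.Regular) {t : ℕ} (h1 : 1 ≤ t) (hT : t ≤ P.T) :
    BddAbove {r | ∃ p ∈ P.X t, ∃ x ∈ P.X t, r = P.bregman t p x} := by
  have hX := hP.X_compact t h1 hT
  have hω : ContinuousOn (P.ω t) (P.X t) := fun p hp =>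
    (hP.ω_deriv t h1 hT p hp).continuousWithinAt
  have hc : ContinuousOn (fun z : E t × E t => P.bregman t z.1 z.2) (P.X t ×ˢ P.X t) := by
    unfold bregman
    refine ContinuousOn.sub (ContinuousOn.sub ?_ ?_) (ContinuousOn.clm_apply ?_ (by fun_prop))
    · exact hω.comp continuousOn_snd fun z hz => hz.2
    · exact hω.comp continuousOn_fst fun z hz => hz.1
    · exact (hP.ω'_cont t h1 hT).comp continuousOn_fst fun z hz => hz.1
  refine ((hX.prod hX).bddAbove_image hc).mono ?_
  rintro r ⟨p, hp, x, hx, rfl⟩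
  exact ⟨(p, x), ⟨hp, hx⟩, rfl⟩

theorem bregman_le_Ω (hP : P.Regular) {t : ℕ} (h1 : 1 ≤ t) (hT : t ≤ P.T) {p x : E t}
    (hp : p ∈ P.X t) (hx : x ∈ P.X t) : P.bregman t p x ≤ P.Ω t ^ 2 := by
  have h := le_csSup (bregman_bddAbove hP h1 hT) ⟨p, hp, x, hx, rfl⟩
  have h0 : 0 ≤ P.bregman t p x :=
    breg_nonneg (hP.X_convex t h1 hT) (hP.α_pos t h1 hT).le hp hx (hP.ω_deriv t h1 hT p hp)
      (hP.ω_strong t h1 hT)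
  unfold Ω
  rw [Real.sq_sqrt (h0.trans h)]
  exact h

theorem norm_sub_le_Ω (hP : P.Regular) {t : ℕ} (h1 : 1 ≤ t) (hT : t ≤ P.T) {p x : E t}
    (hp : p ∈ P.X t) (hx : x ∈ P.X t) : ‖x - p‖ ≤ √(2 / P.α t) * P.Ω t := by
  have hα := hP.α_pos t h1 hT
  have h := (le_breg (hP.X_convex t h1 hT) hp hx (hP.ω_deriv t h1 hT p hp)
      (hP.ω_strong t h1 hT)).trans (bregman_le_Ω hP h1 hT hp hx)
  have hΩ : 0 ≤ P.Ω t := Real.sqrt_nonneg _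
  refine (abs_le_of_sq_le_sq' ?_ (by positivity)).2
  rw [mul_pow, Real.sq_sqrt (by positivity), div_mul_eq_mul_div, le_div_iff₀ hα]
  linarith

/-- `μ` is a modulus of `h` relative to the distance generating function. -/
def ModulusAt (P : Problem S E m) (t : ℕ) (s : S t) (μ : ℝ) : Prop :=
  0 ≤ μ ∧ ∀ x₂ ∈ P.X t, ∀ g : E t →L[ℝ] ℝ,
    (∀ x ∈ P.X t, P.h t s x₂ + g (x - x₂) ≤ P.h t s x) →
    ∀ x₁ ∈ P.X t, μ * P.bregman t x₂ x₁ ≤ P.h t s x₁ - P.h t s x₂ - g (x₁ - x₂)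

/-- With modulus zero the requirement is the subgradient inequality itself, so the general convex
case is an instance of the same analysis. -/
theorem modulusAt_zero (P : Problem S E m) (t : ℕ) (s : S t) : P.ModulusAt t s 0 :=
  ⟨le_rfl, fun x₂ _ g hg x₁ hx₁ => by linarith [hg x₁ hx₁]⟩

/-- The Lipschitz constant of the cost-to-go function of stage `t`. -/
def stageM (P : Problem S E m) (M : ℕ → ℝ) (t : ℕ) : ℝ := if t < P.T then M (t + 1) else 0

theorem valid_stage (hP : P.Regular) {t : ℕ} (h1 : 1 ≤ t) (hT : t ≤ P.T) {s : S t}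
    (hs : P.GoodAt Q t s) {μ : ℝ} (hμ : P.ModulusAt t s μ) {M : ℕ → ℝ}
    (hM : t < P.T → 0 ≤ M (t + 1) ∧ P.ValidAt Q par M t s) (q : Y m t) :
    (P.stage t s q μ (P.stageM M t)).Valid where
  nonempty := hP.X_nonempty t h1 hT
  compact := hP.X_compact t h1 hT
  convex := hP.X_convex t h1 hT
  α_pos := hP.α_pos t h1 hT
  ω_deriv := hP.ω_deriv t h1 hT
  ω'_cont := hP.ω'_cont t h1 hT
  ω_strong := hP.ω_strong t h1 hT
  h_convex := hs.h_convex
  h_closed := hs.h_closed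
  μ_nonneg := hμ.1
  h_strong := hμ.2
  v_convex := hs.v_convex hP h1 hT
  M_nonneg := by
    show 0 ≤ P.stageM M t
    unfold stageM
    split_ifs with h
    · exact (hM h).1
    · exact le_rfl
  v_lip := by
    show ∀ x ∈ P.X t, ∀ x' ∈ P.X t, |P.v t s x' - P.v t s x| ≤ P.stageM M t * ‖x' - x‖
    intro x hx x' hx'
    unfold stageM
    split_ifs with h
    · exact ((hM h).2 x hx).1 x' hx'
    · obtain rfl : t = P.T := by omega
      simp [v_last]

theorem oracle_loop (hP : P.Regular) (hQ : P.Admissible Q) (hpar : par.Meas P.T) {t : ℕ}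
    (h1 : 1 ≤ t) (hT : t ≤ P.T) {s : S t} (hs : P.GoodAt Q t s) {M : ℕ → ℝ}
    (hM : t < P.T → 0 ≤ M (t + 1) ∧ P.ValidAt Q par M t s) {e : ℝ} (he : 0 ≤ e)
    (hgap : t < P.T → ∀ᵐ s' ∂(P.κ t s), ∀ u ∈ P.X t,
      P.GapBound Q par (t + 1) s' (P.rhs t s' u) e) (q : Y m t) (μ : ℝ) (c : Cert) :
    (P.loop Q par t s q μ (P.stageM M t) e c).Oracle where
  markov := ⟨fun x => by
    obtain ⟨-, -, -, hp, -⟩ := measurable_run hP hQ hpar (P.T - t) t h1 (by omega)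
    have := hp s x
    rw [← gradKernel_apply hP hQ hpar h1 hT] at this
    exact this⟩
  e_nonneg := he
  sq := by
    intro x hx
    show ∫⁻ G, ‖G‖ₑ ^ 2 ∂(gradKernel P Q par t s x) ≤ ENNReal.ofReal (P.stageM M t ^ 2)
    rw [gradKernel_apply hP hQ hpar h1 hT]
    unfold stageM
    split_ifs with h
    · rw [gradLaw_moment hP hQ hpar h1 h]
      exact ((hM h).2 x hx).2
    · obtain rfl : t = P.T := by omega
      rw [Nat.sub_self, gradLaw, lintegral_dirac]
      rw [← ofReal_norm, norm_zero, ENNReal.ofReal_zero]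
      simp
  sub := by
    intro p hp x hx
    show P.v t s p - P.v t s x + ∫ G, G (x - p) ∂(gradKernel P Q par t s p) ≤ e
    rw [gradKernel_apply hP hQ hpar h1 hT]
    by_cases h : t < P.T
    · exact inexact_subgradient hP hQ hpar h1 h hs (hM h).1 (hM h).2 (hgap h) hp hx
    · obtain rfl : t = P.T := by omega
      rw [Nat.sub_self, gradLaw, integral_dirac, v_last, v_last]
      simpa using he

theorem updates_loop (hQ : P.Admissible Q) (hpar : par.Meas P.T) {t : ℕ}
    (h1 : 1 ≤ t) (hT : t ≤ P.T) {s : S t} (hs : P.GoodAt Q t s) {q : Y m t} {x : E t} {y : Y m t}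
    (hsad : P.IsSaddle t s q x y) {μ M e : ℝ} {c : Cert}
    (hA : (P.loop Q par t s q μ M e c).Admissible) :
    (P.loop Q par t s q μ M e c).Updates where
  meas := fun k => (measurable_spdt hQ hpar h1 hT (k + 1)).comp
    ((measurable_const (a := (s, q))).prodMk measurable_id)
  x0_mem := hQ.x0_mem t h1 hT
  spec := by
    intro k st G hst
    have hτ : 0 ≤ par.τ t s q (k + 1) := hA.τ_nonneg k
    have hw : 0 < par.w t s q (k + 1) := hA.w_pos k
    have hη : par.w t s q (k + 1) * par.η t s q (k + 1) = c.H := hA.η_eq k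
    have hprox := hs.prox_spec q st.1 hst
      ((par.w t s q k / par.w t s q (k + 1)) • (st.2.1 - st.2.2.1) + st.2.1) G _ hτ
    set x' := Q.prox t (s, q, st.1,
      (par.w t s q k / par.w t s q (k + 1)) • (st.2.1 - st.2.2.1) + st.2.1, G,
      par.τ t s q (k + 1)) with hx'
    have hdual : IsArgmin (fun y => inner ℝ (P.A t s x' - q) y
        + par.η t s q (k + 1) / 2 * ‖y - st.2.1‖ ^ 2) (P.Kdual t)
        (Q.dual t (s, q, x', st.2.1, par.η t s q (k + 1))) := by
      have hη0 : 0 ≤ par.η t s q (k + 1) := by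
        have : 0 ≤ c.H := hA.H_nonneg
        rw [← hη] at this
        exact nonneg_of_mul_nonneg_right this hw
      refine hs.dual_spec q x' hprox.1 st.2.1 _ hη0 ?_
      by_cases h0 : P.A t s = 0
      · have hH : c.H = 0 := hA.H_zero h0
        have : par.η t s q (k + 1) = 0 := by
          rw [hH] at hη
          exact (mul_eq_zero.1 hη).resolve_left hw.ne'
        have h2 := fun y' hy' => (hsad.stage μ M).inner_nonpos (y' := y') hy'
        -- For `A = 0` the dual objective is the linear function `-⟨q, y⟩`. It is nonnegative on the
        -- dual cone because a saddle point exists, so `0` is a minimizer even though `η = 0`.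
        refine ⟨0, (P.stage t s q μ M).C.zero_mem, fun z hz => ?_⟩
        have h3 : inner ℝ (q - P.A t s x) z ≤ 0 := h2 z hz
        simp only [h0, this, zero_apply, zero_sub, inner_neg_left, inner_zero_right, zero_div,
          zero_mul, add_zero, sub_zero] at h3 ⊢
        linarith
      · have hH : 0 < c.H := hA.H_pos h0
        rw [← hη] at hH
        exact exists_isArgmin_dual ⟨0, (P.stage t s q μ M).C.zero_mem⟩
          (P.stage t s q μ M).C.isClosed (P.stage t s q μ M).C.convex _ _
          (pos_of_mul_pos_right hH hw.le)
    exact ⟨hprox, hdual, rfl, rfl, rfl⟩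

/-- The step sizes of stage `t` are admissible, with the certificate `c`. -/
def Fits (P : Problem S E m) (Q : Method S E m) (par : Params S m) (t : ℕ) (s : S t) (q : Y m t)
    (μ M : ℝ) (c : Cert) : Prop :=
  1 ≤ par.N t s q ∧ ∀ e, (P.loop Q par t s q μ M e c).Admissible

theorem inner_rhs_nonpos {t : ℕ} {s : S t} {q : Y m t} {x₀ : E t} {y₀ : Y m t}
    (hsad : P.IsSaddle t s q x₀ y₀) (μ M : ℝ) :
    ∀ y ∈ (P.stage t s q μ M).C, P.A t s = 0 → inner ℝ q y ≤ 0 := by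
  intro y hy h0
  have h3 : inner ℝ (q - P.A t s x₀) y ≤ 0 := (hsad.stage μ M).inner_nonpos hy
  simpa [h0] using h3

/-- Total weight of the loop of stage `t`. -/
def weight (par : Params S m) (t : ℕ) (s : S t) (q : Y m t) : ℝ :=
  ∑ k ∈ Finset.Icc 1 (par.N t s q), par.w t s q k

/-- What the analysis of the loop says about the final state. -/
theorem run_estimates (hP : P.Regular) (hQ : P.Admissible Q) (hpar : par.Meas P.T) {t : ℕ}
    (h1 : 1 ≤ t) (hT : t ≤ P.T) {s : S t} (hs : P.GoodAt Q t s) {μ : ℝ}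
    (hμ : P.ModulusAt t s μ) {M : ℕ → ℝ}
    (hM : t < P.T → 0 ≤ M (t + 1) ∧ P.ValidAt Q par M t s) {e : ℝ} (he : 0 ≤ e)
    (hgap : t < P.T → ∀ᵐ s' ∂(P.κ t s), ∀ u ∈ P.X t,
      P.GapBound Q par (t + 1) s' (P.rhs t s' u) e) {q : Y m t} {x₀ : E t} {y₀ : Y m t}
    (hsad : P.IsSaddle t s q x₀ y₀) {c : Cert}
    (hfit : P.Fits Q par t s q μ (P.stageM M t) c) :
    0 < weight par t s q ∧
    (∃ R, ∀ᵐ st ∂(run P Q par (P.T - t) t s q),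
      (P.loop Q par t s q μ (P.stageM M t) e c).Inv R (par.N t s q) st ∧
        xbar par t s q st ∈ P.X t ∧ ybar par t s q st ∈ P.Kdual t) ∧
    ∀ x ∈ P.X t, ∀ y ∈ P.Kdual t,
      Integrable (fun st => P.lagrangian t s q (xbar par t s q st) y
        - P.lagrangian t s q x (ybar par t s q st)) (run P Q par (P.T - t) t s q) ∧
      Integrable (fun st => c.H / 2 * ‖y - st.2.1‖ ^ 2) (run P Q par (P.T - t) t s q) ∧
      weight par t s q * ∫ st, (P.lagrangian t s q (xbar par t s q st) y
        - P.lagrangian t s q x (ybar par t s q st)) ∂(run P Q par (P.T - t) t s q)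
        + ∫ st, c.H / 2 * ‖y - st.2.1‖ ^ 2 ∂(run P Q par (P.T - t) t s q)
      ≤ c.lam 0 * P.bregman t (Q.x0 t) x + c.H / 2 * ‖y - Q.y0 t‖ ^ 2
        + c.err (P.stageM M t) (par.N t s q) + weight par t s q * e := by
  have hZ := valid_stage hP h1 hT hs hμ hM q
  have hO := oracle_loop hP hQ hpar h1 hT hs hM he hgap q μ c
  have hA := hfit.2 e
  have hU := updates_loop hQ hpar h1 hT hs hsad hA
  have hq := inner_rhs_nonpos hsad μ (P.stageM M t)
  set ℓ := P.loop Q par t s q μ (P.stageM M t) e c with hℓ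
  obtain ⟨k, hk⟩ : ∃ k, par.N t s q = k + 1 := ⟨par.N t s q - 1, by have := hfit.1; omega⟩
  have hlaw : ℓ.law (k + 1) = run P Q par (P.T - t) t s q := by
    rw [← hk]; exact law_loop hP hQ hpar h1 hT s q _ _ _ _
  have hW : weight par t s q = ℓ.W (k + 1) := by
    rw [weight, hk]; rfl
  have hWpos := hA.W_pos k
  obtain ⟨R, hR⟩ := Loop.ae_inv hZ hA hO hU hq (k + 1)
  rw [hlaw] at hR
  have hxb : ∀ st : State E m t, xbar par t s q st = (ℓ.W (k + 1))⁻¹ • st.2.2.2.1 := fun st => by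
    rw [← hW]; rfl
  have hyb : ∀ st : State E m t, ybar par t s q st = (ℓ.W (k + 1))⁻¹ • st.2.2.2.2 := fun st => by
    rw [← hW]; rfl
  refine ⟨hW ▸ hWpos, ⟨R, ?_⟩, fun x hx y hy => ?_⟩
  · filter_upwards [hR] with st hst
    rw [hxb, hyb, hk]
    exact ⟨hst, hst.average_mem hA, ℓ.Z.C.smul_mem (hst.sumy_mem hA) (by positivity)⟩
  · have hkN : k + 1 ≤ ℓ.N := by rw [← hk]; rfl
    obtain ⟨i1, i2, hle⟩ := Loop.integral_wgap_le hZ hA hO hU hq (x := x) (y := y) hx hy hkN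
    rw [hlaw] at i1 i2 hle
    have hgapeq : ∀ st, ℓ.Z.wgap (ℓ.W (k + 1)) st x y = ℓ.W (k + 1) *
        (P.lagrangian t s q (xbar par t s q st) y
          - P.lagrangian t s q x (ybar par t s q st)) := fun st => by
      rw [ℓ.Z.wgap_eq hWpos, hxb, hyb]; rfl
    simp_rw [hgapeq] at i1 hle
    have i3 : Integrable (fun st => P.lagrangian t s q (xbar par t s q st) y
        - P.lagrangian t s q x (ybar par t s q st)) (run P Q par (P.T - t) t s q) := by
      refine (i1.const_mul (ℓ.W (k + 1))⁻¹).congr (Filter.Eventually.of_forall fun st => ?_)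
      simp only
      rw [inv_mul_cancel_left₀ hWpos.ne']
    refine ⟨i3, i2, ?_⟩
    rw [integral_const_mul, ← hW] at hle
    rw [hk]
    exact hle

/-- `e` is inherited from the later stages through the stochastic subgradients and `e'` is the error
of this loop; they add up. The Bregman distance to the comparator is replaced by `Ω²`, and the final
dual distance, being nonnegative, is dropped. -/
theorem gapBound_of_fits (hP : P.Regular) (hQ : P.Admissible Q) (hpar : par.Meas P.T) {t : ℕ}
    (h1 : 1 ≤ t) (hT : t ≤ P.T) {s : S t} (hs : P.GoodAt Q t s) {μ : ℝ}
    (hμ : P.ModulusAt t s μ) {M : ℕ → ℝ}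
    (hM : t < P.T → 0 ≤ M (t + 1) ∧ P.ValidAt Q par M t s) {e : ℝ} (he : 0 ≤ e)
    (hgap : t < P.T → ∀ᵐ s' ∂(P.κ t s), ∀ u ∈ P.X t,
      P.GapBound Q par (t + 1) s' (P.rhs t s' u) e) {q : Y m t} {x₀ : E t}
    (hsad : P.IsSaddle t s q x₀ (Q.ystar t (s, q))) {c : Cert}
    (hfit : P.Fits Q par t s q μ (P.stageM M t) c) (hlam : 0 ≤ c.lam 0) {e' : ℝ}
    (herr : c.lam 0 * P.Ω t ^ 2 + c.H / 2 * ‖Q.ystar t (s, q) - Q.y0 t‖ ^ 2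
      + c.err (P.stageM M t) (par.N t s q) ≤ weight par t s q * e') :
    P.GapBound Q par t s q (e' + e) := by
  obtain ⟨hW, ⟨R, hR⟩, hmain⟩ := run_estimates hP hQ hpar h1 hT hs hμ hM he hgap hsad hfit
  refine ⟨hR.mono fun st h => h.2, fun x hx => ?_⟩
  obtain ⟨i1, -, hle⟩ := hmain x hx _ hsad.2.1
  refine ⟨i1, ?_⟩
  have h2 : 0 ≤ ∫ st : State E m t, c.H / 2 * ‖Q.ystar t (s, q) - st.2.1‖ ^ 2
      ∂(run P Q par (P.T - t) t s q) := integral_nonneg fun st => by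
    have : 0 ≤ c.H := (hfit.2 e).H_nonneg
    positivity
  have h3 : c.lam 0 * P.bregman t (Q.x0 t) x ≤ c.lam 0 * P.Ω t ^ 2 :=
    mul_le_mul_of_nonneg_left (bregman_le_Ω hP h1 hT (hQ.x0_mem t h1 hT) hx) hlam
  refine le_of_mul_le_mul_left ?_ hW
  linarith

/-- Second moment of the dual output. -/
theorem lintegral_ybar_le (hP : P.Regular) (hQ : P.Admissible Q) (hpar : par.Meas P.T) {t : ℕ}
    (h1 : 1 ≤ t) (hT : t ≤ P.T) {s : S t} (hs : P.GoodAt Q t s) {μ : ℝ}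
    (hμ : P.ModulusAt t s μ) {M : ℕ → ℝ}
    (hM : t < P.T → 0 ≤ M (t + 1) ∧ P.ValidAt Q par M t s) {e : ℝ} (he : 0 ≤ e)
    (hgap : t < P.T → ∀ᵐ s' ∂(P.κ t s), ∀ u ∈ P.X t,
      P.GapBound Q par (t + 1) s' (P.rhs t s' u) e) {q : Y m t} {x₀ : E t} {y₀ : Y m t}
    (hsad : P.IsSaddle t s q x₀ y₀) {c : Cert}
    (hfit : P.Fits Q par t s q μ (P.stageM M t) c) (hlam : 0 ≤ c.lam 0) (hH : 0 < c.H) {B : ℝ}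
    (hB : c.lam 0 * P.Ω t ^ 2 + c.err (P.stageM M t) (par.N t s q) + weight par t s q * e
      ≤ c.H / 2 * B) :
    ∫⁻ st, ENNReal.ofReal (‖ybar par t s q st - y₀‖ ^ 2) ∂(run P Q par (P.T - t) t s q)
      ≤ ENNReal.ofReal (‖y₀ - Q.y0 t‖ ^ 2 + B) := by
  have hZ := valid_stage hP h1 hT hs hμ hM q
  have hO := oracle_loop hP hQ hpar h1 hT hs hM he hgap q μ c
  have hA := hfit.2 e
  have hU := updates_loop hQ hpar h1 hT hs hsad hA
  have hq := inner_rhs_nonpos hsad μ (P.stageM M t)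
  have hM0 : 0 ≤ P.stageM M t := hZ.M_nonneg
  set ℓ := P.loop Q par t s q μ (P.stageM M t) e c with hℓ
  obtain ⟨k, hk⟩ : ∃ k, par.N t s q = k + 1 := ⟨par.N t s q - 1, by have := hfit.1; omega⟩
  have hlaw : ℓ.law (k + 1) = run P Q par (P.T - t) t s q := by
    rw [← hk]; exact law_loop hP hQ hpar h1 hT s q _ _ _ _
  have hW : weight par t s q = ℓ.W (k + 1) := by
    rw [weight, hk]; rfl
  have hWpos := hA.W_pos k
  have hyb : ∀ st : State E m t, ybar par t s q st = (ℓ.W (k + 1))⁻¹ • st.2.2.2.2 := fun st => by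
    rw [← hW]; rfl
  have herr : ∀ i, 0 ≤ ℓ.err i := fun i => by
    have := hA.r_nonneg i
    have := hA.z_nonneg i
    have : 0 ≤ ℓ.Z.M := hM0
    unfold Loop.err
    positivity
  have herrN : ∑ i ∈ Finset.Icc 1 (k + 1), ℓ.err i = c.err (P.stageM M t) (par.N t s q) := by
    rw [hk]; rfl
  have hB0 : 0 ≤ B := by
    have h2 : 0 ≤ ∑ i ∈ Finset.Icc 1 (k + 1), ℓ.err i := Finset.sum_nonneg fun i _ => herr i
    rw [herrN] at h2
    rw [hW] at hB
    have : 0 ≤ c.lam 0 * P.Ω t ^ 2 := by positivity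
    have : 0 ≤ ℓ.W (k + 1) * e := by positivity
    exact nonneg_of_mul_nonneg_right (by linarith : 0 ≤ c.H / 2 * B) (by positivity)
  have hmain := Loop.lintegral_sumy_le hZ hA hO hU hq (hsad.stage μ (P.stageM M t)) (k := k + 1)
    (B := ‖y₀ - Q.y0 t‖ ^ 2 + B) hH (by positivity) ?_ (by rw [← hk]; rfl)
  · rw [hlaw] at hmain
    have h2 : ∀ st : State E m t, ENNReal.ofReal (‖ybar par t s q st - y₀‖ ^ 2)
        = ENNReal.ofReal ((ℓ.W (k + 1))⁻¹ ^ 2)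
          * ENNReal.ofReal (‖st.2.2.2.2 - ℓ.W (k + 1) • y₀‖ ^ 2) := fun st => by
      rw [← ENNReal.ofReal_mul (by positivity), ← mul_pow]
      congr 2
      rw [hyb, ← Real.norm_of_nonneg (inv_nonneg.2 hWpos.le), ← norm_smul, smul_sub, smul_smul,
        Real.norm_of_nonneg (inv_nonneg.2 hWpos.le), inv_mul_cancel₀ hWpos.ne', one_smul]
    simp_rw [h2]
    rw [lintegral_const_mul _ (by fun_prop)]
    refine (mul_le_mul_right hmain _).trans ?_
    rw [← ENNReal.ofReal_mul (by positivity)]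
    refine ENNReal.ofReal_le_ofReal (le_of_eq ?_)
    field_simp
  -- The dual moments are needed after every number of steps. The bound for the full loop implies
  -- them, since errors and weights are nonnegative and their partial sums increase.
  · intro j hj
    have hjk : j + 1 ≤ k + 1 := by rw [← hk]; exact hj
    have h3 : c.lam 0 * P.bregman t (Q.x0 t) x₀ ≤ c.lam 0 * P.Ω t ^ 2 :=
      mul_le_mul_of_nonneg_left (bregman_le_Ω hP h1 hT (hQ.x0_mem t h1 hT) hsad.1) hlam
    have h4 : ∑ i ∈ Finset.Icc 1 (j + 1), ℓ.err i ≤ c.err (P.stageM M t) (par.N t s q) := by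
      rw [← herrN]
      exact Finset.sum_le_sum_of_subset_of_nonneg (Finset.Icc_subset_Icc_right hjk)
        fun i _ _ => herr i
    have h5 : ℓ.W (j + 1) ≤ weight par t s q := by
      rw [hW]
      exact Finset.sum_le_sum_of_subset_of_nonneg (Finset.Icc_subset_Icc_right hjk)
        fun i _ _ => hA.w_nonneg i
    have h6 : ℓ.W (j + 1) * e ≤ weight par t s q * e := mul_le_mul_of_nonneg_right h5 he
    show c.lam 0 * P.bregman t (Q.x0 t) x₀ + c.H / 2 * ‖y₀ - Q.y0 t‖ ^ 2
      + ∑ i ∈ Finset.Icc 1 (j + 1), ℓ.err i + ℓ.W (j + 1) * e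
      ≤ c.H / 2 * (‖y₀ - Q.y0 t‖ ^ 2 + B)
    linarith

/-- The step sizes of all stages but the first are admissible, and each of these stages adds at
most `ε / T` to the inexactness. -/
def InnerFits (P : Problem S E m) (Q : Method S E m) (par : Params S m) (μ M : ℕ → ℝ) (ε : ℝ)
    (t : ℕ) : Prop :=
  ∀ s q, ∃ c, P.Fits Q par t s q (μ t) (P.stageM M t) c ∧ 0 ≤ c.lam 0 ∧
    c.lam 0 * P.Ω t ^ 2 + c.H / 2 * ‖Q.ystar t (s, q) - Q.y0 t‖ ^ 2
      + c.err (P.stageM M t) (par.N t s q)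
      ≤ weight par t s q * (ε / P.T)

/-- The inexactness of the stochastic subgradients at stage `t`. -/
def inexactness (P : Problem S E m) (ε : ℝ) (t : ℕ) : ℝ := (P.T - t : ℝ) * (ε / P.T)

theorem inexactness_nonneg {ε : ℝ} (hε : 0 < ε) {t : ℕ} (hT : t ≤ P.T) :
    0 ≤ P.inexactness ε t := by
  have : (t : ℝ) ≤ P.T := by exact_mod_cast hT
  have : (0 : ℝ) ≤ P.T - t := by linarith
  unfold inexactness
  positivity

/-- Gap bounds for all stages but the first. -/
theorem ae_gapBound (hP : P.Regular) (hQ : P.Admissible Q) (hpar : par.Meas P.T) {ε : ℝ}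
    (hε : 0 < ε) {μ M : ℕ → ℝ}
    (hμ : ∀ t, 1 ≤ t → t ≤ P.T → ∀ᵐ s ∂(P.law t), P.ModulusAt t s (μ t)) {t₀ : ℕ} (ht₀ : 2 ≤ t₀)
    (hM : ∀ t, t₀ ≤ t → t < P.T → 0 ≤ M (t + 1) ∧ ∀ᵐ s ∂(P.law t), P.ValidAt Q par M t s)
    (hfit : ∀ t, t₀ ≤ t → t ≤ P.T → P.InnerFits Q par μ M ε t) (r : ℕ) :
    ∀ t, t₀ ≤ t → t + r = P.T → ∀ᵐ s ∂(P.law t), ∀ q,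
      (∃ x, P.IsSaddle t s q x (Q.ystar t (s, q))) →
      P.GapBound Q par t s q (ε / P.T + P.inexactness ε t) := by
  induction r with
  | zero =>
    intro t ht htT
    have hT : t ≤ P.T := by omega
    filter_upwards [ae_goodAt hP hQ (by omega : 1 ≤ t) hT, hμ t (by omega) hT] with s hs hμs q hq
    obtain ⟨x, hx⟩ := hq
    obtain ⟨c, h1, h2, h3⟩ := hfit t ht hT s q
    exact gapBound_of_fits hP hQ hpar (by omega) hT hs hμs (fun h => by omega)
      (inexactness_nonneg hε hT) (fun h => by omega) hx h1 h2 h3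
  | succ r ih =>
    intro t ht htT
    have hlt : t < P.T := by omega
    have hT := hlt.le
    filter_upwards [ae_goodAt hP hQ (by omega : 1 ≤ t) hT, hμ t (by omega) hT, (hM t ht hlt).2,
      ae_ae_of_ae_law (by omega : 1 ≤ t) (ih (t + 1) (by omega) (by omega))] with s hs hμs hv hn q hq
    obtain ⟨x, hx⟩ := hq
    obtain ⟨c, h1, h2, h3⟩ := hfit t ht hT s q
    -- The gap of stage `t + 1`, its own share `ε/T` plus what it inherits, is exactly the
    -- inexactness seen at stage `t`.
    have he : ε / P.T + P.inexactness ε (t + 1) = P.inexactness ε t := by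
      unfold inexactness; push_cast; ring
    rw [he] at hn
    refine gapBound_of_fits hP hQ hpar (by omega) hT hs hμs (fun _ => ⟨(hM t ht hlt).1, hv⟩)
      (inexactness_nonneg hε hT) (fun _ => ?_) hx h1 h2 h3
    filter_upwards [hn, hs.next hlt] with s' h4 h5 u hu
    exact h4 _ (h5 u hu)

end Problem

end DSA
end

/-! ### Certificates for constant and for linearly weighted step sizes. -/

noncomputable section

namespace DSA

set_option linter.unusedSectionVars false

theorem sub_mul_sq_le_div {u d p : ℝ} (hp : 0 < p) : u * d - p * d ^ 2 ≤ u ^ 2 / (4 * p) := by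
  rw [le_div_iff₀ (by positivity)]
  nlinarith [sq_nonneg (u - 2 * p * d)]

/-- The minimum of `b' a² + c d²` for given `a + d` is `b (a + d)²` with `1/b = 1/b' + 1/c`. This is
the exact exchange rate at which a debt can be handed on. -/
theorem harmonic_combination {b b' c : ℝ} (hb : 0 < b) (hb' : 0 < b') (hc : 0 < c)
    (h : 1 / b = 1 / b' + 1 / c) (a d : ℝ) : b * (a + d) ^ 2 ≤ b' * a ^ 2 + c * d ^ 2 := by
  have h1 : b' * c = b * (b' + c) := by
    field_simp at h
    linarith
  have h2 : (b' + c) * (b' * a ^ 2 + c * d ^ 2 - b * (a + d) ^ 2) = (b' * a - c * d) ^ 2 := by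
    have : (b' + c) * (b' * a ^ 2 + c * d ^ 2 - b * (a + d) ^ 2)
        = (b' + c) * (b' * a ^ 2 + c * d ^ 2) - (b * (b' + c)) * (a + d) ^ 2 := by ring
    rw [this, ← h1]
    ring
  have h3 : 0 ≤ (b' + c) * (b' * a ^ 2 + c * d ^ 2 - b * (a + d) ^ 2) := by
    rw [h2]; positivity
  have := nonneg_of_mul_nonneg_right h3 (by positivity)
  linarith

/-- The logarithmic growth is given away for a linear bound. Slope `1/4` and constant `4/3` are what
the total error `3 (n + 2) / (α μ)` in `fits_of_linear` requires. -/
theorem sum_inv_le (n : ℕ) : ∑ i ∈ Finset.range n, 1 / ((i : ℝ) + 1) ≤ n / 4 + 4 / 3 := by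
  induction n with
  | zero => norm_num
  | succ n ih =>
    rcases lt_or_ge n 3 with h | h
    · interval_cases n <;> norm_num [Finset.sum_range_succ]
    · rw [Finset.sum_range_succ]
      have : (3 : ℝ) ≤ n := by exact_mod_cast h
      have h2 : 1 / ((n : ℝ) + 1) ≤ 1 / 4 := by
        apply one_div_le_one_div_of_le <;> linarith
      push_cast
      linarith

variable {S : ℕ → Type*} [∀ t, MeasurableSpace (S t)]
  {E : ℕ → Type*} [∀ t, NormedAddCommGroup (E t)] [∀ t, NormedSpace ℝ (E t)]
  [∀ t, FiniteDimensional ℝ (E t)] [∀ t, MeasurableSpace (E t)] [∀ t, BorelSpace (E t)]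
  {m : ℕ → ℕ} {P : Problem S E m} {Q : Method S E m} {par : Params S m}

namespace Problem

theorem Ω_nonneg (P : Problem S E m) (t : ℕ) : 0 ≤ P.Ω t := Real.sqrt_nonneg _

/-- Constant step sizes. -/
theorem fits_of_const (hP : P.Regular) {t : ℕ} (h1 : 1 ≤ t) (hT : t ≤ P.T) {s : S t} {q : Y m t}
    {M τ η : ℝ} (hN : 1 ≤ par.N t s q) (hw : ∀ k, par.w t s q k = 1)
    (hτ : ∀ k, par.τ t s q k = τ) (hη : ∀ k, par.η t s q k = η) (hτ0 : 0 ≤ τ)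
    (hA : 2 * ‖P.A t s‖ ^ 2 ≤ η * τ * P.α t) (hη0 : P.A t s ≠ 0 → 0 < η)
    (hη1 : P.A t s = 0 → η = 0) (hM : 0 ≤ M)
    (hMτ : 0 < M → 0 < P.Ω t → M * √(3 * par.N t s q) / (P.Ω t * √(P.α t)) ≤ τ) :
    ∃ c, P.Fits Q par t s q 0 M c ∧ c.lam 0 = τ ∧ c.H = η ∧
      c.err M (par.N t s q) ≤ 4 * (M * P.Ω t) * √(par.N t s q) / (√3 * √(P.α t)) := by
  have hα := hP.α_pos t h1 hT
  have hN' : (0 : ℝ) < par.N t s q := by exact_mod_cast hN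
  have hΩ0 := P.Ω_nonneg t
  -- Of the prox coefficient `τ α/2`, one half is reserved for the coupling and the other half, `τ
  -- α/4`, absorbs the subgradient error. Young's inequality gives `r = 1/(τ α)`, and the lower
  -- bound on `τ` bounds the sum of `N` such errors.
  obtain ⟨r, z, hr, hz, hstep, herr⟩ : ∃ r z : ℝ, 0 ≤ r ∧ 0 ≤ z ∧
      (∀ g d : ℝ, 0 ≤ g → 0 ≤ d → d ≤ √(2 / P.α t) * P.Ω t →
        (M + g) * d - τ * P.α t / 4 * d ^ 2 ≤ r * (M + g) ^ 2 + z * (M + g)) ∧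
      par.N t s q * (4 * r * M ^ 2 + 2 * z * M)
        ≤ 4 * (M * P.Ω t) * √(par.N t s q) / (√3 * √(P.α t)) := by
    by_cases hpos : 0 < M ∧ 0 < P.Ω t
    · obtain ⟨hM1, hΩ⟩ := hpos
      have hMτ := hMτ hM1 hΩ
      have hτpos : 0 < τ := lt_of_lt_of_le (by positivity) hMτ
      refine ⟨1 / (τ * P.α t), 0, by positivity, le_rfl, fun g d hg hd hdD => ?_, ?_⟩
      · have := sub_mul_sq_le_div (u := M + g) (d := d) (p := τ * P.α t / 4) (by positivity)
        have e1 : (M + g) ^ 2 / (4 * (τ * P.α t / 4)) = 1 / (τ * P.α t) * (M + g) ^ 2 := by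
          field_simp
        rw [e1] at this
        linarith
      · set n : ℝ := (par.N t s q : ℝ)
        have hs3 : √(3 * n) = √3 * √n := Real.sqrt_mul (by norm_num) _
        have hn0 : 0 < √n := Real.sqrt_pos.2 hN'
        have hα0 : 0 < √(P.α t) := Real.sqrt_pos.2 hα
        rw [hs3, div_le_iff₀ (by positivity)] at hMτ
        rw [mul_zero, zero_mul, add_zero, le_div_iff₀ (by positivity)]
        have e : n * (4 * (1 / (τ * P.α t)) * M ^ 2) * (√3 * √(P.α t))
            = 4 * M * √n / (τ * √(P.α t)) * (M * (√3 * √n)) := by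
          field_simp
          rw [Real.sq_sqrt hα.le, Real.sq_sqrt hN'.le, mul_comm]
        rw [e]
        calc _ ≤ 4 * M * √n / (τ * √(P.α t)) * (τ * (P.Ω t * √(P.α t))) := by gcongr
          _ = _ := by field_simp
    -- Degenerate case, in which no lower bound on `τ` is available. The product of `M` with the
    -- diameter bound vanishes, so the crude linear error with `z` equal to that bound costs `2 z M
    -- = 0`.
    · have hD : M * (√(2 / P.α t) * P.Ω t) = 0 := by
        rcases hM.eq_or_lt with h | h
        · rw [← h, zero_mul]
        · have : P.Ω t = 0 := by
            by_contra h0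
            exact hpos ⟨h, lt_of_le_of_ne hΩ0 (Ne.symm h0)⟩
          rw [this, mul_zero, mul_zero]
      refine ⟨0, √(2 / P.α t) * P.Ω t, le_rfl, by positivity, fun g d hg hd hdD => ?_, ?_⟩
      · have e1 : (M + g) * d ≤ (M + g) * (√(2 / P.α t) * P.Ω t) := by gcongr
        have e2 : 0 ≤ τ * P.α t * d ^ 2 := by positivity
        linarith
      · have e : 4 * (0 : ℝ) * M ^ 2 + 2 * (√(2 / P.α t) * P.Ω t) * M = 0 := by linarith
        rw [e, mul_zero]
        positivity
  refine ⟨⟨η, √(2 / P.α t) * P.Ω t, fun _ => τ, fun _ => 0, fun _ => r, fun _ => z⟩,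
    ⟨hN, fun e => ?_⟩, rfl, rfl, ?_⟩
  · have hfin : ∀ k, (par.w t s q k * ‖P.A t s‖) ^ 2 ≤ 2 * η * (τ * P.α t / 4) := fun k => by
      rw [hw, one_mul]
      linarith
    exact {
      w_zero := by show 0 ≤ par.w t s q 0; rw [hw]; exact zero_le_one
      w_pos := fun k => by show 0 < par.w t s q (k + 1); rw [hw]; exact one_pos
      τ_nonneg := fun k => by show 0 ≤ par.τ t s q (k + 1); rwa [hτ]
      η_eq := fun k => by
        show par.w t s q (k + 1) * par.η t s q (k + 1) = η
        rw [hw, hη, one_mul]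
      H_pos := hη0
      H_zero := hη1
      lam_prev := fun k => by
        show par.w t s q (k + 1) * par.τ t s q (k + 1) = τ
        rw [hw, hτ, one_mul]
      lam_next := fun k => by
        show τ = par.w t s q (k + 1) * (par.τ t s q (k + 1) + 0)
        rw [hw, hτ, one_mul, add_zero]
      diam := fun p hp x hx => norm_sub_le_Ω hP h1 hT hp hx
      b_zero := rfl
      b_nonneg := fun _ => le_rfl
      step := fun k _ => Or.inl ⟨τ * P.α t / 4, 0, by positivity, hfin k, fun a d => by
        show 0 * (a + d) ^ 2 ≤ 0 * a ^ 2 + 0 * d ^ 2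
        simp, fun g d hg hd hdD => by
        show par.w t s q (k + 1) * (M + g) * d
          - (par.w t s q (k + 1) * par.τ t s q (k + 1) * P.α t / 2 - τ * P.α t / 4 - 0) * d ^ 2
          ≤ r * (M + g) ^ 2 + z * (M + g)
        rw [hw, hτ]
        linarith [hstep g d hg hd hdD]⟩
      final := fun k _ => ⟨τ * P.α t / 4, by positivity, hfin (k + 1), by
        show τ * P.α t / 4 + 0 ≤ τ * P.α t / 2
        have : 0 ≤ τ * P.α t := by positivity
        linarith⟩
      r_nonneg := fun _ => hr
      z_nonneg := fun _ => hz }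
  · unfold Cert.err
    simpa only [Finset.sum_const, Nat.card_Icc, Nat.add_sub_cancel, nsmul_eq_mul] using herr

/-- Linearly increasing weights and step sizes. -/
theorem fits_of_linear (hP : P.Regular) {t : ℕ} (h1 : 1 ≤ t) (hT : t ≤ P.T) {s : S t} {q : Y m t}
    {M μ H : ℝ} (hN : 1 ≤ par.N t s q) (hw : ∀ k, par.w t s q k = k)
    (hτ : ∀ k : ℕ, par.τ t s q k = ((k : ℝ) - 1) / 2 * μ)
    (hη : ∀ k : ℕ, ((k : ℝ) + 1) * par.η t s q (k + 1) = H) (hμ : 0 < μ)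
    (hA : 4 * ‖P.A t s‖ ^ 2 ≤ H * (P.α t * μ)) (hH : P.A t s = 0 → H = 0) :
    ∃ c, P.Fits Q par t s q μ M c ∧ c.lam 0 = 0 ∧ c.H = H ∧
      c.err M (par.N t s q) ≤ 12 * (par.N t s q + 1) * M ^ 2 / (P.α t * μ) := by
  have hα := hP.α_pos t h1 hT
  obtain ⟨n, hn⟩ : ∃ n, par.N t s q = n + 1 := ⟨par.N t s q - 1, by omega⟩
  -- In this unit the prox coefficient of step `k + 1` is `2k(k+1)υ`. It is split into `k²υ` for the
  -- coupling, `kυ` for handing on the debt and `k(k+1)υ` for the subgradient error.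
  set υ := P.α t * μ / 8 with hυ
  have hυ0 : 0 < υ := by positivity
  -- The debt is `b_k = υ/ρ_k`. Handing it on with `c = kυ` requires `ρ_k = ρ_{k+1} + 1/k`, and
  -- repayment after `k` steps requires `b_k ≤ k(k+2)υ`. The final value `1/((n+1)(n+3))` meets the
  -- latter with equality at the last step.
  set ρ : ℕ → ℝ := fun k => ∑ j ∈ Finset.Ico k (n + 1), 1 / (j : ℝ)
    + 1 / (((n : ℝ) + 1) * (n + 3)) with hρ
  have hρ0 : ∀ k, 0 < ρ k := fun k => by
    have : 0 ≤ ∑ j ∈ Finset.Ico k (n + 1), 1 / (j : ℝ) :=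
      Finset.sum_nonneg fun i _ => by positivity
    simp only [hρ]
    positivity
  have hρs : ∀ k < n + 1, ρ k = ρ (k + 1) + 1 / (k : ℝ) := fun k hk => by
    simp only [hρ]
    rw [Finset.sum_eq_sum_Ico_succ_bot hk]
    ring
  have hρl : ∀ k, 1 ≤ k → k ≤ n + 1 → 1 / ((k : ℝ) * (k + 2)) ≤ ρ k := fun k hk1 hk => by
    have hk0 : (1 : ℝ) ≤ k := by exact_mod_cast hk1
    rcases hk.eq_or_lt with h | h
    · subst h
      simp only [hρ, Finset.Ico_self, Finset.sum_empty, zero_add]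
      push_cast
      rw [show (n : ℝ) + 1 + 2 = n + 3 by ring]
    · rw [hρs k h]
      have h2 : 1 / ((k : ℝ) * (k + 2)) ≤ 1 / k :=
        one_div_le_one_div_of_le (by positivity) (by nlinarith)
      linarith [hρ0 (k + 1)]
  set b : ℕ → ℝ := fun k => if k = 0 then 0 else υ / ρ k with hb
  -- Young's inequality with coefficient `b_1 = υ/ρ_1` in the first step and `(k-1)kυ` in step `k ≥
  -- 2`.
  set r : ℕ → ℝ := fun k => if k = 1 then ρ 1 / (4 * υ) else 2 * k / ((k - 1) * (P.α t * μ)) with hr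
  refine ⟨⟨H, √(2 / P.α t) * P.Ω t, fun k => k * (k + 1) / 2 * μ, b, r, fun _ => 0⟩,
    ⟨hN, fun e => ?_⟩, by simp, rfl, ?_⟩
  · have hfin : ∀ k : ℕ, (k * ‖P.A t s‖) ^ 2 ≤ 2 * H * ((k : ℝ) ^ 2 * υ) := fun k => by
      have : (k : ℝ) ^ 2 * (4 * ‖P.A t s‖ ^ 2) ≤ (k : ℝ) ^ 2 * (H * (P.α t * μ)) := by gcongr
      rw [hυ]
      linarith
    exact {
      w_zero := by show 0 ≤ par.w t s q 0; rw [hw]; simp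
      w_pos := fun k => by show 0 < par.w t s q (k + 1); rw [hw]; positivity
      τ_nonneg := fun k => by
        show 0 ≤ par.τ t s q (k + 1)
        rw [hτ]
        push_cast
        rw [add_sub_cancel_right]
        positivity
      η_eq := fun k => by
        show par.w t s q (k + 1) * par.η t s q (k + 1) = H
        rw [hw, ← hη k]
        push_cast
        rfl
      H_pos := fun h => by
        have h2 : 0 < ‖P.A t s‖ := norm_pos_iff.2 h
        have : 0 < H * (P.α t * μ) := lt_of_lt_of_le (by positivity) hA
        exact pos_of_mul_pos_left this (by positivity)
      H_zero := hH
      lam_prev := fun k => by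
        show par.w t s q (k + 1) * par.τ t s q (k + 1) = (k : ℝ) * (k + 1) / 2 * μ
        rw [hw, hτ]
        push_cast
        ring
      lam_next := fun k => by
        show ((k + 1 : ℕ) : ℝ) * ((k + 1 : ℕ) + 1) / 2 * μ
          = par.w t s q (k + 1) * (par.τ t s q (k + 1) + μ)
        rw [hw, hτ]
        push_cast
        ring
      diam := fun p hp x hx => norm_sub_le_Ω hP h1 hT hp hx
      b_zero := by simp [loop, hb]
      b_nonneg := fun k => by
        show 0 ≤ b k
        have := hρ0 k
        simp only [hb]
        split_ifs <;> positivity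
      step := fun k hk => by
        have hkn : k < n + 1 := by rw [← hn]; exact hk
        rcases Nat.eq_zero_or_pos k with h0 | h0
        · refine Or.inr ⟨h0, ?_, ?_, fun g d hg hd hdD => ?_⟩
          · show par.w t s q 0 = 0
            rw [hw]; simp
          · show par.τ t s q 1 = 0
            rw [hτ]; simp
          · show par.w t s q 1 * (M + g) * d ≤ b 1 * d ^ 2 + r 1 * (M + g) ^ 2 + 0 * (M + g)
            have hρ1 := hρ0 1
            have h2 := sub_mul_sq_le_div (u := M + g) (d := d) (p := υ / ρ 1) (by positivity)
            rw [hw]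
            simp only [hb, hr, one_ne_zero, if_false, if_true, Nat.cast_one]
            have e1 : (M + g) ^ 2 / (4 * (υ / ρ 1)) = ρ 1 / (4 * υ) * (M + g) ^ 2 := by
              field_simp
            linarith
        · have hk0 : (0 : ℝ) < k := by exact_mod_cast h0
          refine Or.inl ⟨(k : ℝ) ^ 2 * υ, k * υ, by positivity, ?_, fun a d => ?_,
            fun g d hg hd hdD => ?_⟩
          · show (par.w t s q k * ‖P.A t s‖) ^ 2 ≤ 2 * H * ((k : ℝ) ^ 2 * υ)
            rw [hw]
            exact hfin k
          · show b k * (a + d) ^ 2 ≤ b (k + 1) * a ^ 2 + k * υ * d ^ 2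
            simp only [hb, h0.ne', if_false, Nat.add_eq_zero_iff, one_ne_zero, and_false]
            have e1 := hρ0 k
            have e2 := hρ0 (k + 1)
            refine harmonic_combination (by positivity) (by positivity) (by positivity) ?_ a d
            rw [one_div_div, one_div_div, hρs k hkn]
            field_simp
          · show par.w t s q (k + 1) * (M + g) * d - (par.w t s q (k + 1) * par.τ t s q (k + 1)
              * P.α t / 2 - (k : ℝ) ^ 2 * υ - k * υ) * d ^ 2
              ≤ r (k + 1) * (M + g) ^ 2 + 0 * (M + g)
            have h2 := sub_mul_sq_le_div (u := ((k : ℝ) + 1) * (M + g)) (d := d)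
              (p := k * (k + 1) * υ) (by positivity)
            have e1 : (((k : ℝ) + 1) * (M + g)) ^ 2 / (4 * (k * (k + 1) * υ))
                = r (k + 1) * (M + g) ^ 2 := by
              have : ¬ k + 1 = 1 := by omega
              simp only [hr, this, if_false]
              push_cast
              rw [add_sub_cancel_right, hυ]
              field_simp
              ring
            have e2 : par.w t s q (k + 1) * par.τ t s q (k + 1) * P.α t / 2 - (k : ℝ) ^ 2 * υ - k * υ
                = k * (k + 1) * υ := by
              rw [hw, hτ, hυ]
              push_cast
              ring
            rw [e2, hw, ← e1]
            push_cast
            linarith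
      final := fun k hk => by
        have hkn : k + 1 ≤ n + 1 := by rw [← hn]; exact hk
        refine ⟨((k + 1 : ℕ) : ℝ) ^ 2 * υ, by positivity, ?_, ?_⟩
        · show (par.w t s q (k + 1) * ‖P.A t s‖) ^ 2 ≤ 2 * H * (((k + 1 : ℕ) : ℝ) ^ 2 * υ)
          rw [hw]
          exact hfin (k + 1)
        · show ((k + 1 : ℕ) : ℝ) ^ 2 * υ + b (k + 1)
            ≤ ((k + 1 : ℕ) : ℝ) * ((k + 1 : ℕ) + 1) / 2 * μ * P.α t / 2
          have h2 := hρl (k + 1) (by omega) hkn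
          have h3 := hρ0 (k + 1)
          have h4 : b (k + 1) ≤ υ * (((k + 1 : ℕ) : ℝ) * ((k + 1 : ℕ) + 2)) := by
            simp only [hb, Nat.add_eq_zero_iff, one_ne_zero, and_false, if_false]
            rw [div_le_iff₀ h3, mul_assoc]
            have h5 := (div_le_iff₀ (by positivity)).1 h2
            rw [mul_comm (ρ (k + 1))] at h5
            nlinarith
          have e1 : ((k + 1 : ℕ) : ℝ) * ((k + 1 : ℕ) + 1) / 2 * μ * P.α t / 2
              = ((k + 1 : ℕ) : ℝ) ^ 2 * υ + υ * (((k + 1 : ℕ) : ℝ) * ((k + 1 : ℕ) + 2)) := by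
            rw [hυ]; ring
          linarith
      r_nonneg := fun k => by
        show 0 ≤ r k
        have := hρ0 1
        simp only [hr]
        split_ifs with h
        · positivity
        · rcases Nat.eq_zero_or_pos k with h0 | h0
          · simp [h0]
          · have : (0 : ℝ) ≤ k - 1 := by
              have : (1 : ℝ) ≤ k := by exact_mod_cast h0
              linarith
            positivity
      z_nonneg := fun _ => le_rfl }
  · have hsum : ∑ i ∈ Finset.Icc 1 (n + 1), r i ≤ 3 * ((n : ℝ) + 2) / (P.α t * μ) := by
      have e1 : ∑ i ∈ Finset.Icc 1 (n + 1), r i = r 1 + ∑ i ∈ Finset.range n, r (i + 2) := by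
        rw [← Finset.Ico_add_one_right_eq_Icc, Finset.sum_Ico_eq_sum_range,
          show n + 1 + 1 - 1 = n + 1 by omega, Finset.sum_range_succ', add_comm]
        congr 1
        exact Finset.sum_congr rfl fun i _ => by congr 1; omega
      have e2 : ∀ i : ℕ, r (i + 2) = 2 / (P.α t * μ) * (1 + 1 / ((i : ℝ) + 1)) := fun i => by
        have : ¬ i + 2 = 1 := by omega
        simp only [hr, this, if_false]
        push_cast
        have : (i : ℝ) + 2 - 1 = i + 1 := by ring
        rw [this]
        field_simp
        ring
      have e3 : r 1 = 2 / (P.α t * μ) * ρ 1 := by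
        simp only [hr, if_true, hυ]
        field_simp
        ring
      have e4 : ρ 1 = ∑ i ∈ Finset.range n, 1 / ((i : ℝ) + 1) + 1 / (((n : ℝ) + 1) * (n + 3)) := by
        simp only [hρ]
        rw [Finset.sum_Ico_eq_sum_range, Nat.add_sub_cancel]
        congr 1
        exact Finset.sum_congr rfl fun i _ => by push_cast; rw [add_comm]
      rw [e1, Finset.sum_congr rfl fun i _ => e2 i, ← Finset.mul_sum, e3, ← mul_add,
        Finset.sum_add_distrib, e4]
      have h5 := sum_inv_le n
      have h6 : 1 / (((n : ℝ) + 1) * (n + 3)) ≤ 1 / 3 := by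
        apply one_div_le_one_div_of_le (by norm_num)
        have : (0 : ℝ) ≤ n := by positivity
        nlinarith
      simp only [Finset.sum_const, Finset.card_range, nsmul_eq_mul, mul_one]
      rw [div_mul_eq_mul_div]
      refine div_le_div_of_nonneg_right ?_ (by positivity)
      linarith
    have e5 : ∀ K, Cert.err ⟨H, √(2 / P.α t) * P.Ω t, fun k => k * (k + 1) / 2 * μ, b, r,
        fun _ => 0⟩ M K = 4 * M ^ 2 * ∑ i ∈ Finset.Icc 1 K, r i := fun K => by
      unfold Cert.err
      rw [Finset.mul_sum]
      exact Finset.sum_congr rfl fun i _ => by ring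
    rw [e5, hn]
    calc _ ≤ 4 * M ^ 2 * (3 * ((n : ℝ) + 2) / (P.α t * μ)) := by gcongr
      _ = _ := by push_cast; ring

end Problem

end DSA
end

/-! ### Numerical inequalities behind the iteration counts. -/

noncomputable section

namespace DSA

theorem le_max_one_ceil (x : ℝ) : x ≤ (max 1 ⌈x⌉₊ : ℕ) :=
  (Nat.le_ceil x).trans (by exact_mod_cast le_max_right _ _)

theorem max_one_ceil_le {x : ℝ} (hx : 0 ≤ x) : ((max 1 ⌈x⌉₊ : ℕ) : ℝ) ≤ x + 1 := by
  rw [Nat.cast_max, Nat.cast_one]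
  exact max_le (by linarith) (Nat.ceil_lt_add_one hx).le

theorem le_sqrt_pow_three_of_rpow_le {x n : ℝ} (hx : 0 ≤ x) (hn : 0 ≤ n)
    (h : x ^ (2 / 3 : ℝ) ≤ n) : x ≤ √n ^ 3 := by
  have h1 := Real.rpow_le_rpow (by positivity) h (by norm_num : (0 : ℝ) ≤ 3 / 2)
  rw [← Real.rpow_mul hx] at h1
  norm_num at h1
  refine h1.trans (le_of_eq ?_)
  rw [Real.sqrt_eq_rpow, ← Real.rpow_natCast, ← Real.rpow_mul hn]
  norm_num

theorem rpow_two_thirds_le {x : ℝ} (hx : 0 ≤ x) : x ^ (2 / 3 : ℝ) ≤ 1 + x := by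
  rcases le_total x 1 with h | h
  · have := Real.rpow_le_one hx h (by norm_num : (0 : ℝ) ≤ 2 / 3)
    linarith
  · have := Real.rpow_le_rpow_of_exponent_le h (by norm_num : (2 / 3 : ℝ) ≤ 1)
    rw [Real.rpow_one] at this
    linarith

/-- The middle loops with constant step sizes, in terms of `A = ‖A‖ / √α`, `g = M Ω / √α` and
`ρ = √N`. -/
theorem const_middle_le {A Ω d g T ε ρ : ℝ} (hA : 0 ≤ A) (hg : 0 ≤ g)
    (hT : 0 < T) (hε : 0 < ε) (hρ : 0 < ρ) (h1 : 4 * √2 * T * (A * Ω ^ 2) / ε ≤ ρ ^ 3)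
    (h2 : 2 * T * (A * d ^ 2 + 4 * √3 * g) / ε ≤ ρ) :
    7 / 3 * √3 * g * ρ + √2 * A * Ω ^ 2 / ρ + √2 * ρ * A / 2 * d ^ 2 ≤ ρ ^ 2 * (ε / T) := by
  have s2 : √(2 : ℝ) ≤ 2 := by rw [Real.sqrt_le_iff]; norm_num
  rw [div_le_iff₀ hε] at h1 h2
  have e1 : √2 * A * Ω ^ 2 / ρ ≤ ρ ^ 2 * (ε / T) / 4 := by
    rw [div_le_iff₀ hρ]
    have : ρ ^ 2 * (ε / T) / 4 * ρ = ρ ^ 3 * ε / T / 4 := by ring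
    rw [this]
    have : √2 * A * Ω ^ 2 ≤ ρ ^ 3 * ε / T / 4 := by
      rw [div_div, le_div_iff₀ (by positivity)]
      linarith
    exact this
  have e2 : (A * d ^ 2 + 4 * √3 * g) * ρ ≤ ρ ^ 2 * (ε / T) / 2 := by
    have : ρ ^ 2 * (ε / T) / 2 = ρ * ε / T / 2 * ρ := by ring
    rw [this]
    refine mul_le_mul_of_nonneg_right ?_ hρ.le
    rw [div_div, le_div_iff₀ (by positivity)]
    linarith
  have e3 : √2 * ρ * A / 2 * d ^ 2 ≤ A * d ^ 2 * ρ := by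
    have : √2 * ρ * A / 2 * d ^ 2 = √2 / 2 * (A * d ^ 2 * ρ) := by ring
    rw [this]
    have : 0 ≤ A * d ^ 2 * ρ := by positivity
    nlinarith
  have e4 : 0 ≤ √3 * g * ρ := by positivity
  have e5 : 0 ≤ ρ ^ 2 * (ε / T) := by positivity
  linarith

/-- The optimality half of the first count: its two summands each leave half of the budget `ρ² ε/T`.
Here `A = ‖A‖/√α`, `g = M Ω/√α` and `ρ = √N`. -/
theorem const_first_gap_le {A Ω y g T ε ρ : ℝ} (hg : 0 ≤ g)
    (hT : 0 < T) (hε : 0 < ε) (hρ : 0 < ρ) (h1 : 2 * T * (√2 * A * (2 * Ω ^ 2 + y ^ 2)) / ε ≤ ρ ^ 2)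
    (h2 : 8 * √3 * T * g / ε ≤ ρ) :
    7 / 3 * √3 * g * ρ + √2 * A * Ω ^ 2 + √2 * A / 2 * y ^ 2 ≤ ρ ^ 2 * (ε / T) := by
  rw [div_le_iff₀ hε] at h1 h2
  have e1 : √2 * A * (2 * Ω ^ 2 + y ^ 2) ≤ ρ ^ 2 * (ε / T) / 2 := by
    have : ρ ^ 2 * (ε / T) / 2 = ρ ^ 2 * ε / (2 * T) := by field_simp
    rw [this, le_div_iff₀ (by positivity)]
    linarith
  have e2 : 8 * √3 * g * ρ ≤ ρ ^ 2 * (ε / T) := by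
    have : ρ ^ 2 * (ε / T) = ρ * ε / T * ρ := by ring
    rw [this]
    refine mul_le_mul_of_nonneg_right ?_ hρ.le
    rw [le_div_iff₀ (by positivity)]
    linarith
  have e4 : 0 ≤ √3 * g * ρ := by positivity
  have e5 : 0 ≤ ρ ^ 2 * (ε / T) := by positivity
  linarith

theorem const_first_residual_le {A Ω g T ε ρ : ℝ} (hA : 0 ≤ A) (hg : 0 ≤ g) (hT : 3 ≤ T)
    (hε : 0 < ε) (hρ : 0 < ρ) (h1 : 4 * T * (√2 * A * Ω ^ 2) / ε ≤ ρ ^ 2)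
    (h2 : 8 * √3 * T * g / ε ≤ ρ) (h3 : 27 * (T - 1) * A / (T * ε) ≤ ρ ^ 2) :
    2 * (√2 * A) * (7 / 3 * √3 * g * ρ + √2 * A * Ω ^ 2 + ρ ^ 2 * ((T - 1) * (ε / T)))
      ≤ 4 / 9 * ε ^ 2 * (ρ ^ 2) ^ 2 := by
  have hT0 : 0 < T := by linarith
  have s2 : √(2 : ℝ) ≤ 3 / 2 := by rw [Real.sqrt_le_iff]; norm_num
  have s2' : 1 ≤ √(2 : ℝ) := by rw [Real.one_le_sqrt]; norm_num
  have s22 : √(2 : ℝ) * √2 = 2 := Real.mul_self_sqrt (by norm_num)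
  set s := √(2 : ℝ)
  set z := √(3 : ℝ)
  have hz : 0 ≤ z := Real.sqrt_nonneg _
  rw [div_le_iff₀ hε] at h1 h2
  rw [div_le_iff₀ (by positivity)] at h3
  have k1 : 12 * (s * A * Ω ^ 2) ≤ ρ ^ 2 * ε := by
    have : 0 ≤ s * A * Ω ^ 2 := by positivity
    nlinarith
  have k2 : 24 * z * g ≤ ρ * ε := by
    have : 0 ≤ z * g := by positivity
    nlinarith
  -- As `T ≥ 3`, the factor `27 (T - 1)/T` is at least `18`. The count thus controls `A` alone, and
  -- multiplying this with `k1` and `k2` yields the products that occur in the residual.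
  have k3 : 18 * A ≤ ρ ^ 2 * ε := by
    have h4 : 18 * A * T ≤ ρ ^ 2 * ε * T := by nlinarith
    exact le_of_mul_le_mul_right h4 hT0
  have k4 : 27 * (A * ((T - 1) * (ε / T))) ≤ ρ ^ 2 * ε ^ 2 := by
    have : 27 * (A * ((T - 1) * (ε / T))) = 27 * (T - 1) * A * ε / T := by ring
    rw [this, div_le_iff₀ hT0]
    nlinarith
  set n := ρ ^ 2 with hn
  have hn0 : 0 < n := by positivity
  have p1 : 216 * (A * (s * A * Ω ^ 2)) ≤ ε ^ 2 * n ^ 2 := by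
    have := mul_le_mul k3 k1 (by positivity) (by positivity)
    nlinarith
  have p2 : 432 * (A * (z * g * ρ)) ≤ ε ^ 2 * n ^ 2 := by
    have := mul_le_mul k3 k2 (by positivity) (by positivity)
    have h5 := mul_le_mul_of_nonneg_right this hρ.le
    have h6 : n * ε * (ρ * ε) * ρ = ε ^ 2 * n ^ 2 := by rw [hn]; ring
    linarith
  have p3 : 27 * (A * ((T - 1) * (ε / T)) * n) ≤ ε ^ 2 * n ^ 2 := by
    have := mul_le_mul_of_nonneg_right k4 hn0.le
    nlinarith
  have q1 : 0 ≤ A * (s * A * Ω ^ 2) := by positivity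
  have q2 : 0 ≤ A * (z * g * ρ) := by positivity
  have q3 : 0 ≤ A * ((T - 1) * (ε / T)) * n := by
    have : 0 ≤ T - 1 := by linarith
    positivity
  have e : 2 * (s * A) * (7 / 3 * z * g * ρ + s * A * Ω ^ 2 + n * ((T - 1) * (ε / T)))
      = s * (14 / 3 * (A * (z * g * ρ)) + 2 * (A * (s * A * Ω ^ 2))
        + 2 * (A * ((T - 1) * (ε / T)) * n)) := by ring
  rw [e]
  calc _ ≤ 3 / 2 * (14 / 3 * (A * (z * g * ρ)) + 2 * (A * (s * A * Ω ^ 2))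
        + 2 * (A * ((T - 1) * (ε / T)) * n)) := by gcongr
    _ ≤ _ := by linarith

/-- The norm of `A` is bounded below but not above, so the number of iterations is not bounded
either. The factor `H = √2 ρ A` grows along with it, and dividing by `H/2` leaves a bound free of
`A` and `ρ`. -/
theorem const_dual_le {A A₀ Ω g e ρ C : ℝ} (hA₀ : 0 < A₀) (hA : A₀ ≤ A) (hg : 0 ≤ g) (he : 0 ≤ e)
    (hρ : 1 ≤ ρ) (hC : ρ ≤ C * A) :
    7 / 3 * √3 * g * ρ + √2 * A * Ω ^ 2 / ρ + ρ ^ 2 * e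
      ≤ √2 * ρ * A / 2 * (2 / √2 * (7 / 3 * √3 * g / A₀ + √2 * Ω ^ 2 + C * e)) := by
  have hA' : 0 < A := by linarith
  have e1 : √2 * ρ * A / 2 * (2 / √2 * (7 / 3 * √3 * g / A₀ + √2 * Ω ^ 2 + C * e))
      = 7 / 3 * √3 * g * ρ * (A / A₀) + √2 * A * Ω ^ 2 * ρ + ρ * e * (C * A) := by
    have : √(2 : ℝ) ≠ 0 := by positivity
    field_simp
  rw [e1]
  have h1 : 1 ≤ A / A₀ := by rwa [one_le_div hA₀]
  have h2 : 7 / 3 * √3 * g * ρ ≤ 7 / 3 * √3 * g * ρ * (A / A₀) :=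
    le_mul_of_one_le_right (by positivity) h1
  have h3 : √2 * A * Ω ^ 2 / ρ ≤ √2 * A * Ω ^ 2 * ρ := by
    have h5 : 1 ≤ ρ * ρ := by nlinarith
    rw [div_le_iff₀ (by positivity), mul_assoc (√2 * A * Ω ^ 2)]
    exact le_mul_of_one_le_right (by positivity) h5
  have h4 : ρ ^ 2 * e ≤ ρ * e * (C * A) := by
    have : ρ ^ 2 * e = ρ * e * ρ := by ring
    rw [this]
    gcongr
  linarith

/-- The outer loop with linearly increasing weights, in terms of `A = ‖A‖² / (α μ)` and
`g = M² / (α μ)`. -/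
theorem linear_first_gap_le {A y g T ε n : ℝ} (hA : 0 ≤ A) (hg : 0 ≤ g)
    (hT : 0 < T) (hε : 0 < ε) (hn : 0 < n)
    (h1 : 4 * √(T * A * y ^ 2 / ε) + 24 * T * g / ε ≤ n) :
    2 * A * y ^ 2 + 12 * (n + 1) * g ≤ n * (n + 1) / 2 * (ε / T) := by
  set p := √(T * A * y ^ 2 / ε) with hp
  have hp0 : 0 ≤ p := Real.sqrt_nonneg _
  have hp2 : p ^ 2 = T * A * y ^ 2 / ε := Real.sq_sqrt (by positivity)
  set u := 24 * T * g / ε with hu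
  have hu0 : 0 ≤ u := by positivity
  have e1 : A * y ^ 2 = p ^ 2 * (ε / T) := by rw [hp2]; field_simp
  have e2 : 12 * (n + 1) * g = (n + 1) * u / 2 * (ε / T) := by rw [hu]; field_simp; ring
  have e3 : 2 * A * y ^ 2 = 2 * p ^ 2 * (ε / T) := by linarith
  rw [e2, e3, ← add_mul]
  refine mul_le_mul_of_nonneg_right ?_ (by positivity)
  nlinarith

theorem linear_first_residual_le {A g T ε n : ℝ} (hT : 1 ≤ T)
    (hε : 0 < ε) (hn : 0 < n) (h1 : 3456 * (A * g) ≤ ε ^ 2 * n ^ 3)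
    (h2 : 144 * A * (T - 1) / (T * ε) ≤ n ^ 2) :
    2 * (4 * A) * (12 * (n + 1) * g + n * (n + 1) / 2 * ((T - 1) * (ε / T)))
      ≤ 4 / 9 * ε ^ 2 * (n * (n + 1) / 2) ^ 2 := by
  have hT0 : 0 < T := by linarith
  rw [div_le_iff₀ (by positivity)] at h2
  have k2 : 144 * (A * ((T - 1) * (ε / T))) ≤ n ^ 2 * ε ^ 2 := by
    have : 144 * (A * ((T - 1) * (ε / T))) = 144 * A * (T - 1) * ε / T := by ring
    rw [this, div_le_iff₀ hT0]
    nlinarith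
  -- Each of the two summands comes out at most `ε² n³ (n+1)/36`, while the right-hand side is `ε²
  -- n² (n+1)²/9`.
  have k3 := mul_le_mul_of_nonneg_right h1 (by positivity : 0 ≤ n + 1)
  have k4 := mul_le_mul_of_nonneg_right k2 (by positivity : 0 ≤ n * (n + 1))
  have k5 : 0 ≤ ε ^ 2 * n ^ 2 * (n + 1) := by positivity
  nlinarith

end DSA
end

/-! ### The parameters of the general convex case fit the analysis. -/

noncomputable section

namespace DSA

set_option linter.unusedSectionVars false

theorem add_sq_add_one_le {u v : ℝ} (hu : 0 ≤ u) (hv : 0 ≤ v) :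
    1 + u + v ^ 2 + 1 ≤ (2 + u + v) ^ 2 := by
  have : 0 ≤ u * v := by positivity
  nlinarith

theorem first_count_eq {a σ d Ω T ε : ℝ} (hσ : 0 < σ) (hT : 0 < T) (hε : 0 < ε) :
    (6 * T * a * (√2 * σ * d + 2 * Ω) + 27 * (T - 1) * σ * a) / (σ ^ 2 * T * ε)
      = 6 * (√2 * (a / σ) * d) / ε + 12 * (a / σ * Ω) / (σ * ε)
        + 27 * (T - 1) * (a / σ) / (T * ε) := by
  field_simp
  ring

variable {S : ℕ → Type*} [∀ t, MeasurableSpace (S t)]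
  {E : ℕ → Type*} [∀ t, NormedAddCommGroup (E t)] [∀ t, NormedSpace ℝ (E t)]
  [∀ t, FiniteDimensional ℝ (E t)] [∀ t, MeasurableSpace (E t)] [∀ t, BorelSpace (E t)]
  {m : ℕ → ℕ} {P : Problem S E m} {Q : Method S E m} {par : Params S m}

namespace Problem

/-- The step sizes of stage `t` are admissible, with an analysis that bounds the dual iterates
uniformly over bounded dual solutions. -/
def DualFits (P : Problem S E m) (Q : Method S E m) (par : Params S m) (μ M : ℕ → ℝ) (ε : ℝ)
    (t : ℕ) : Prop :=
  ∀ a > 0, ∀ D : ℝ, ∃ B, ∀ s q, a ≤ ‖P.A t s‖ → ‖Q.ystar t (s, q)‖ ≤ D →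
    ∃ c, P.Fits Q par t s q (μ t) (P.stageM M t) c ∧ 0 ≤ c.lam 0 ∧ 0 < c.H ∧
      c.lam 0 * P.Ω t ^ 2 + c.err (P.stageM M t) (par.N t s q)
        + weight par t s q * P.inexactness ε t ≤ c.H / 2 * B

/-- The step sizes of the first stage are admissible, and the loop is long enough. -/
def OuterFits (P : Problem S E m) (Q : Method S E m) (par : Params S m) (μ M : ℕ → ℝ) (ε : ℝ)
    (s : S 1) (q : Y m 1) : Prop :=
  ∃ c, P.Fits Q par 1 s q (μ 1) (P.stageM M 1) c ∧ 0 ≤ c.lam 0 ∧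
    c.lam 0 * P.Ω 1 ^ 2 + c.H / 2 * ‖Q.y0 1‖ ^ 2 + c.err (P.stageM M 1) (par.N 1 s q)
      ≤ weight par 1 s q * (ε / P.T) ∧
    c.H * ‖Q.ystar 1 (s, q) - Q.y0 1‖ ≤ weight par 1 s q * ε / 6 ∧
    2 * c.H * (c.lam 0 * P.Ω 1 ^ 2 + c.err (P.stageM M 1) (par.N 1 s q)
      + weight par 1 s q * P.inexactness ε 1) ≤ 4 / 9 * ε ^ 2 * weight par 1 s q ^ 2

theorem weight_of_const {t : ℕ} {s : S t} {q : Y m t} (hw : ∀ k, par.w t s q k = 1) :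
    weight par t s q = par.N t s q := by
  simp [weight, hw]

theorem weight_of_linear {t : ℕ} {s : S t} {q : Y m t} (hw : ∀ k, par.w t s q k = k) :
    weight par t s q = par.N t s q * (par.N t s q + 1) / 2 := by
  unfold weight
  simp only [hw]
  induction par.N t s q with
  | zero => simp
  | succ n ih =>
    rw [Finset.sum_Icc_succ_top (by omega), ih]
    push_cast
    ring

theorem measurable_norm_A (hP : P.Regular) {t : ℕ} (h1 : 1 ≤ t) (hT : t ≤ P.T) :
    Measurable fun p : S t × Y m t => ‖P.A t p.1‖ :=
  ((hP.meas_A t h1 hT).comp measurable_fst).norm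

theorem measurable_dist (hQ : P.Admissible Q) {t : ℕ} (h1 : 1 ≤ t) (hT : t ≤ P.T) :
    Measurable fun p : S t × Y m t => ‖Q.ystar t (p.1, p.2) - Q.y0 t‖ :=
  ((hQ.meas_ystar t h1 hT).sub_const _).norm

theorem measurable_convexParams (hP : P.Regular) (hQ : P.Admissible Q) (ε : ℝ) (M : ℕ → ℝ) :
    (convexParams P Q ε M).Meas P.T := by
  have hN : ∀ t, 1 ≤ t → t ≤ P.T →
      Measurable fun p : S t × Y m t => (convexParams P Q ε M).N t p.1 p.2 := by
    intro t h1 hT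
    have hA := measurable_norm_A hP h1 hT
    have hd := measurable_dist hQ h1 hT
    refine measurable_const.max (Measurable.nat_ceil ?_)
    split_ifs
    · fun_prop
    · fun_prop
    · fun_prop
  refine ⟨hN, fun t h1 hT k => measurable_const, fun t h1 hT k => ?_, fun t h1 hT k => ?_⟩
  · have hA := measurable_norm_A hP h1 hT
    have hN' : Measurable fun p : S t × Y m t => ((convexParams P Q ε M).N t p.1 p.2 : ℝ) :=
      measurable_from_nat.comp (hN t h1 hT)
    show Measurable fun p : S t × Y m t => if t = 1 then
        max (M 2 * √(3 * (convexParams P Q ε M).N t p.1 p.2) / (P.Ω t * √(P.α t)))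
          (√2 * ‖P.A t p.1‖ / √(P.α t))
      else if t < P.T then
        max (M (t + 1) * √(3 * (convexParams P Q ε M).N t p.1 p.2) / (P.Ω t * √(P.α t)))
          (√2 * ‖P.A t p.1‖ / √(P.α t * (convexParams P Q ε M).N t p.1 p.2))
      else √2 * ‖P.A t p.1‖ / √(P.α t)
    split_ifs <;> fun_prop
  · have hA := measurable_norm_A hP h1 hT
    have hN' : Measurable fun p : S t × Y m t => ((convexParams P Q ε M).N t p.1 p.2 : ℝ) :=
      measurable_from_nat.comp (hN t h1 hT)
    show Measurable fun p : S t × Y m t => if 1 < t ∧ t < P.T then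
        √(2 * (convexParams P Q ε M).N t p.1 p.2) * ‖P.A t p.1‖ / √(P.α t)
      else √2 * ‖P.A t p.1‖ / √(P.α t)
    split_ifs <;> fun_prop

theorem measurable_strongParams (hP : P.Regular) (hQ : P.Admissible Q) (μ : ℕ → ℝ) (ε : ℝ)
    (M : ℕ → ℝ) : (strongParams P Q μ ε M).Meas P.T := by
  have hN : ∀ t, 1 ≤ t → t ≤ P.T →
      Measurable fun p : S t × Y m t => (strongParams P Q μ ε M).N t p.1 p.2 := by
    intro t h1 hT
    have hA := measurable_norm_A hP h1 hT
    have hd := measurable_dist hQ h1 hT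
    refine measurable_const.max (Measurable.nat_ceil ?_)
    split_ifs
    · fun_prop
    · fun_prop
    · fun_prop
  refine ⟨hN, fun t h1 hT k => measurable_const, fun t h1 hT k => measurable_const,
    fun t h1 hT k => ?_⟩
  have hA := measurable_norm_A hP h1 hT
  have hN' : Measurable fun p : S t × Y m t => ((strongParams P Q μ ε M).N t p.1 p.2 : ℝ) :=
    measurable_from_nat.comp (hN t h1 hT)
  show Measurable fun p : S t × Y m t => if 1 < t ∧ t < P.T then
      4 * ‖P.A t p.1‖ ^ 2 * (strongParams P Q μ ε M).N t p.1 p.2 / (k * P.α t * μ t)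
    else 4 * ‖P.A t p.1‖ ^ 2 / (k * P.α t * μ t)
  split_ifs <;> fun_prop

/-- The factor `Ω` in the denominator of the step size is harmless. -/
theorem mul_div_mul_sq_le {x Ω σ : ℝ} (hΩ : 0 ≤ Ω) :
    x / (Ω * σ) * Ω ^ 2 = x * Ω / σ := by
  rcases hΩ.eq_or_lt with h | h
  · rw [← h]; simp
  · field_simp

theorem convexParams_N_pos (P : Problem S E m) (Q : Method S E m) (ε : ℝ) (M : ℕ → ℝ) (t : ℕ)
    (s : S t) (q : Y m t) : 1 ≤ (convexParams P Q ε M).N t s q := le_max_left _ _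

/-- The certificate of the middle loops. -/
theorem convexParams_middle (hP : P.Regular) {ε : ℝ} {M : ℕ → ℝ} {t : ℕ} (h1 : 1 < t)
    (hT : t < P.T) (hM : 0 ≤ M (t + 1)) (s : S t) (q : Y m t) :
    ∃ c, P.Fits Q (convexParams P Q ε M) t s q 0 (P.stageM M t) c ∧ 0 ≤ c.lam 0 ∧
      c.H = √2 * √((convexParams P Q ε M).N t s q) * (‖P.A t s‖ / √(P.α t)) ∧
      c.lam 0 * P.Ω t ^ 2 + c.err (P.stageM M t) ((convexParams P Q ε M).N t s q)
        ≤ 7 / 3 * √3 * (M (t + 1) * P.Ω t / √(P.α t)) * √((convexParams P Q ε M).N t s q)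
          + √2 * (‖P.A t s‖ / √(P.α t)) * P.Ω t ^ 2 / √((convexParams P Q ε M).N t s q) := by
  have hα := hP.α_pos t h1.le hT.le
  have hMs : P.stageM M t = M (t + 1) := if_pos hT
  have hN := convexParams_N_pos P Q ε M t s q
  have hN' : (0 : ℝ) < (convexParams P Q ε M).N t s q := by exact_mod_cast hN
  have hτ : ∀ k, (convexParams P Q ε M).τ t s q k
      = max (M (t + 1) * √(3 * (convexParams P Q ε M).N t s q) / (P.Ω t * √(P.α t)))
          (√2 * ‖P.A t s‖ / √(P.α t * (convexParams P Q ε M).N t s q)) := fun k => by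
    show (if t = 1 then _ else if t < P.T then _ else _) = _
    rw [if_neg h1.ne', if_pos hT]
    rfl
  have hη : ∀ k, (convexParams P Q ε M).η t s q k
      = √(2 * (convexParams P Q ε M).N t s q) * ‖P.A t s‖ / √(P.α t) := fun k => by
    show (if 1 < t ∧ t < P.T then _ else _) = _
    rw [if_pos ⟨h1, hT⟩]
    rfl
  set n : ℝ := ((convexParams P Q ε M).N t s q : ℝ) with hn
  have hΩ := P.Ω_nonneg t
  have hα0 : 0 < √(P.α t) := Real.sqrt_pos.2 hα
  have hn0 : 0 < √n := Real.sqrt_pos.2 hN'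
  have hnn : √n ^ 2 = n := Real.sq_sqrt hN'.le
  have hαα : √(P.α t) ^ 2 = P.α t := Real.sq_sqrt hα.le
  have h22 : √(2 : ℝ) ^ 2 = 2 := Real.sq_sqrt (by norm_num)
  have h33 : √(3 : ℝ) ^ 2 = 3 := Real.sq_sqrt (by norm_num)
  have e2 : √(2 * n) = √2 * √n := Real.sqrt_mul (by norm_num) _
  have e3 : √(3 * n) = √3 * √n := Real.sqrt_mul (by norm_num) _
  have eα : √(P.α t * n) = √(P.α t) * √n := Real.sqrt_mul hα.le _
  rw [e3, eα] at hτ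
  rw [e2] at hη
  set τ := max (M (t + 1) * (√3 * √n) / (P.Ω t * √(P.α t))) (√2 * ‖P.A t s‖ / (√(P.α t) * √n))
    with hτdef
  have hτ0 : 0 ≤ τ := le_max_of_le_right (by positivity)
  rw [hMs]
  have hA : 2 * ‖P.A t s‖ ^ 2 ≤ √2 * √n * ‖P.A t s‖ / √(P.α t) * τ * P.α t := by
    have h4 : √2 * ‖P.A t s‖ / (√(P.α t) * √n) ≤ τ := le_max_right _ _
    have h5 : √2 * √n * ‖P.A t s‖ / √(P.α t) * (√2 * ‖P.A t s‖ / (√(P.α t) * √n)) * P.α t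
        = 2 * ‖P.A t s‖ ^ 2 := by
      field_simp
      rw [h22, hαα]
      ring
    rw [← h5]
    gcongr
  have hη0 : P.A t s ≠ 0 → 0 < √2 * √n * ‖P.A t s‖ / √(P.α t) := fun h => by
    have : 0 < ‖P.A t s‖ := norm_pos_iff.2 h
    positivity
  have hη1 : P.A t s = 0 → √2 * √n * ‖P.A t s‖ / √(P.α t) = 0 := fun h => by
    rw [h]; simp
  have hMτ : 0 < M (t + 1) → 0 < P.Ω t →
      M (t + 1) * √(3 * (convexParams P Q ε M).N t s q) / (P.Ω t * √(P.α t)) ≤ τ := fun _ _ => by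
    rw [← hn, e3]; exact le_max_left _ _
  obtain ⟨c, hc, hc0, hcH, hce⟩ := fits_of_const (Q := Q) hP h1.le hT.le hN (fun _ => rfl) hτ hη
    hτ0 hA hη0 hη1 hM hMτ
  refine ⟨c, hc, hc0 ▸ hτ0, by rw [hcH]; ring, ?_⟩
  -- The maximum in `τ` is replaced by a sum. Its first part contributes `√3` and the accumulated
  -- errors `4/3 √3`, whence the constant `7/3 √3`.
  have h4 : τ * P.Ω t ^ 2 ≤ (M (t + 1) * (√3 * √n) / (P.Ω t * √(P.α t))
      + √2 * ‖P.A t s‖ / (√(P.α t) * √n)) * P.Ω t ^ 2 := by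
    refine mul_le_mul_of_nonneg_right (max_le_add_of_nonneg ?_ ?_) (by positivity) <;> positivity
  rw [add_mul, mul_div_mul_sq_le hΩ] at h4
  rw [hc0]
  have h5 : 4 * (M (t + 1) * P.Ω t) * √n / (√3 * √(P.α t))
      = 4 / 3 * √3 * (M (t + 1) * P.Ω t / √(P.α t)) * √n := by
    have : √(3 : ℝ) ≠ 0 := by positivity
    field_simp
    rw [h33]
  have h6 : M (t + 1) * (√3 * √n) * P.Ω t / √(P.α t)
      = √3 * (M (t + 1) * P.Ω t / √(P.α t)) * √n := by ring
  have h7 : √2 * ‖P.A t s‖ / (√(P.α t) * √n) * P.Ω t ^ 2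
      = √2 * (‖P.A t s‖ / √(P.α t)) * P.Ω t ^ 2 / √n := by field_simp
  rw [h5] at hce
  rw [h6, h7] at h4
  linarith

/-- The certificate of the outer loop. -/
theorem convexParams_first (hP : P.Regular) {ε : ℝ} {M : ℕ → ℝ} (hT : 1 < P.T) (hM : 0 ≤ M 2)
    (s : S 1) (q : Y m 1) :
    ∃ c, P.Fits Q (convexParams P Q ε M) 1 s q 0 (P.stageM M 1) c ∧ 0 ≤ c.lam 0 ∧
      c.H = √2 * (‖P.A 1 s‖ / √(P.α 1)) ∧
      c.lam 0 * P.Ω 1 ^ 2 + c.err (P.stageM M 1) ((convexParams P Q ε M).N 1 s q)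
        ≤ 7 / 3 * √3 * (M 2 * P.Ω 1 / √(P.α 1)) * √((convexParams P Q ε M).N 1 s q)
          + √2 * (‖P.A 1 s‖ / √(P.α 1)) * P.Ω 1 ^ 2 := by
  have hα := hP.α_pos 1 le_rfl hT.le
  have hMs : P.stageM M 1 = M 2 := if_pos hT
  have hN := convexParams_N_pos P Q ε M 1 s q
  have hN' : (0 : ℝ) < (convexParams P Q ε M).N 1 s q := by exact_mod_cast hN
  have hτ : ∀ k, (convexParams P Q ε M).τ 1 s q k
      = max (M 2 * √(3 * (convexParams P Q ε M).N 1 s q) / (P.Ω 1 * √(P.α 1)))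
          (√2 * ‖P.A 1 s‖ / √(P.α 1)) := fun k => by
    simp [convexParams]
  have hη : ∀ k, (convexParams P Q ε M).η 1 s q k = √2 * ‖P.A 1 s‖ / √(P.α 1) := fun k => by
    simp [convexParams]
  set n : ℝ := ((convexParams P Q ε M).N 1 s q : ℝ) with hn
  have hΩ := P.Ω_nonneg 1
  have hα0 : 0 < √(P.α 1) := Real.sqrt_pos.2 hα
  have hαα : √(P.α 1) ^ 2 = P.α 1 := Real.sq_sqrt hα.le
  have h22 : √(2 : ℝ) ^ 2 = 2 := Real.sq_sqrt (by norm_num)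
  have h33 : √(3 : ℝ) ^ 2 = 3 := Real.sq_sqrt (by norm_num)
  have e3 : √(3 * n) = √3 * √n := Real.sqrt_mul (by norm_num) _
  rw [e3] at hτ
  set τ := max (M 2 * (√3 * √n) / (P.Ω 1 * √(P.α 1))) (√2 * ‖P.A 1 s‖ / √(P.α 1))
    with hτdef
  have hτ0 : 0 ≤ τ := le_max_of_le_right (by positivity)
  rw [hMs]
  have hA : 2 * ‖P.A 1 s‖ ^ 2 ≤ √2 * ‖P.A 1 s‖ / √(P.α 1) * τ * P.α 1 := by
    have h4 : √2 * ‖P.A 1 s‖ / √(P.α 1) ≤ τ := le_max_right _ _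
    have h5 : √2 * ‖P.A 1 s‖ / √(P.α 1) * (√2 * ‖P.A 1 s‖ / √(P.α 1)) * P.α 1
        = 2 * ‖P.A 1 s‖ ^ 2 := by
      field_simp
      rw [h22, hαα]
      ring
    rw [← h5]
    gcongr
  have hη0 : P.A 1 s ≠ 0 → 0 < √2 * ‖P.A 1 s‖ / √(P.α 1) := fun h => by
    have : 0 < ‖P.A 1 s‖ := norm_pos_iff.2 h
    positivity
  have hη1 : P.A 1 s = 0 → √2 * ‖P.A 1 s‖ / √(P.α 1) = 0 := fun h => by
    rw [h]; simp
  have hMτ : 0 < M 2 → 0 < P.Ω 1 →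
      M 2 * √(3 * (convexParams P Q ε M).N 1 s q) / (P.Ω 1 * √(P.α 1)) ≤ τ := fun _ _ => by
    rw [← hn, e3]; exact le_max_left _ _
  obtain ⟨c, hc, hc0, hcH, hce⟩ := fits_of_const (Q := Q) hP le_rfl hT.le hN (fun _ => rfl) hτ hη
    hτ0 hA hη0 hη1 hM hMτ
  refine ⟨c, hc, hc0 ▸ hτ0, by rw [hcH]; ring, ?_⟩
  have h4 : τ * P.Ω 1 ^ 2 ≤ (M 2 * (√3 * √n) / (P.Ω 1 * √(P.α 1))
      + √2 * ‖P.A 1 s‖ / √(P.α 1)) * P.Ω 1 ^ 2 := by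
    refine mul_le_mul_of_nonneg_right (max_le_add_of_nonneg ?_ ?_) (by positivity) <;> positivity
  rw [add_mul, mul_div_mul_sq_le hΩ] at h4
  rw [hc0]
  have h5 : 4 * (M 2 * P.Ω 1) * √n / (√3 * √(P.α 1))
      = 4 / 3 * √3 * (M 2 * P.Ω 1 / √(P.α 1)) * √n := by
    have : √(3 : ℝ) ≠ 0 := by positivity
    field_simp
    rw [h33]
  have h6 : M 2 * (√3 * √n) * P.Ω 1 / √(P.α 1)
      = √3 * (M 2 * P.Ω 1 / √(P.α 1)) * √n := by ring
  have h7 : √2 * ‖P.A 1 s‖ / √(P.α 1) * P.Ω 1 ^ 2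
      = √2 * (‖P.A 1 s‖ / √(P.α 1)) * P.Ω 1 ^ 2 := by ring
  rw [h5] at hce
  rw [h6, h7] at h4
  linarith

/-- The certificate of the innermost loop. -/
theorem convexParams_last (hP : P.Regular) {ε : ℝ} {M : ℕ → ℝ} (hT : 1 < P.T)
    (s : S P.T) (q : Y m P.T) :
    ∃ c, P.Fits Q (convexParams P Q ε M) P.T s q 0 (P.stageM M P.T) c ∧ 
      c.lam 0 = √2 * (‖P.A P.T s‖ / √(P.α P.T)) ∧ c.H = √2 * (‖P.A P.T s‖ / √(P.α P.T)) ∧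
      c.err (P.stageM M P.T) ((convexParams P Q ε M).N P.T s q) ≤ 0 := by
  have hα := hP.α_pos P.T hT.le le_rfl
  have hMs : P.stageM M P.T = 0 := if_neg (lt_irrefl _)
  have hN := convexParams_N_pos P Q ε M P.T s q
  have hτ : ∀ k, (convexParams P Q ε M).τ P.T s q k = √2 * ‖P.A P.T s‖ / √(P.α P.T) := fun k => by
    show (if P.T = 1 then _ else if P.T < P.T then _ else _) = _
    rw [if_neg hT.ne', if_neg (lt_irrefl _)]
  have hη : ∀ k, (convexParams P Q ε M).η P.T s q k = √2 * ‖P.A P.T s‖ / √(P.α P.T) := fun k => by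
    show (if 1 < P.T ∧ P.T < P.T then _ else _) = _
    rw [if_neg (by simp)]
  have hα0 : 0 < √(P.α P.T) := Real.sqrt_pos.2 hα
  have hαα : √(P.α P.T) ^ 2 = P.α P.T := Real.sq_sqrt hα.le
  have h22 : √(2 : ℝ) ^ 2 = 2 := Real.sq_sqrt (by norm_num)
  rw [hMs]
  have hA : 2 * ‖P.A P.T s‖ ^ 2
      ≤ √2 * ‖P.A P.T s‖ / √(P.α P.T) * (√2 * ‖P.A P.T s‖ / √(P.α P.T)) * P.α P.T := by
    refine le_of_eq ?_
    field_simp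
    rw [h22, hαα]
    ring
  have hη0 : P.A P.T s ≠ 0 → 0 < √2 * ‖P.A P.T s‖ / √(P.α P.T) := fun h => by
    have : 0 < ‖P.A P.T s‖ := norm_pos_iff.2 h
    positivity
  have hη1 : P.A P.T s = 0 → √2 * ‖P.A P.T s‖ / √(P.α P.T) = 0 := fun h => by
    rw [h]; simp
  obtain ⟨c, hc, hc0, hcH, hce⟩ := fits_of_const (Q := Q) hP hT.le le_rfl hN (fun _ => rfl) hτ hη
    (M := 0) (by positivity) hA hη0 hη1 le_rfl (fun h => absurd h (lt_irrefl _))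
  refine ⟨c, hc, by rw [hc0]; ring, by rw [hcH]; ring, ?_⟩
  rwa [zero_mul, mul_zero, zero_mul, zero_div] at hce

theorem innerFits_convexParams (hP : P.Regular) (hT3 : 3 ≤ P.T) {ε : ℝ} (hε : 0 < ε) {M : ℕ → ℝ}
    {t : ℕ} (h1 : 1 < t) (hT : t ≤ P.T) (hM : t < P.T → 0 ≤ M (t + 1)) :
    P.InnerFits Q (convexParams P Q ε M) (fun _ => 0) M ε t := by
  intro s q
  have hα := hP.α_pos t h1.le hT
  have hα0 : 0 < √(P.α t) := Real.sqrt_pos.2 hα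
  have hT0 : (0 : ℝ) < P.T := by exact_mod_cast (by omega : 0 < P.T)
  have hw : weight (convexParams P Q ε M) t s q = (convexParams P Q ε M).N t s q :=
    weight_of_const fun _ => rfl
  have hN := convexParams_N_pos P Q ε M t s q
  have hN' : (0 : ℝ) < (convexParams P Q ε M).N t s q := by exact_mod_cast hN
  have hΩ := P.Ω_nonneg t
  rcases hT.lt_or_eq with hlt | rfl
  · obtain ⟨c, hc, hl, hH, he⟩ := convexParams_middle (Q := Q) (ε := ε) hP h1 hlt (hM hlt) s q
    refine ⟨c, hc, hl, ?_⟩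
    have hM0 := hM hlt
    have hb := le_max_one_ceil ((4 * √2 * P.T * ‖P.A t s‖ * P.Ω t ^ 2 / (√(P.α t) * ε)) ^ (2 / 3 : ℝ)
          + (2 * P.T * (‖P.A t s‖ * ‖Q.ystar t (s, q) - Q.y0 t‖ ^ 2 + 4 * √3 * M (t + 1) * P.Ω t)
              / (√(P.α t) * ε)) ^ 2)
    have hNe : (convexParams P Q ε M).N t s q = max 1 ⌈(4 * √2 * P.T * ‖P.A t s‖ * P.Ω t ^ 2
          / (√(P.α t) * ε)) ^ (2 / 3 : ℝ)
          + (2 * P.T * (‖P.A t s‖ * ‖Q.ystar t (s, q) - Q.y0 t‖ ^ 2 + 4 * √3 * M (t + 1) * P.Ω t)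
              / (√(P.α t) * ε)) ^ 2⌉₊ := by
      show max 1 ⌈if t = 1 then _ else if t < P.T then _ else _⌉₊ = _
      rw [if_neg h1.ne', if_pos hlt]
    rw [← hNe] at hb
    rw [hw, hH]
    set n : ℝ := ((convexParams P Q ε M).N t s q : ℝ) with hn
    have hn0 : 0 < √n := Real.sqrt_pos.2 hN'
    have hnn : √n ^ 2 = n := Real.sq_sqrt hN'.le
    have key := const_middle_le (A := ‖P.A t s‖ / √(P.α t)) (Ω := P.Ω t)
      (d := ‖Q.ystar t (s, q) - Q.y0 t‖) (g := M (t + 1) * P.Ω t / √(P.α t)) (T := P.T) (ε := ε)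
      (ρ := √n) (by positivity) (by positivity) hT0 hε hn0 ?_ ?_
    · rw [hnn] at key
      linarith
    · have := le_sqrt_pow_three_of_rpow_le (by positivity) hN'.le
        ((le_add_of_nonneg_right (by positivity)).trans hb)
      refine le_of_eq_of_le ?_ this
      field_simp
    · have := Real.le_sqrt_of_sq_le ((le_add_of_nonneg_left (by positivity)).trans hb)
      refine le_of_eq_of_le ?_ this
      field_simp
  · obtain ⟨c, hc, hl, hH, he⟩ := convexParams_last (Q := Q) (ε := ε) (M := M) hP h1 s q
    refine ⟨c, hc, by rw [hl]; positivity, ?_⟩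
    have hb := le_max_one_ceil (P.T * √2 * ‖P.A P.T s‖
      * (2 * P.Ω P.T ^ 2 + ‖Q.ystar P.T (s, q) - Q.y0 P.T‖ ^ 2) / (√(P.α P.T) * ε))
    have hNe : (convexParams P Q ε M).N P.T s q = max 1 ⌈P.T * √2 * ‖P.A P.T s‖
      * (2 * P.Ω P.T ^ 2 + ‖Q.ystar P.T (s, q) - Q.y0 P.T‖ ^ 2) / (√(P.α P.T) * ε)⌉₊ := by
      show max 1 ⌈if P.T = 1 then _ else if P.T < P.T then _ else _⌉₊ = _
      rw [if_neg h1.ne', if_neg (lt_irrefl _)]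
    rw [← hNe] at hb
    rw [hw, hl, hH]
    set n : ℝ := ((convexParams P Q ε M).N P.T s q : ℝ) with hn
    set d := ‖Q.ystar P.T (s, q) - Q.y0 P.T‖
    have h5 : √2 * (‖P.A P.T s‖ / √(P.α P.T)) * (2 * P.Ω P.T ^ 2 + d ^ 2) ≤ n * (ε / P.T) := by
      have := mul_le_mul_of_nonneg_right hb (by positivity : 0 ≤ ε / (P.T : ℝ))
      refine le_of_eq_of_le ?_ this
      field_simp
    have h6 : 0 ≤ n * (ε / P.T) := by positivity
    linarith

theorem outerFits_convexParams (hP : P.Regular) (hT3 : 3 ≤ P.T) {ε : ℝ} (hε : 0 < ε) {M : ℕ → ℝ}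
    (hM : 0 ≤ M 2) (s : S 1) (q : Y m 1) :
    P.OuterFits Q (convexParams P Q ε M) (fun _ => 0) M ε s q := by
  have h1T : 1 < P.T := by omega
  have hα := hP.α_pos 1 le_rfl h1T.le
  have hα0 : 0 < √(P.α 1) := Real.sqrt_pos.2 hα
  have hαα : √(P.α 1) ^ 2 = P.α 1 := Real.sq_sqrt hα.le
  have hT0 : (3 : ℝ) ≤ P.T := by exact_mod_cast hT3
  have hT1 : (0 : ℝ) < P.T := by linarith
  have hT2 : (0 : ℝ) ≤ P.T - 1 := by linarith
  have hw : weight (convexParams P Q ε M) 1 s q = (convexParams P Q ε M).N 1 s q :=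
    weight_of_const fun _ => rfl
  have hN := convexParams_N_pos P Q ε M 1 s q
  have hN' : (0 : ℝ) < (convexParams P Q ε M).N 1 s q := by exact_mod_cast hN
  have hΩ := P.Ω_nonneg 1
  obtain ⟨c, hc, hl, hH, he⟩ := convexParams_first (Q := Q) (ε := ε) hP h1T hM s q
  have hb := le_max_one_ceil (max
      (2 * √2 * P.T * ‖P.A 1 s‖ * (2 * P.Ω 1 ^ 2 + ‖Q.y0 1‖ ^ 2) / (√(P.α 1) * ε)
        + (8 * √3 * P.T * M 2 * P.Ω 1 / (√(P.α 1) * ε)) ^ 2)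
      ((6 * P.T * ‖P.A 1 s‖ * (√(2 * P.α 1) * ‖Q.ystar 1 (s, q) - Q.y0 1‖ + 2 * P.Ω 1)
            + 27 * (P.T - 1) * √(P.α 1) * ‖P.A 1 s‖) / (P.α 1 * P.T * ε)
        + (6 * √3 * M 2 * (√2 * ‖P.A 1 s‖ + √(P.α 1)) / (P.α 1 * ε)) ^ 2))
  have hNe : (convexParams P Q ε M).N 1 s q = max 1 ⌈max
      (2 * √2 * P.T * ‖P.A 1 s‖ * (2 * P.Ω 1 ^ 2 + ‖Q.y0 1‖ ^ 2) / (√(P.α 1) * ε)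
        + (8 * √3 * P.T * M 2 * P.Ω 1 / (√(P.α 1) * ε)) ^ 2)
      ((6 * P.T * ‖P.A 1 s‖ * (√(2 * P.α 1) * ‖Q.ystar 1 (s, q) - Q.y0 1‖ + 2 * P.Ω 1)
            + 27 * (P.T - 1) * √(P.α 1) * ‖P.A 1 s‖) / (P.α 1 * P.T * ε)
        + (6 * √3 * M 2 * (√2 * ‖P.A 1 s‖ + √(P.α 1)) / (P.α 1 * ε)) ^ 2)⌉₊ := by
    show max 1 ⌈if 1 = 1 then _ else if 1 < P.T then _ else _⌉₊ = _
    rw [if_pos rfl]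
  rw [← hNe] at hb
  have hb1 := (le_max_left _ _).trans hb
  have hb2 := (le_max_right _ _).trans hb
  clear hb hNe
  have e2 : √(2 * P.α 1) = √2 * √(P.α 1) := Real.sqrt_mul (by norm_num) _
  rw [e2] at hb2
  set n : ℝ := ((convexParams P Q ε M).N 1 s q : ℝ) with hn
  set d := ‖Q.ystar 1 (s, q) - Q.y0 1‖ with hd
  set A := ‖P.A 1 s‖ / √(P.α 1) with hA
  set g := M 2 * P.Ω 1 / √(P.α 1) with hg
  have hA0 : 0 ≤ A := by positivity
  have hg0 : 0 ≤ g := by positivity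
  have hd0 : 0 ≤ d := by positivity
  have hn0 : 0 < √n := Real.sqrt_pos.2 hN'
  have hnn : √n ^ 2 = n := Real.sq_sqrt hN'.le
  have f1 : 2 * √2 * P.T * ‖P.A 1 s‖ * (2 * P.Ω 1 ^ 2 + ‖Q.y0 1‖ ^ 2) / (√(P.α 1) * ε)
      = 2 * P.T * (√2 * A * (2 * P.Ω 1 ^ 2 + ‖Q.y0 1‖ ^ 2)) / ε := by
    rw [hA]; field_simp
  have f2 : 8 * √3 * P.T * M 2 * P.Ω 1 / (√(P.α 1) * ε) = 8 * √3 * P.T * g / ε := by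
    rw [hg]; field_simp
  have f3 : (6 * P.T * ‖P.A 1 s‖ * (√2 * √(P.α 1) * d + 2 * P.Ω 1)
        + 27 * (P.T - 1) * √(P.α 1) * ‖P.A 1 s‖) / (P.α 1 * P.T * ε)
      = 6 * (√2 * A * d) / ε + 12 * (A * P.Ω 1) / (√(P.α 1) * ε)
        + 27 * (P.T - 1) * A / (P.T * ε) := by
    have := first_count_eq (a := ‖P.A 1 s‖) (d := d) (Ω := P.Ω 1) hα0 hT1 hε
    rwa [hαα] at this
  rw [f1, f2] at hb1
  rw [f3] at hb2
  have b1 : 2 * P.T * (√2 * A * (2 * P.Ω 1 ^ 2 + ‖Q.y0 1‖ ^ 2)) / ε ≤ √n ^ 2 := by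
    rw [hnn]; exact (le_add_of_nonneg_right (by positivity)).trans hb1
  have b2 : 8 * √3 * P.T * g / ε ≤ √n :=
    Real.le_sqrt_of_sq_le ((le_add_of_nonneg_left (by positivity)).trans hb1)
  have g1 : 0 ≤ 6 * (√2 * A * d) / ε := by positivity
  have g2 : 0 ≤ 12 * (A * P.Ω 1) / (√(P.α 1) * ε) := by positivity
  have g3 : 0 ≤ 27 * (P.T - 1) * A / (P.T * ε) := by positivity
  have g4 : 0 ≤ (6 * √3 * M 2 * (√2 * ‖P.A 1 s‖ + √(P.α 1)) / (P.α 1 * ε)) ^ 2 := by positivity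
  have b3 : 27 * (P.T - 1) * A / (P.T * ε) ≤ √n ^ 2 := by rw [hnn]; linarith
  have b4 : 6 * (√2 * A * d) / ε ≤ n := by linarith
  have b5 : 4 * P.T * (√2 * A * P.Ω 1 ^ 2) / ε ≤ √n ^ 2 := by
    refine le_trans ?_ b1
    refine div_le_div_of_nonneg_right ?_ hε.le
    have : 0 ≤ P.T * (√2 * A * ‖Q.y0 1‖ ^ 2) := by positivity
    linarith
  have k1 := const_first_gap_le hg0 hT1 hε hn0 b1 b2
  have k2 := const_first_residual_le hA0 hg0 hT0 hε hn0 b5 b2 b3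
  rw [hnn] at k1 k2
  refine ⟨c, hc, hl, ?_, ?_, ?_⟩
  · rw [hw, hH]
    linarith
  · rw [hw, hH]
    rw [div_le_iff₀ hε] at b4
    linarith
  · rw [hw, hH]
    refine le_trans ?_ k2
    have : P.inexactness ε 1 = (P.T - 1) * (ε / P.T) := by simp [inexactness]
    rw [this]
    gcongr

theorem dualFits_convexParams (hP : P.Regular) (hT3 : 3 ≤ P.T) {ε : ℝ} (hε : 0 < ε) {M : ℕ → ℝ}
    {t : ℕ} (h1 : 1 < t) (hT : t ≤ P.T) (hM : t < P.T → 0 ≤ M (t + 1)) :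
    P.DualFits Q (convexParams P Q ε M) (fun _ => 0) M ε t := by
  intro a ha D
  have hα := hP.α_pos t h1.le hT
  have hα0 : 0 < √(P.α t) := Real.sqrt_pos.2 hα
  have hT0 : (0 : ℝ) < P.T := by exact_mod_cast (by omega : 0 < P.T)
  have hΩ := P.Ω_nonneg t
  rcases hT.lt_or_eq with hlt | rfl
  · have hM0 := hM hlt
    have he0 := P.inexactness_nonneg hε hT
    set c₁ := 4 * √2 * P.T * P.Ω t ^ 2 / ε with hc₁
    set c₂ := 2 * P.T * (|D| + ‖Q.y0 t‖) ^ 2 / ε with hc₂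
    set c₃ := 2 * P.T * (4 * √3 * M (t + 1) * P.Ω t) / (√(P.α t) * ε) with hc₃
    set A₀ := a / √(P.α t) with hA₀
    have hA₀0 : 0 < A₀ := by positivity
    -- The count gives `√N ≤ 2 + c₁ A + c₂ A + c₃`, affine in the scaled norm `A`; the lower bound
    -- `A₀ ≤ A` turns this into `√N ≤ C A`.
    set C := (2 + c₃) / A₀ + c₁ + c₂ with hC
    refine ⟨2 / √2 * (7 / 3 * √3 * (M (t + 1) * P.Ω t / √(P.α t)) / A₀ + √2 * P.Ω t ^ 2
        + C * P.inexactness ε t), fun s q hsa hsD => ?_⟩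
    have hw : weight (convexParams P Q ε M) t s q = (convexParams P Q ε M).N t s q :=
      weight_of_const fun _ => rfl
    have hN := convexParams_N_pos P Q ε M t s q
    have hN' : (1 : ℝ) ≤ (convexParams P Q ε M).N t s q := by exact_mod_cast hN
    obtain ⟨c, hc, hl, hH, he⟩ := convexParams_middle (Q := Q) (ε := ε) hP h1 hlt (hM hlt) s q
    have hA0 : 0 < ‖P.A t s‖ := by linarith
    have hNe : (convexParams P Q ε M).N t s q = max 1 ⌈(4 * √2 * P.T * ‖P.A t s‖ * P.Ω t ^ 2
          / (√(P.α t) * ε)) ^ (2 / 3 : ℝ)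
          + (2 * P.T * (‖P.A t s‖ * ‖Q.ystar t (s, q) - Q.y0 t‖ ^ 2 + 4 * √3 * M (t + 1) * P.Ω t)
              / (√(P.α t) * ε)) ^ 2⌉₊ := by
      show max 1 ⌈if t = 1 then _ else if t < P.T then _ else _⌉₊ = _
      rw [if_neg h1.ne', if_pos hlt]
    set n : ℝ := ((convexParams P Q ε M).N t s q : ℝ) with hn
    have hb : n ≤ (4 * √2 * P.T * ‖P.A t s‖ * P.Ω t ^ 2 / (√(P.α t) * ε)) ^ (2 / 3 : ℝ)
          + (2 * P.T * (‖P.A t s‖ * ‖Q.ystar t (s, q) - Q.y0 t‖ ^ 2 + 4 * √3 * M (t + 1) * P.Ω t)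
              / (√(P.α t) * ε)) ^ 2 + 1 := by
      rw [hn, hNe]
      exact max_one_ceil_le (by positivity)
    have hn0 : 1 ≤ √n := Real.one_le_sqrt.2 hN'
    have hnn : √n ^ 2 = n := Real.sq_sqrt (by linarith)
    set A := ‖P.A t s‖ / √(P.α t) with hA
    have hAA : A₀ ≤ A := by rw [hA₀, hA]; gcongr
    have hA0' : 0 < A := by positivity
    have f1 : 4 * √2 * P.T * ‖P.A t s‖ * P.Ω t ^ 2 / (√(P.α t) * ε) = c₁ * A := by
      rw [hc₁, hA]; field_simp
    have f2 : 2 * P.T * (‖P.A t s‖ * ‖Q.ystar t (s, q) - Q.y0 t‖ ^ 2 + 4 * √3 * M (t + 1) * P.Ω t)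
              / (√(P.α t) * ε) ≤ c₂ * A + c₃ := by
      have e1 : c₂ * A + c₃ = 2 * P.T * (‖P.A t s‖ * (|D| + ‖Q.y0 t‖) ^ 2
          + 4 * √3 * M (t + 1) * P.Ω t) / (√(P.α t) * ε) := by
        rw [hc₂, hc₃, hA]; field_simp
      rw [e1]
      have : ‖Q.ystar t (s, q) - Q.y0 t‖ ≤ |D| + ‖Q.y0 t‖ :=
        (norm_sub_le _ _).trans (by have := le_abs_self D; gcongr; linarith)
      gcongr
    have hc₁0 : 0 ≤ c₁ := by positivity
    have hc₂0 : 0 ≤ c₂ := by positivity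
    have hc₃0 : 0 ≤ c₃ := by positivity
    have hCρ : √n ≤ C * A := by
      have h5 : √n ≤ 2 + c₁ * A + (c₂ * A + c₃) := by
        rw [Real.sqrt_le_iff]
        have h7 : 0 ≤ c₁ * A := by positivity
        have h8 : 0 ≤ c₂ * A + c₃ := by positivity
        refine ⟨by positivity, hb.trans ?_⟩
        rw [f1]
        have h6 := rpow_two_thirds_le (x := c₁ * A) (by positivity)
        have h9 : (2 * P.T * (‖P.A t s‖ * ‖Q.ystar t (s, q) - Q.y0 t‖ ^ 2
            + 4 * √3 * M (t + 1) * P.Ω t) / (√(P.α t) * ε)) ^ 2 ≤ (c₂ * A + c₃) ^ 2 := by gcongr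
        linarith [add_sq_add_one_le h7 h8]
      have h6 : (2 + c₃) ≤ (2 + c₃) / A₀ * A := by
        rw [div_mul_eq_mul_div, le_div_iff₀ hA₀0]
        gcongr
      rw [hC]
      linarith
    refine ⟨c, hc, hl, by rw [hH]; positivity, ?_⟩
    rw [hw, hH]
    have key := const_dual_le (Ω := P.Ω t) (g := M (t + 1) * P.Ω t / √(P.α t)) hA₀0 hAA
      (by positivity) he0 hn0 hCρ
    rw [hnn] at key
    linarith
  -- At the last stage `λ₀ = H`, and there is neither a subgradient error nor any inexactness.
  · refine ⟨2 * P.Ω P.T ^ 2, fun s q hsa _ => ?_⟩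
    obtain ⟨c, hc, hl, hH, he⟩ := convexParams_last (Q := Q) (ε := ε) (M := M) hP h1 s q
    have hA0 : 0 < ‖P.A P.T s‖ := by linarith
    refine ⟨c, hc, by rw [hl]; positivity, by rw [hH]; positivity, ?_⟩
    have : P.inexactness ε P.T = 0 := by simp [inexactness]
    rw [this, hl, hH, mul_zero]
    linarith

end Problem

end DSA
end

/-! ### The parameters of the strongly convex case fit the analysis. -/

noncomputable section

namespace DSA

set_option linter.unusedSectionVars false

/-- As with constant step sizes, `A` has no upper bound. The count is affine in `A = ‖A‖²/(α μ)` and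
`H = 4 A n`, so dividing by `H/2` removes both `A` and `n`. -/
theorem linear_dual_le {A A₀ g e n c C : ℝ} (hA₀ : 0 < A₀) (hA : A₀ ≤ A) (hg : 0 ≤ g) (he : 0 ≤ e)
    (hc : 0 ≤ c) (hn : 1 ≤ n) (hn' : n ≤ c + C * A) :
    12 * (n + 1) * g + n * (n + 1) / 2 * e
      ≤ 4 * A * n / 2 * (12 * g / A₀ + e * (c / A₀ + C) / 2) := by
  have e1 : 4 * A * n / 2 * (12 * g / A₀ + e * (c / A₀ + C) / 2)
      = 24 * n * g * (A / A₀) + n * e * (c * (A / A₀) + C * A) := by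
    field_simp
    ring
  rw [e1]
  have h1 : 1 ≤ A / A₀ := by rwa [one_le_div hA₀]
  have h2 : 24 * n * g ≤ 24 * n * g * (A / A₀) := le_mul_of_one_le_right (by positivity) h1
  have h3 : n ≤ c * (A / A₀) + C * A := by
    have := le_mul_of_one_le_right hc h1
    linarith
  have h4 : n * e * n ≤ n * e * (c * (A / A₀) + C * A) := by gcongr
  have h5 : 12 * (n + 1) * g ≤ 24 * n * g := by nlinarith
  have h6 : n * (n + 1) / 2 * e ≤ n * e * n := by
    have : 0 ≤ n * e := by positivity
    nlinarith
  linarith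

variable {S : ℕ → Type*} [∀ t, MeasurableSpace (S t)]
  {E : ℕ → Type*} [∀ t, NormedAddCommGroup (E t)] [∀ t, NormedSpace ℝ (E t)]
  [∀ t, FiniteDimensional ℝ (E t)] [∀ t, MeasurableSpace (E t)] [∀ t, BorelSpace (E t)]
  {m : ℕ → ℕ} {P : Problem S E m} {Q : Method S E m} {par : Params S m}

namespace Problem

theorem strongParams_N_pos (P : Problem S E m) (Q : Method S E m) (μ : ℕ → ℝ) (ε : ℝ) (M : ℕ → ℝ)
    (t : ℕ) (s : S t) (q : Y m t) : 1 ≤ (strongParams P Q μ ε M).N t s q := le_max_left _ _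

theorem strongParams_middle (hP : P.Regular) {μ : ℕ → ℝ} {ε : ℝ} {M : ℕ → ℝ} {t : ℕ} (h1 : 1 < t)
    (hT : t < P.T) (hμ : 0 < μ t) (s : S t) (q : Y m t) :
    ∃ c, P.Fits Q (strongParams P Q μ ε M) t s q (μ t) (P.stageM M t) c ∧ c.lam 0 = 0 ∧
      c.H = 4 * (‖P.A t s‖ ^ 2 / (P.α t * μ t)) * (strongParams P Q μ ε M).N t s q ∧
      c.err (P.stageM M t) ((strongParams P Q μ ε M).N t s q)
        ≤ 12 * ((strongParams P Q μ ε M).N t s q + 1) * (M (t + 1) ^ 2 / (P.α t * μ t)) := by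
  have hα := hP.α_pos t h1.le hT.le
  have hMs : P.stageM M t = M (t + 1) := if_pos hT
  have hN := strongParams_N_pos P Q μ ε M t s q
  have hN' : (1 : ℝ) ≤ (strongParams P Q μ ε M).N t s q := by exact_mod_cast hN
  have hη : ∀ k : ℕ, ((k : ℝ) + 1) * (strongParams P Q μ ε M).η t s q (k + 1)
      = 4 * (‖P.A t s‖ ^ 2 / (P.α t * μ t)) * (strongParams P Q μ ε M).N t s q := fun k => by
    have : (strongParams P Q μ ε M).η t s q (k + 1)
        = 4 * ‖P.A t s‖ ^ 2 * (strongParams P Q μ ε M).N t s q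
          / ((k + 1 : ℕ) * P.α t * μ t) := by
      show (if 1 < t ∧ t < P.T then _ else _) = _
      rw [if_pos ⟨h1, hT⟩]
      rfl
    rw [this]
    push_cast
    field_simp
  rw [hMs]
  have hA : 4 * ‖P.A t s‖ ^ 2 ≤ 4 * (‖P.A t s‖ ^ 2 / (P.α t * μ t))
      * (strongParams P Q μ ε M).N t s q * (P.α t * μ t) := by
    have : 4 * (‖P.A t s‖ ^ 2 / (P.α t * μ t)) * (strongParams P Q μ ε M).N t s q * (P.α t * μ t)
        = 4 * ‖P.A t s‖ ^ 2 * (strongParams P Q μ ε M).N t s q := by field_simp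
    rw [this]
    exact le_mul_of_one_le_right (by positivity) hN'
  obtain ⟨c, hc, hl, hH, he⟩ := fits_of_linear (Q := Q) (M := M (t + 1)) hP h1.le hT.le hN
    (fun _ => rfl) (fun _ => rfl) hη hμ hA (fun h => by rw [h]; simp)
  refine ⟨c, hc, hl, hH, ?_⟩
  rwa [mul_div_assoc] at he

theorem strongParams_first_last (hP : P.Regular) {μ : ℕ → ℝ} {ε : ℝ} {M : ℕ → ℝ} {t : ℕ}
    (h1 : 1 ≤ t) (hT : t ≤ P.T) (ht : ¬(1 < t ∧ t < P.T)) (hμ : 0 < μ t) (s : S t) (q : Y m t) :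
    ∃ c, P.Fits Q (strongParams P Q μ ε M) t s q (μ t) (P.stageM M t) c ∧ c.lam 0 = 0 ∧
      c.H = 4 * (‖P.A t s‖ ^ 2 / (P.α t * μ t)) ∧
      c.err (P.stageM M t) ((strongParams P Q μ ε M).N t s q)
        ≤ 12 * ((strongParams P Q μ ε M).N t s q + 1) * (P.stageM M t ^ 2 / (P.α t * μ t)) := by
  have hα := hP.α_pos t h1 hT
  have hN := strongParams_N_pos P Q μ ε M t s q
  have hη : ∀ k : ℕ, ((k : ℝ) + 1) * (strongParams P Q μ ε M).η t s q (k + 1)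
      = 4 * (‖P.A t s‖ ^ 2 / (P.α t * μ t)) := fun k => by
    have : (strongParams P Q μ ε M).η t s q (k + 1)
        = 4 * ‖P.A t s‖ ^ 2 / ((k + 1 : ℕ) * P.α t * μ t) := by
      show (if 1 < t ∧ t < P.T then _ else _) = _
      rw [if_neg ht]
    rw [this]
    push_cast
    field_simp
  have hA : 4 * ‖P.A t s‖ ^ 2 ≤ 4 * (‖P.A t s‖ ^ 2 / (P.α t * μ t)) * (P.α t * μ t) := by
    refine le_of_eq ?_
    field_simp
  obtain ⟨c, hc, hl, hH, he⟩ := fits_of_linear (Q := Q) (M := P.stageM M t) hP h1 hT hN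
    (fun _ => rfl) (fun _ => rfl) hη hμ hA (fun h => by rw [h]; simp)
  refine ⟨c, hc, hl, hH, ?_⟩
  rwa [mul_div_assoc] at he

theorem innerFits_strongParams (hP : P.Regular) {ε : ℝ} (hε : 0 < ε) {μ M : ℕ → ℝ}
    {t : ℕ} (h1 : 1 < t) (hT : t ≤ P.T) (hμ : 0 < μ t) :
    P.InnerFits Q (strongParams P Q μ ε M) μ M ε t := by
  intro s q
  have hα := hP.α_pos t h1.le hT
  have hT0 : (0 : ℝ) < P.T := by exact_mod_cast (by omega : 0 < P.T)
  have hw : weight (strongParams P Q μ ε M) t s q = (strongParams P Q μ ε M).N t s q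
      * ((strongParams P Q μ ε M).N t s q + 1) / 2 := weight_of_linear fun _ => rfl
  have hN := strongParams_N_pos P Q μ ε M t s q
  have hN' : (0 : ℝ) < (strongParams P Q μ ε M).N t s q := by exact_mod_cast hN
  rcases hT.lt_or_eq with hlt | rfl
  · obtain ⟨c, hc, hl, hH, he⟩ := strongParams_middle (Q := Q) (ε := ε) (M := M) hP h1 hlt hμ s q
    refine ⟨c, hc, hl.ge, ?_⟩
    have hb := le_max_one_ceil ((8 * P.T * ‖P.A t s‖ ^ 2 * ‖Q.ystar t (s, q) - Q.y0 t‖ ^ 2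
      + 24 * P.T * M (t + 1) ^ 2) / (P.α t * μ t * ε))
    have hNe : (strongParams P Q μ ε M).N t s q = max 1 ⌈(8 * P.T * ‖P.A t s‖ ^ 2
        * ‖Q.ystar t (s, q) - Q.y0 t‖ ^ 2 + 24 * P.T * M (t + 1) ^ 2) / (P.α t * μ t * ε)⌉₊ := by
      show max 1 ⌈if t = 1 then _ else if t < P.T then _ else _⌉₊ = _
      rw [if_neg h1.ne', if_pos hlt]
    rw [← hNe] at hb
    rw [hw, hl, hH]
    set n : ℝ := ((strongParams P Q μ ε M).N t s q : ℝ) with hn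
    set d := ‖Q.ystar t (s, q) - Q.y0 t‖
    have h2 := mul_le_mul_of_nonneg_right hb
      (by positivity : 0 ≤ (n + 1) / 2 * (ε / (P.T : ℝ)))
    have e1 : (8 * P.T * ‖P.A t s‖ ^ 2 * d ^ 2 + 24 * P.T * M (t + 1) ^ 2) / (P.α t * μ t * ε)
        * ((n + 1) / 2 * (ε / (P.T : ℝ))) = 4 * (‖P.A t s‖ ^ 2 / (P.α t * μ t)) * d ^ 2 * (n + 1)
          + 12 * (n + 1) * (M (t + 1) ^ 2 / (P.α t * μ t)) := by
      field_simp
      ring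
    rw [e1] at h2
    have h3 : 0 ≤ ‖P.A t s‖ ^ 2 / (P.α t * μ t) * d ^ 2 := by positivity
    have h4 : 0 ≤ ‖P.A t s‖ ^ 2 / (P.α t * μ t) * d ^ 2 * n := by positivity
    linarith
  · obtain ⟨c, hc, hl, hH, he⟩ := strongParams_first_last (Q := Q) (ε := ε) (M := M) hP h1.le le_rfl
      (fun h => absurd h.2 (lt_irrefl _)) hμ s q
    have hMs : P.stageM M P.T = 0 := if_neg (lt_irrefl _)
    refine ⟨c, hc, hl.ge, ?_⟩
    have hb := le_max_one_ceil (√(8 * P.T) * ‖P.A P.T s‖ * ‖Q.ystar P.T (s, q) - Q.y0 P.T‖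
      / √(P.α P.T * μ P.T * ε))
    have hNe : (strongParams P Q μ ε M).N P.T s q = max 1 ⌈√(8 * P.T) * ‖P.A P.T s‖
        * ‖Q.ystar P.T (s, q) - Q.y0 P.T‖ / √(P.α P.T * μ P.T * ε)⌉₊ := by
      show max 1 ⌈if P.T = 1 then _ else if P.T < P.T then _ else _⌉₊ = _
      rw [if_neg h1.ne', if_neg (lt_irrefl _)]
    rw [← hNe] at hb
    rw [hMs] at he ⊢
    rw [hw, hl, hH]
    set n : ℝ := ((strongParams P Q μ ε M).N P.T s q : ℝ) with hn
    set d := ‖Q.ystar P.T (s, q) - Q.y0 P.T‖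
    -- The total weight grows like `n²/2`, so a count of order `ε^{-1/2}` is enough once squared.
    have h2 := pow_le_pow_left₀ (by positivity) hb 2
    rw [div_pow, mul_pow, mul_pow, Real.sq_sqrt (by positivity), Real.sq_sqrt (by positivity)] at h2
    have h3 := mul_le_mul_of_nonneg_right h2 (by positivity : 0 ≤ ε / (P.T : ℝ) / 2)
    have e1 : 8 * P.T * ‖P.A P.T s‖ ^ 2 * d ^ 2 / (P.α P.T * μ P.T * ε) * (ε / (P.T : ℝ) / 2)
        = 4 * (‖P.A P.T s‖ ^ 2 / (P.α P.T * μ P.T)) * d ^ 2 := by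
      field_simp
      ring
    rw [e1] at h3
    have h4 : 0 ≤ ‖P.A P.T s‖ ^ 2 / (P.α P.T * μ P.T) * d ^ 2 := by positivity
    have h5 : 0 ≤ n * (ε / P.T) := by positivity
    have h6 : 12 * (n + 1) * ((0 : ℝ) ^ 2 / (P.α P.T * μ P.T)) = 0 := by simp
    rw [h6] at he
    linarith

theorem outerFits_strongParams (hP : P.Regular) (hT3 : 3 ≤ P.T) {ε : ℝ} (hε : 0 < ε)
    {μ M : ℕ → ℝ} (hM : 0 ≤ M 2) (hμ : 0 < μ 1) (s : S 1) (q : Y m 1) :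
    P.OuterFits Q (strongParams P Q μ ε M) μ M ε s q := by
  have h1T : 1 < P.T := by omega
  have hα := hP.α_pos 1 le_rfl h1T.le
  have hT0 : (3 : ℝ) ≤ P.T := by exact_mod_cast hT3
  have hT1 : (0 : ℝ) < P.T := by linarith
  have hT2 : (0 : ℝ) ≤ P.T - 1 := by linarith
  have hMs : P.stageM M 1 = M 2 := if_pos h1T
  have hw : weight (strongParams P Q μ ε M) 1 s q = (strongParams P Q μ ε M).N 1 s q
      * ((strongParams P Q μ ε M).N 1 s q + 1) / 2 := weight_of_linear fun _ => rfl
  have hN := strongParams_N_pos P Q μ ε M 1 s q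
  have hN' : (0 : ℝ) < (strongParams P Q μ ε M).N 1 s q := by exact_mod_cast hN
  obtain ⟨c, hc, hl, hH, he⟩ := strongParams_first_last (Q := Q) (ε := ε) (M := M) hP le_rfl h1T.le
      (fun h => absurd h.1 (lt_irrefl _)) hμ s q
  rw [hMs] at hc he
  have hb := le_max_one_ceil (max
          (4 * √P.T * ‖P.A 1 s‖ * ‖Q.y0 1‖ / √(P.α 1 * μ 1 * ε)
            + 24 * P.T * M 2 ^ 2 / (P.α 1 * μ 1 * ε))
          (4 * √3 * ‖P.A 1 s‖ * √‖Q.ystar 1 (s, q) - Q.y0 1‖ / √(P.α 1 * μ 1 * ε)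
            + (24 * √6 * ‖P.A 1 s‖ * M 2 / (P.α 1 * μ 1 * ε)) ^ (2 / 3 : ℝ)
            + 12 * ‖P.A 1 s‖ * √(P.T - 1) / √(P.α 1 * μ 1 * P.T * ε)))
  have hNe : (strongParams P Q μ ε M).N 1 s q = max 1 ⌈max
          (4 * √P.T * ‖P.A 1 s‖ * ‖Q.y0 1‖ / √(P.α 1 * μ 1 * ε)
            + 24 * P.T * M 2 ^ 2 / (P.α 1 * μ 1 * ε))
          (4 * √3 * ‖P.A 1 s‖ * √‖Q.ystar 1 (s, q) - Q.y0 1‖ / √(P.α 1 * μ 1 * ε)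
            + (24 * √6 * ‖P.A 1 s‖ * M 2 / (P.α 1 * μ 1 * ε)) ^ (2 / 3 : ℝ)
            + 12 * ‖P.A 1 s‖ * √(P.T - 1) / √(P.α 1 * μ 1 * P.T * ε))⌉₊ := by
    show max 1 ⌈if 1 = 1 then _ else if 1 < P.T then _ else _⌉₊ = _
    rw [if_pos rfl]
  rw [← hNe] at hb
  have hb1 := (le_max_left _ _).trans hb
  have hb2 := (le_max_right _ _).trans hb
  clear hb hNe
  set n : ℝ := ((strongParams P Q μ ε M).N 1 s q : ℝ) with hn
  set d := ‖Q.ystar 1 (s, q) - Q.y0 1‖ with hd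
  have hd0 : 0 ≤ d := norm_nonneg _
  set a := ‖P.A 1 s‖ with ha
  set y := ‖Q.y0 1‖ with hy
  set β := P.α 1 * μ 1 with hβ
  have hβ0 : 0 < β := by positivity
  have ha0 : 0 ≤ a := norm_nonneg _
  have hy0 : 0 ≤ y := norm_nonneg _
  have e6 : √(6 : ℝ) ^ 2 = 6 := Real.sq_sqrt (by norm_num)
  have e3 : √(3 : ℝ) ^ 2 = 3 := Real.sq_sqrt (by norm_num)
  have t1 : 0 ≤ 4 * √3 * a * √d / √(β * ε) := by positivity
  have t2 : 0 ≤ (24 * √6 * a * M 2 / (β * ε)) ^ (2 / 3 : ℝ) := by positivity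
  have t3 : 0 ≤ 12 * a * √(P.T - 1) / √(β * P.T * ε) := by positivity
  have k1 : 4 * √(P.T * (a ^ 2 / β) * y ^ 2 / ε) + 24 * P.T * (M 2 ^ 2 / β) / ε ≤ n := by
    have h2 : P.T * (a ^ 2 / β) * y ^ 2 / ε = (√P.T * a * y / √(β * ε)) ^ 2 := by
      rw [div_pow, mul_pow, mul_pow, Real.sq_sqrt hT1.le, Real.sq_sqrt (by positivity)]
      field_simp
    rw [h2, Real.sqrt_sq (by positivity)]
    refine le_of_eq_of_le ?_ hb1
    field_simp
  have k2 : 48 * (a ^ 2 / β) * d ≤ n ^ 2 * ε := by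
    have h2 := pow_le_pow_left₀ t1 (by linarith : 4 * √3 * a * √d / √(β * ε) ≤ n) 2
    rw [div_pow, mul_pow, mul_pow, mul_pow, e3, Real.sq_sqrt hd0, Real.sq_sqrt (by positivity),
      div_le_iff₀ (by positivity)] at h2
    have : 48 * (a ^ 2 / β) * d = 4 ^ 2 * 3 * a ^ 2 * d / β := by ring
    rw [this, div_le_iff₀ hβ0]
    linarith
  have k3 : 3456 * (a ^ 2 / β * (M 2 ^ 2 / β)) ≤ ε ^ 2 * n ^ 3 := by
    have h2 := le_sqrt_pow_three_of_rpow_le (by positivity) hN'.le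
      (by linarith : (24 * √6 * a * M 2 / (β * ε)) ^ (2 / 3 : ℝ) ≤ n)
    have h3 := pow_le_pow_left₀ (by positivity) h2 2
    have h4 : (√n ^ 3) ^ 2 = n ^ 3 := by
      rw [← pow_mul, mul_comm, pow_mul, Real.sq_sqrt hN'.le]
    rw [h4, div_pow, mul_pow, mul_pow, mul_pow, e6, div_le_iff₀ (by positivity)] at h3
    have : 3456 * (a ^ 2 / β * (M 2 ^ 2 / β)) = 24 ^ 2 * 6 * a ^ 2 * M 2 ^ 2 / β ^ 2 := by
      field_simp
      ring
    rw [this, div_le_iff₀ (by positivity)]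
    linarith
  have k4 : 144 * (a ^ 2 / β) * (P.T - 1) / (P.T * ε) ≤ n ^ 2 := by
    have h2 := pow_le_pow_left₀ t3 (by linarith : 12 * a * √(P.T - 1) / √(β * P.T * ε) ≤ n) 2
    rw [div_pow, mul_pow, mul_pow, Real.sq_sqrt hT2, Real.sq_sqrt (by positivity)] at h2
    refine le_of_eq_of_le ?_ h2
    field_simp
    ring
  have g1 := linear_first_gap_le (A := a ^ 2 / β) (g := M 2 ^ 2 / β) (by positivity) (by positivity)
    hT1 hε hN' k1
  have g2 := linear_first_residual_le (A := a ^ 2 / β) (g := M 2 ^ 2 / β) (by linarith : 1 ≤ (P.T : ℝ))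
    hε hN' k3 k4
  rw [OuterFits, hMs]
  refine ⟨c, hc, hl.ge, ?_, ?_, ?_⟩
  · rw [hw, hl, hH]
    linarith
  · rw [hw, hH]
    have : 0 ≤ n * ε := by positivity
    linarith
  · rw [hw, hl, hH, zero_mul, zero_add]
    refine le_trans ?_ g2
    have : P.inexactness ε 1 = (P.T - 1) * (ε / P.T) := by simp [inexactness]
    rw [this]
    gcongr

theorem dualFits_strongParams (hP : P.Regular) {ε : ℝ} (hε : 0 < ε) {μ M : ℕ → ℝ}
    {t : ℕ} (h1 : 1 < t) (hT : t ≤ P.T) (hμ : 0 < μ t) :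
    P.DualFits Q (strongParams P Q μ ε M) μ M ε t := by
  intro a ha D
  have hα := hP.α_pos t h1.le hT
  have hT0 : (0 : ℝ) < P.T := by exact_mod_cast (by omega : 0 < P.T)
  have he0 := P.inexactness_nonneg hε hT
  rcases hT.lt_or_eq with hlt | rfl
  · set A₀ := a ^ 2 / (P.α t * μ t) with hA₀
    have hA₀0 : 0 < A₀ := by positivity
    refine ⟨12 * (M (t + 1) ^ 2 / (P.α t * μ t)) / A₀ + P.inexactness ε t
      * ((1 + 24 * P.T * M (t + 1) ^ 2 / (P.α t * μ t * ε)) / A₀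
        + 8 * P.T * (|D| + ‖Q.y0 t‖) ^ 2 / ε) / 2, fun s q hsa hsD => ?_⟩
    have hw : weight (strongParams P Q μ ε M) t s q = (strongParams P Q μ ε M).N t s q
      * ((strongParams P Q μ ε M).N t s q + 1) / 2 := weight_of_linear fun _ => rfl
    have hN := strongParams_N_pos P Q μ ε M t s q
    have hN' : (1 : ℝ) ≤ (strongParams P Q μ ε M).N t s q := by exact_mod_cast hN
    have hA0 : 0 < ‖P.A t s‖ := by linarith
    obtain ⟨c, hc, hl, hH, he⟩ := strongParams_middle (Q := Q) (ε := ε) (M := M) hP h1 hlt hμ s q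
    refine ⟨c, hc, hl.ge, by rw [hH]; positivity, ?_⟩
    have hNe : (strongParams P Q μ ε M).N t s q = max 1 ⌈(8 * P.T * ‖P.A t s‖ ^ 2
        * ‖Q.ystar t (s, q) - Q.y0 t‖ ^ 2 + 24 * P.T * M (t + 1) ^ 2) / (P.α t * μ t * ε)⌉₊ := by
      show max 1 ⌈if t = 1 then _ else if t < P.T then _ else _⌉₊ = _
      rw [if_neg h1.ne', if_pos hlt]
    rw [hw, hl, hH, zero_mul, zero_add]
    set n : ℝ := ((strongParams P Q μ ε M).N t s q : ℝ) with hn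
    have hb : n ≤ (8 * P.T * ‖P.A t s‖ ^ 2 * ‖Q.ystar t (s, q) - Q.y0 t‖ ^ 2
        + 24 * P.T * M (t + 1) ^ 2) / (P.α t * μ t * ε) + 1 := by
      rw [hn, hNe]
      exact max_one_ceil_le (by positivity)
    have hd : ‖Q.ystar t (s, q) - Q.y0 t‖ ≤ |D| + ‖Q.y0 t‖ :=
      (norm_sub_le _ _).trans (by have := le_abs_self D; gcongr; linarith)
    have hb2 : n ≤ 1 + 24 * P.T * M (t + 1) ^ 2 / (P.α t * μ t * ε)
        + 8 * P.T * (|D| + ‖Q.y0 t‖) ^ 2 / ε * (‖P.A t s‖ ^ 2 / (P.α t * μ t)) := by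
      have e1 : 8 * P.T * (|D| + ‖Q.y0 t‖) ^ 2 / ε * (‖P.A t s‖ ^ 2 / (P.α t * μ t))
          = 8 * P.T * ‖P.A t s‖ ^ 2 * (|D| + ‖Q.y0 t‖) ^ 2 / (P.α t * μ t * ε) := by field_simp
      have e2 : 8 * P.T * ‖P.A t s‖ ^ 2 * ‖Q.ystar t (s, q) - Q.y0 t‖ ^ 2 / (P.α t * μ t * ε)
          ≤ 8 * P.T * ‖P.A t s‖ ^ 2 * (|D| + ‖Q.y0 t‖) ^ 2 / (P.α t * μ t * ε) := by gcongr
      rw [add_div] at hb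
      rw [e1]
      linarith
    have hAA : A₀ ≤ ‖P.A t s‖ ^ 2 / (P.α t * μ t) := by rw [hA₀]; gcongr
    have key := linear_dual_le (g := M (t + 1) ^ 2 / (P.α t * μ t)) hA₀0 hAA (by positivity) he0
      (by positivity) hN' hb2
    linarith
  -- At the last stage `λ₀`, the subgradient error and the inexactness all vanish.
  · refine ⟨0, fun s q hsa _ => ?_⟩
    obtain ⟨c, hc, hl, hH, he⟩ := strongParams_first_last (Q := Q) (ε := ε) (M := M) hP h1.le le_rfl
      (fun h => absurd h.2 (lt_irrefl _)) hμ s q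
    have hMs : P.stageM M P.T = 0 := if_neg (lt_irrefl _)
    have hA0 : 0 < ‖P.A P.T s‖ := by linarith
    refine ⟨c, hc, hl.ge, by rw [hH]; positivity, ?_⟩
    have : P.inexactness ε P.T = 0 := by simp [inexactness]
    rw [this, hl, mul_zero]
    rw [hMs] at he ⊢
    simpa using he

end Problem

end DSA
end

/-! ### The first stage: optimality and feasibility of the output. -/

noncomputable section

namespace DSA

set_option linter.unusedSectionVars false

/-- No measurability of `p` is required: a Dirac measure gives every set containing its point mass
at least one. -/
theorem of_ae_dirac {α : Type*} [MeasurableSpace α] {a : α} {p : α → Prop}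
    (h : ∀ᵐ x ∂(Measure.dirac a), p x) : p a := by
  by_contra hp
  have h1 : Measure.dirac a {x | ¬p x} = 0 := h
  have h2 := Measure.le_dirac_apply (a := a) (s := {x | ¬p x})
  rw [h1, Set.indicator_of_mem (by exact hp)] at h2
  simp at h2

variable {S : ℕ → Type*} [∀ t, MeasurableSpace (S t)]
  {E : ℕ → Type*} [∀ t, NormedAddCommGroup (E t)] [∀ t, NormedSpace ℝ (E t)]
  [∀ t, FiniteDimensional ℝ (E t)] [∀ t, MeasurableSpace (E t)] [∀ t, BorelSpace (E t)]
  {m : ℕ → ℕ} {P : Problem S E m} {Q : Method S E m} {par : Params S m}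

namespace Problem

theorem IsSaddle.gap_nonneg {t : ℕ} {s : S t} {q : Y m t} {x x' : E t} {y y' : Y m t}
    (h : P.IsSaddle t s q x y) (hx' : x' ∈ P.X t) (hy' : y' ∈ P.Kdual t) :
    0 ≤ P.lagrangian t s q x' y - P.lagrangian t s q x y' := by
  have h1 := h.2.2.1 y' hy'
  have h2 := h.2.2.2 x' hx'
  linarith

theorem measurable_ybar_right (par : Params S m) {t : ℕ} (s : S t) (q : Y m t) :
    Measurable fun st : State E m t => ybar par t s q st := by
  have h : Measurable fun st : State E m t => st.2.2.2.2 := by fun_prop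
  exact h.const_smul (∑ k ∈ Finset.Icc 1 (par.N t s q), par.w t s q k)⁻¹

/-- The integral of a nonnegative multiple of a norm, from that of its square. -/
theorem integral_mul_le_of_sq {Ω : Type*} [MeasurableSpace Ω] {ν : Measure Ω}
    [IsProbabilityMeasure ν] {f : Ω → ℝ} {H c : ℝ} (hf : AEStronglyMeasurable f ν)
    (hi : Integrable (fun a => H / 2 * f a ^ 2) ν) (hc : 0 ≤ c)
    (h : 2 * H * ∫ a, H / 2 * f a ^ 2 ∂ν ≤ c ^ 2) :
    Integrable (fun a => H * f a) ν ∧ ∫ a, H * f a ∂ν ≤ c := by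
  have h2 : Integrable (fun a => (H * f a) ^ 2) ν :=
    (hi.const_mul (2 * H)).congr (Filter.Eventually.of_forall fun a => by simp only; ring)
  have h1 : Integrable (fun a => H * f a) ν :=
    ((memLp_two_iff_integrable_sq (hf.const_mul H)).2 h2).integrable (by norm_num)
  refine ⟨h1, (abs_le_of_sq_le_sq' ((sq_integral_le h1 h2).trans ?_) hc).2⟩
  refine le_of_eq_of_le ?_ h
  rw [← integral_const_mul]
  congr 1
  ext a
  ring

/-- The same run is tested twice: against `(x^*, 0)` for the objective, where the distance to the
dual solution does not enter, and against a saddle point for the final dual iterate, which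
determines the residual `δ`. -/
theorem findsSolution_of_fits (hT3 : 3 ≤ P.T) (hP : P.Regular) (hQ : P.Admissible Q)
    (hpar : par.Meas P.T) {ε : ℝ} (hε : 0 < ε) {μ M : ℕ → ℝ}
    (hμ : ∀ t, 1 ≤ t → t ≤ P.T → ∀ᵐ s ∂(P.law t), P.ModulusAt t s (μ t))
    (hM : ValidConstants P Q par M)
    (hin : ∀ t, 1 < t → t ≤ P.T → P.InnerFits Q par μ M ε t)
    (hout : P.OuterFits Q par μ M ε P.root (P.b 1 P.root)) :
    FindsSolution P Q par ε := by
  have h1T : 1 < P.T := by omega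
  have hgap : ∀ᵐ s ∂(P.law 1), ∀ᵐ s' ∂(P.κ 1 s), ∀ q,
      (∃ x, P.IsSaddle 2 s' q x (Q.ystar 2 (s', q))) →
      P.GapBound Q par 2 s' q (ε / P.T + P.inexactness ε 2) :=
    ae_ae_of_ae_law le_rfl (ae_gapBound hP hQ hpar hε hμ le_rfl
      (fun t ht hlt => hM t (by omega) hlt) (fun t ht hle => hin t (by omega) hle) (P.T - 2) 2
      le_rfl (by omega))
  have hs : P.GoodAt Q 1 P.root := of_ae_dirac (ae_goodAt hP hQ le_rfl h1T.le)
  have hμr : P.ModulusAt 1 P.root (μ 1) :=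
    of_ae_dirac (p := fun s => P.ModulusAt 1 s (μ 1)) (hμ 1 le_rfl h1T.le)
  have hv : P.ValidAt Q par M 1 P.root := of_ae_dirac (hM 1 le_rfl h1T).2
  have hg := of_ae_dirac (a := P.root) hgap
  have hM2 := (hM 1 le_rfl h1T).1
  obtain ⟨x₀, hsad⟩ := hQ.ystar_first
  obtain ⟨c, hfit, hlam, hc1, hc2, hc3⟩ := hout
  set s := P.root
  set q := P.b 1 s with hq
  have he : ε / P.T + P.inexactness ε 2 = P.inexactness ε 1 := by
    unfold inexactness; push_cast; ring
  have he0 := P.inexactness_nonneg hε h1T.le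
  rw [he] at hg
  obtain ⟨hW, ⟨R, hR⟩, hmain⟩ := run_estimates hP hQ hpar le_rfl h1T.le hs hμr
    (fun _ => ⟨hM2, hv⟩) he0 (fun _ => by
      filter_upwards [hg, hs.next h1T] with s' h4 h5 u hu
      exact h4 _ (h5 u hu)) hsad hfit
  have hH : 0 ≤ c.H := (hfit.2 0).H_nonneg
  set out := run P Q par (P.T - 1) 1 s q with hout'
  have hprob : IsProbabilityMeasure out := by
    obtain ⟨-, hp, -⟩ := measurable_run hP hQ hpar (P.T - 1) 1 le_rfl (by omega)
    exact hp s q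
  set W := weight par 1 s q with hWdef
  have hy0 : (0 : Y m 1) ∈ P.Kdual 1 := (P.stage 1 s q 0 0).C.zero_mem
  have hmy := measurable_ybar_right (E := E) par s q
  have hxb : ∀ st : State E m 1, xbar par 1 s q st = W⁻¹ • st.2.2.2.1 := fun st => rfl
  have hyb : ∀ st : State E m 1, ybar par 1 s q st = W⁻¹ • st.2.2.2.2 := fun st => rfl
  have hlag0 : ∀ x, P.lagrangian 1 s q x 0 = P.h 1 s x + P.v 1 s x := fun x => by
    simp [lagrangian]
  have hOm : ∀ x ∈ P.X 1, c.lam 0 * P.bregman 1 (Q.x0 1) x ≤ c.lam 0 * P.Ω 1 ^ 2 := fun x hx =>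
    mul_le_mul_of_nonneg_left (bregman_le_Ω hP le_rfl h1T.le (hQ.x0_mem 1 le_rfl h1T.le) hx) hlam
  have hsq : ∀ y : Y m 1, 0 ≤ ∫ st : State E m 1, c.H / 2 * ‖y - st.2.1‖ ^ 2 ∂out := fun y =>
    integral_nonneg fun st => by positivity
  have hW1 : W * ε = W * (ε / P.T) + W * P.inexactness ε 1 := by
    have : (P.T : ℝ) ≠ 0 := by
      have : 0 < P.T := by omega
      positivity
    unfold inexactness
    push_cast
    field_simp
    ring
  -- The objective at `x̄` is the gap against `(x₀, 0)` plus a bounded product with `ȳ` and a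
  -- constant; the bound holds even when the dual iterates are unbounded.
  have hobj : Integrable (fun st => P.h 1 s (xbar par 1 s q st) + P.v 1 s (xbar par 1 s q st)) out := by
    obtain ⟨i1, -, -⟩ := hmain x₀ hsad.1 0 hy0
    obtain ⟨C, hC⟩ := (P.loop Q par 1 s q (μ 1) (P.stageM M 1) (P.inexactness ε 1) c).abs_inner_sumy_le
      R (par.N 1 s q) x₀
    have i2 : Integrable (fun st => (inner ℝ (q - P.A 1 s x₀) (ybar par 1 s q st) : ℝ)) out := by
      refine Integrable.of_bound (hmy.const_inner).aestronglyMeasurable (W⁻¹ * C) ?_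
      filter_upwards [hR] with st hst
      rw [hyb, inner_smul_right, Real.norm_eq_abs, abs_mul, abs_of_nonneg (by positivity : 0 ≤ W⁻¹)]
      exact mul_le_mul_of_nonneg_left (hC st hst.1) (by positivity)
    refine ((i1.add i2).add (integrable_const (P.h 1 s x₀ + P.v 1 s x₀))).congr
      (Filter.Eventually.of_forall fun st => ?_)
    simp only [Pi.add_apply, hlag0]
    simp only [lagrangian]
    ring
  refine ⟨hprob, hR.mono fun st h => h.2.1, hobj, fun xopt hxopt => ?_, ?_⟩
  -- Feasibility of the optimal point gives `⟨q - A x^*, ȳ⟩ ≤ 0`, so the gap against `(x^*, 0)`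
  -- dominates the objective gap.
  · obtain ⟨i1, -, hle⟩ := hmain xopt hxopt.1.1 0 hy0
    have hint : Integrable (fun st => P.h 1 s (xbar par 1 s q st) + P.v 1 s (xbar par 1 s q st)
        - (P.h 1 s xopt + P.v 1 s xopt)) out := hobj.sub (integrable_const _)
    have h1 : ∫ st, (P.h 1 s (xbar par 1 s q st) + P.v 1 s (xbar par 1 s q st)
        - (P.h 1 s xopt + P.v 1 s xopt)) ∂out
        ≤ ∫ st, (P.lagrangian 1 s q (xbar par 1 s q st) 0
          - P.lagrangian 1 s q xopt (ybar par 1 s q st)) ∂out := by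
      refine integral_mono_ae hint i1 ?_
      filter_upwards [hR] with st hst
      have h3 : P.lagrangian 1 s q xopt (ybar par 1 s q st) ≤ P.h 1 s xopt + P.v 1 s xopt :=
        Stage.IsSaddle.L_le_of_feas (P.stage 1 s q 0 0) hxopt.1 hst.2.2
      rw [hlag0]
      linarith
    refine h1.trans ?_
    have h2 := hOm xopt hxopt.1.1
    have h3 := hsq 0
    rw [zero_sub, norm_neg] at hle
    refine le_of_mul_le_mul_left ?_ hW
    linarith
  · obtain ⟨-, i2, hle⟩ := hmain x₀ hsad.1 _ hsad.2.1
    set y₀ := Q.ystar 1 (s, q) with hy₀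
    have h1 : 0 ≤ ∫ st, (P.lagrangian 1 s q (xbar par 1 s q st) y₀
        - P.lagrangian 1 s q x₀ (ybar par 1 s q st)) ∂out :=
      integral_nonneg_of_ae (hR.mono fun st hst => hsad.gap_nonneg hst.2.1 hst.2.2)
    have h2 := hOm x₀ hsad.1
    have h3 : 0 ≤ W * ∫ st, (P.lagrangian 1 s q (xbar par 1 s q st) y₀
        - P.lagrangian 1 s q x₀ (ybar par 1 s q st)) ∂out := by positivity
    -- The budget for the loop error is `4/9`, the initial distance contributes `(1/6)² = 1/36`, and
    -- `4/9 + 1/36 ≤ (3/4)²`.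
    have h4 : 2 * c.H * ∫ st : State E m 1, c.H / 2 * ‖y₀ - st.2.1‖ ^ 2 ∂out
        ≤ (3 / 4 * (W * ε)) ^ 2 := by
      have h5 : ∫ st : State E m 1, c.H / 2 * ‖y₀ - st.2.1‖ ^ 2 ∂out
          ≤ (c.lam 0 * P.Ω 1 ^ 2 + c.err (P.stageM M 1) (par.N 1 s q)
            + W * P.inexactness ε 1) + c.H / 2 * ‖y₀ - Q.y0 1‖ ^ 2 := by linarith
      have h6 := mul_le_mul_of_nonneg_left h5 (by positivity : 0 ≤ 2 * c.H)
      have h7 := pow_le_pow_left₀ (by positivity) hc2 2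
      have h8 : 0 ≤ (W * ε) ^ 2 := by positivity
      linarith
    have m1 : Measurable fun st : State E m 1 => ‖y₀ - st.2.1‖ := by fun_prop
    obtain ⟨i3, h5⟩ := integral_mul_le_of_sq m1.aestronglyMeasurable i2 (by positivity) h4
    -- This vector is the residual: dividing the telescoped dual optimality conditions by `W` puts
    -- `A x̄ - q - δ` into `K`. Splitting at the dual solution gives an expected norm of at most
    -- `(1/6 + 3/4) ε`.
    have hδ : ∀ st : State E m 1, ‖(c.H / W) • (Q.y0 1 - st.2.1)‖
        ≤ W⁻¹ * (c.H * ‖y₀ - Q.y0 1‖ + c.H * ‖y₀ - st.2.1‖) := fun st => by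
      rw [norm_smul, Real.norm_of_nonneg (by positivity), div_eq_inv_mul, mul_assoc, ← mul_add]
      have h6 := norm_sub_le_norm_sub_add_norm_sub (Q.y0 1) y₀ st.2.1
      rw [norm_sub_rev (Q.y0 1) y₀] at h6
      gcongr
    have mδ : Measurable fun st : State E m 1 => (c.H / W) • (Q.y0 1 - st.2.1) := by fun_prop
    have i4 : Integrable (fun st : State E m 1 =>
        W⁻¹ * (c.H * ‖y₀ - Q.y0 1‖ + c.H * ‖y₀ - st.2.1‖)) out :=
      ((integrable_const _).add i3).const_mul _
    have i5 : Integrable (fun st : State E m 1 => (c.H / W) • (Q.y0 1 - st.2.1)) out :=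
      i4.mono' mδ.aestronglyMeasurable (Filter.Eventually.of_forall hδ)
    refine ⟨_, mδ, ?_, i5, ?_⟩
    · filter_upwards [hR] with st hst
      have h6 := (P.K 1).smul_mem hst.1.2.2.2.1 (by positivity : 0 ≤ W⁻¹)
      have h7 : W⁻¹ • (P.A 1 s st.2.2.2.1 - W • q + c.H • (st.2.1 - Q.y0 1))
          = P.A 1 s (xbar par 1 s q st) - q - (c.H / W) • (Q.y0 1 - st.2.1) := by
        rw [hxb, map_smul, smul_add, smul_sub, smul_smul W⁻¹ W, inv_mul_cancel₀ hW.ne', one_smul,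
          smul_smul, div_eq_inv_mul, ← neg_sub (Q.y0 1), smul_neg, ← sub_eq_add_neg]
      rw [← h7]
      exact h6
    · refine (integral_mono i5.norm i4 hδ).trans ?_
      rw [integral_const_mul, integral_add (integrable_const _) i3]
      simp only [integral_const, probReal_univ, one_smul]
      rw [inv_mul_le_iff₀ hW]
      have h8 : 0 ≤ W * ε := by positivity
      linarith

end Problem

end DSA
end

/-! ### Existence of valid constants. -/

noncomputable section

namespace DSA

set_option linter.unusedSectionVars false

variable {S : ℕ → Type*} [∀ t, MeasurableSpace (S t)]
  {E : ℕ → Type*} [∀ t, NormedAddCommGroup (E t)] [∀ t, NormedSpace ℝ (E t)]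
  [∀ t, FiniteDimensional ℝ (E t)] [∀ t, MeasurableSpace (E t)] [∀ t, BorelSpace (E t)]
  {m : ℕ → ℕ} {P : Problem S E m} {Q : Method S E m} {par par' : Params S m}

/-- Two families of parameters agree at stage `t`. -/
def Params.AgreeAt (par par' : Params S m) (t : ℕ) : Prop :=
  par.N t = par'.N t ∧ par.w t = par'.w t ∧ par.τ t = par'.τ t ∧ par.η t = par'.η t

theorem spdt_congr {t : ℕ} (h : par.AgreeAt par' t) : spdt Q par t = spdt Q par' t := by
  obtain ⟨-, h2, h3, h4⟩ := h
  unfold spdt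
  rw [h2, h3, h4]

theorem stochGrad_congr {t : ℕ} (h : par.AgreeAt par' (t + 1)) :
    stochGrad P par t = stochGrad P par' t := by
  obtain ⟨h1, h2, -, -⟩ := h
  unfold stochGrad ybar
  rw [h1, h2]

theorem run_congr (r : ℕ) : ∀ t, (∀ j, t ≤ j → j ≤ t + r → par.AgreeAt par' j) →
    run P Q par r t = run P Q par' r t := by
  induction r with
  | zero =>
    intro t h
    have h0 := h t le_rfl (by omega)
    unfold run
    rw [spdt_congr h0, h0.1]
  | succ r ih =>
    intro t h
    have h0 := h t le_rfl (by omega)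
    unfold run
    rw [spdt_congr h0, h0.1, stochGrad_congr (h (t + 1) (by omega) (by omega)),
      ih (t + 1) fun j h1 h2 => h j (by omega) (by omega)]

namespace Problem

theorem validAt_congr {M M' : ℕ → ℝ} {t : ℕ} (ht : t < P.T)
    (h : ∀ j, t < j → j ≤ P.T → par.AgreeAt par' j) (hM : M (t + 1) = M' (t + 1)) (s : S t) :
    P.ValidAt Q par M t s ↔ P.ValidAt Q par' M' t s := by
  unfold ValidAt
  rw [stochGrad_congr (h (t + 1) (by omega) ht),
    run_congr (par' := par') (P.T - (t + 1)) (t + 1) fun j h1 h2 => h j (by omega) (by omega), hM]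

/-- Dual solutions control the variation of the value function. -/
theorem abs_V_sub_le {t : ℕ} {s : S t} {q q' : Y m t} {x x' : E t} {y y' : Y m t} {D : ℝ}
    (h : P.IsSaddle t s q x y) (h' : P.IsSaddle t s q' x' y') (hy : ‖y‖ ≤ D) (hy' : ‖y'‖ ≤ D) :
    |P.V t s q' - P.V t s q| ≤ D * ‖q' - q‖ := by
  have h1 := h.V_add_inner_saddle_le h'
  have h2 := h'.V_add_inner_saddle_le h
  have h3 := (abs_le.1 (abs_real_inner_le_norm (q' - q) y)).1
  have h4 := (abs_le.1 (abs_real_inner_le_norm (q - q') y')).1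
  have h5 : ‖q' - q‖ * ‖y‖ ≤ D * ‖q' - q‖ := by
    rw [mul_comm]; gcongr
  have h6 : ‖q - q'‖ * ‖y'‖ ≤ D * ‖q' - q‖ := by
    rw [mul_comm, norm_sub_rev]; gcongr
  rw [abs_le]
  constructor <;> linarith

/-- Dual solutions of norm at most `D` are subgradients of `V` in the right-hand side, which itself
moves by at most `C ‖x' - x‖`. -/
theorem lipschitz_v (hP : P.Regular) {t : ℕ} (h1 : 1 ≤ t) (hT : t < P.T) {s : S t}
    (hs : P.GoodAt Q t s) {L C D : ℝ} (hD0 : 0 ≤ D)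
    (hF : ∀ x ∈ P.X t, ∀ x' ∈ P.X t, |P.F t s x' - P.F t s x| ≤ L * ‖x' - x‖)
    (hB : ∀ᵐ s' ∂(P.κ t s), ‖P.B t s'‖ ≤ C)
    (hD : ∀ᵐ s' ∂(P.κ t s), ∀ u ∈ P.X t, ‖Q.ystar (t + 1) (s', P.rhs t s' u)‖ ≤ D) {x x' : E t}
    (hx : x ∈ P.X t) (hx' : x' ∈ P.X t) :
    |P.v t s x' - P.v t s x| ≤ (L + D * C) * ‖x' - x‖ := by
  have hκ := hP.markov t h1 hT
  have i1 := hs.fin hT x hx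
  have i2 := hs.fin hT x' hx'
  rw [v_of_lt hT, v_of_lt hT, add_sub_add_comm, ← integral_sub i2 i1]
  have h2 : ‖∫ s', (P.V (t + 1) s' (P.rhs t s' x') - P.V (t + 1) s' (P.rhs t s' x)) ∂(P.κ t s)‖
      ≤ D * C * ‖x' - x‖ := by
    have h3 := norm_integral_le_of_norm_le_const (μ := P.κ t s) (C := D * C * ‖x' - x‖)
      (f := fun s' => P.V (t + 1) s' (P.rhs t s' x') - P.V (t + 1) s' (P.rhs t s' x)) ?_
    · simpa using h3
    · filter_upwards [hs.next hT, hB, hD] with s' hn hb hd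
      obtain ⟨z, hz⟩ := hn x hx
      obtain ⟨z', hz'⟩ := hn x' hx'
      refine (abs_V_sub_le hz hz' (hd x hx) (hd x' hx')).trans ?_
      rw [rhs_sub, mul_assoc]
      refine mul_le_mul_of_nonneg_left ?_ hD0
      exact ((P.B t s').le_opNorm _).trans (by gcongr)
  calc _ ≤ |P.F t s x' - P.F t s x| + |∫ s', (P.V (t + 1) s' (P.rhs t s' x')
        - P.V (t + 1) s' (P.rhs t s' x)) ∂(P.κ t s)| := abs_add_le _ _
    _ ≤ L * ‖x' - x‖ + D * C * ‖x' - x‖ := add_le_add (hF x hx x' hx') h2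
    _ = _ := by ring

theorem norm_stochGrad_le (par : Params S m) {t : ℕ} {s : S t} {x : E t} {s' : S (t + 1)}
    {st : State E m (t + 1)} {L C D : ℝ} {y : Y m (t + 1)} (hF : ‖P.F' t s x‖ ≤ L)
    (hB : ‖P.B t s'‖ ≤ C) (hy : ‖y‖ ≤ D) :
    ‖stochGrad P par t s x s' st‖ ^ 2 ≤ 2 * (L + D * C) ^ 2
      + 2 * C ^ 2 * ‖ybar par (t + 1) s' (P.rhs t s' x) st - y‖ ^ 2 := by
  set z := ybar par (t + 1) s' (P.rhs t s' x) st
  have hC : 0 ≤ C := (norm_nonneg _).trans hB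
  have h1 : ‖stochGrad P par t s x s' st‖ ≤ ‖P.F' t s x‖ + ‖innerSL ℝ z‖ * ‖P.B t s'‖ :=
    (norm_add_le _ _).trans (add_le_add le_rfl (ContinuousLinearMap.opNorm_comp_le _ _))
  rw [innerSL_apply_norm] at h1
  have h2 : ‖z‖ ≤ ‖z - y‖ + D := by
    have := norm_sub_norm_le z y
    linarith
  have h3 : ‖z‖ * ‖P.B t s'‖ ≤ (‖z - y‖ + D) * C := by
    have := (norm_nonneg z).trans h2
    gcongr
  have h4 : ‖stochGrad P par t s x s' st‖ ≤ (L + D * C) + C * ‖z - y‖ := by linarith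
  have h5 : ‖stochGrad P par t s x s' st‖ ^ 2 ≤ ((L + D * C) + C * ‖z - y‖) ^ 2 := by gcongr
  nlinarith [sq_nonneg ((L + D * C) - C * ‖z - y‖)]

/-- One more valid constant. -/
theorem exists_validAt (hP : P.Regular) (hQ : P.Admissible Q) (hpar : par.Meas P.T) {ε : ℝ}
    (hε : 0 < ε) {μ M : ℕ → ℝ}
    (hμ : ∀ t, 1 ≤ t → t ≤ P.T → ∀ᵐ s ∂(P.law t), P.ModulusAt t s (μ t))
    (hbd : P.BoundedDuals Q) {t : ℕ} (h1 : 1 ≤ t) (hT : t < P.T)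
    (hM : ∀ j, t < j → j < P.T → 0 ≤ M (j + 1) ∧ ∀ᵐ s ∂(P.law j), P.ValidAt Q par M j s)
    (hin : ∀ j, t < j → j ≤ P.T → P.InnerFits Q par μ M ε j)
    (hdual : P.DualFits Q par μ M ε (t + 1)) :
    ∃ C, 0 ≤ C ∧ ∀ᵐ s ∂(P.law t), P.ValidAt Q par (Function.update M (t + 1) C) t s := by
  obtain ⟨L, hL⟩ := hP.F_lipschitz t h1 hT
  obtain ⟨C, hC⟩ := hP.B_bounded t h1 hT
  obtain ⟨a, ha, D, hD⟩ := hbd t h1 hT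
  obtain ⟨B, hB⟩ := hdual a ha D
  have hκ := hP.markov t h1 hT
  have hgap : ∀ᵐ s' ∂(P.law (t + 1)), t + 1 < P.T → ∀ᵐ s'' ∂(P.κ (t + 1) s'),
      ∀ q, (∃ x, P.IsSaddle (t + 2) s'' q x (Q.ystar (t + 2) (s'', q))) →
      P.GapBound Q par (t + 2) s'' q (P.inexactness ε (t + 1)) := by
    by_cases hlt : t + 1 < P.T
    · have he : ε / P.T + P.inexactness ε (t + 2) = P.inexactness ε (t + 1) := by
        unfold inexactness; push_cast; ring
      rw [← he]
      exact (ae_ae_of_ae_law (by omega) (ae_gapBound hP hQ hpar hε hμ (by omega)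
        (fun j hj hlt' => hM j (by omega) hlt') (fun j hj hle => hin j (by omega) hle)
        (P.T - (t + 2)) (t + 2) le_rfl (by omega))).mono fun s' h _ => h
    · exact Filter.Eventually.of_forall fun s' h => absurd h hlt
  have hvalid : ∀ᵐ s' ∂(P.law (t + 1)), t + 1 < P.T →
      0 ≤ M (t + 1 + 1) ∧ P.ValidAt Q par M (t + 1) s' := by
    by_cases hlt : t + 1 < P.T
    · obtain ⟨h2, h3⟩ := hM (t + 1) (by omega) hlt
      exact h3.mono fun s' h _ => ⟨h2, h⟩
    · exact Filter.Eventually.of_forall fun s' h => absurd h hlt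
  have hnext : ∀ᵐ s' ∂(P.law (t + 1)), ‖P.B t s'‖ ≤ |C| ∧ ∀ u ∈ P.X t,
      ‖Q.ystar (t + 1) (s', P.rhs t s' u)‖ ≤ |D| ∧
      ∫⁻ st, ENNReal.ofReal (‖ybar par (t + 1) s' (P.rhs t s' u) st
        - Q.ystar (t + 1) (s', P.rhs t s' u)‖ ^ 2)
        ∂(run P Q par (P.T - (t + 1)) (t + 1) s' (P.rhs t s' u))
      ≤ ENNReal.ofReal ((|D| + ‖Q.y0 (t + 1)‖) ^ 2 + |B|) := by
    filter_upwards [hC, hD, hgap, hvalid, ae_goodAt hP hQ (by omega : 1 ≤ t + 1) hT,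
      hμ (t + 1) (by omega) hT, hQ.ystar_spec t h1 hT] with s' c1 c2 c3 c4 c5 c6 c7
    refine ⟨c1.trans (le_abs_self C), fun u hu => ?_⟩
    have hyD := (c2.2 u hu).trans (le_abs_self D)
    refine ⟨hyD, ?_⟩
    obtain ⟨x, hx⟩ := c7 u hu
    obtain ⟨c, hfit, hlam, hH, hbound⟩ := hB s' (P.rhs t s' u) c2.1 (c2.2 u hu)
    refine (lintegral_ybar_le hP hQ hpar (by omega) hT c5 c6 c4
      (P.inexactness_nonneg hε hT) (fun hlt => ?_) hx hfit hlam hH hbound).trans ?_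
    · filter_upwards [c3 hlt, c5.next hlt] with s'' h4 h5 u' hu'
      exact h4 _ (h5 u' hu')
    · refine ENNReal.ofReal_le_ofReal (add_le_add ?_ (le_abs_self B))
      have : ‖Q.ystar (t + 1) (s', P.rhs t s' u) - Q.y0 (t + 1)‖ ≤ |D| + ‖Q.y0 (t + 1)‖ :=
        (norm_sub_le _ _).trans (by gcongr)
      gcongr
  set R := 2 * (|L| + |D| * |C|) ^ 2 + 2 * |C| ^ 2 * ((|D| + ‖Q.y0 (t + 1)‖) ^ 2 + |B|) with hR
  have hR0 : 0 ≤ R := by positivity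
  -- The first part is a Lipschitz constant of the value function and `R` bounds the second moment
  -- of the subgradient; their sum serves both requirements.
  refine ⟨(|L| + |D| * |C|) + √R, by positivity, ?_⟩
  filter_upwards [hL, ae_goodAt hP hQ h1 hT.le, ae_ae_of_ae_law h1 hnext] with s hs1 hs2 hs3 x hx
  rw [Function.update_self]
  refine ⟨fun x' hx' => ?_, ?_⟩
  · refine (lipschitz_v hP h1 hT hs2 (L := |L|) (C := |C|) (D := |D|) (by positivity)
      (fun z hz z' hz' => ((hs1.2 z hz).2 z' hz').1.trans ?_) (hs3.mono fun _ h => h.1)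
      (hs3.mono fun _ h u hu => (h.2 u hu).1) hx hx').trans ?_
    · have := le_abs_self L
      gcongr
    · exact mul_le_mul_of_nonneg_right (by linarith [Real.sqrt_nonneg R]) (norm_nonneg _)
  · have hle : ENNReal.ofReal R ≤ ENNReal.ofReal ((|L| + |D| * |C| + √R) ^ 2) := by
      refine ENNReal.ofReal_le_ofReal ?_
      calc R = √R ^ 2 := (Real.sq_sqrt hR0).symm
        _ ≤ _ := by
          have : 0 ≤ |L| + |D| * |C| := by positivity
          have := Real.sqrt_nonneg R
          gcongr
          linarith
    refine le_trans ?_ hle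
    have hmain : ∀ᵐ s' ∂(P.κ t s), ∫⁻ st, ‖stochGrad P par t s x s' st‖ₑ ^ 2
        ∂(run P Q par (P.T - (t + 1)) (t + 1) s' (P.rhs t s' x)) ≤ ENNReal.ofReal R := by
      filter_upwards [hs3] with s' h
      obtain ⟨-, hp, -⟩ := measurable_run hP hQ hpar (P.T - (t + 1)) (t + 1) (by omega) (by omega)
      have hprob := hp s' (P.rhs t s' x)
      obtain ⟨hy, hmom⟩ := h.2 x hx
      set y := Q.ystar (t + 1) (s', P.rhs t s' x)
      have hpt : ∀ st : State E m (t + 1), ‖stochGrad P par t s x s' st‖ₑ ^ 2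
          ≤ ENNReal.ofReal (2 * (|L| + |D| * |C|) ^ 2) + ENNReal.ofReal (2 * |C| ^ 2)
            * ENNReal.ofReal (‖ybar par (t + 1) s' (P.rhs t s' x) st - y‖ ^ 2) := fun st => by
        rw [← ofReal_norm, ← ENNReal.ofReal_pow (norm_nonneg _),
          ← ENNReal.ofReal_mul (by positivity), ← ENNReal.ofReal_add (by positivity) (by positivity)]
        exact ENNReal.ofReal_le_ofReal (norm_stochGrad_le par
          ((hs1.2 x hx).1.trans (le_abs_self L)) h.1 hy)
      have hm : Measurable fun st : State E m (t + 1) =>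
          ENNReal.ofReal (‖ybar par (t + 1) s' (P.rhs t s' x) st - y‖ ^ 2) :=
        (((measurable_ybar_right par s' (P.rhs t s' x)).sub_const y).norm.pow_const 2).ennreal_ofReal
      refine (lintegral_mono hpt).trans ?_
      rw [lintegral_add_left measurable_const, lintegral_const_mul _ hm, lintegral_const,
        measure_univ, mul_one]
      refine (add_le_add le_rfl (mul_le_mul_right hmom _)).trans ?_
      rw [← ENNReal.ofReal_mul (by positivity), ← ENNReal.ofReal_add (by positivity) (by positivity)]
    refine (lintegral_mono_ae hmain).trans ?_
    rw [lintegral_const, measure_univ, mul_one]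

/-- The parameters depend on the constants they have to validate. The circle is broken by `hloc`:
validity of `M (t + 1)` concerns runs from stage `t + 1` on, whose parameters use only `M (t + 2)`
and later constants. The constants are therefore fixed backwards, and changing `M (t + 1)` does not
disturb those already found. -/
theorem exists_validConstants (hP : P.Regular) (hQ : P.Admissible Q) {ε : ℝ}
    (hε : 0 < ε) {μ : ℕ → ℝ} {par : (ℕ → ℝ) → Params S m} (hpar : ∀ M, (par M).Meas P.T)
    (hloc : ∀ M M' t, 1 < t → M (t + 1) = M' (t + 1) → (par M).AgreeAt (par M') t)
    (hμ : ∀ t, 1 ≤ t → t ≤ P.T → ∀ᵐ s ∂(P.law t), P.ModulusAt t s (μ t))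
    (hbd : P.BoundedDuals Q)
    (hin : ∀ M t, 1 < t → t ≤ P.T → (t < P.T → 0 ≤ M (t + 1)) → P.InnerFits Q (par M) μ M ε t)
    (hdual : ∀ M t, 1 < t → t ≤ P.T → (t < P.T → 0 ≤ M (t + 1)) →
      P.DualFits Q (par M) μ M ε t) :
    ∃ M, ValidConstants P Q (par M) M := by
  have key : ∀ r, ∃ M : ℕ → ℝ, ∀ t, 1 ≤ t → P.T ≤ t + r → t < P.T →
      0 ≤ M (t + 1) ∧ ∀ᵐ s ∂(P.law t), P.ValidAt Q (par M) M t s := by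
    intro r
    induction r with
    | zero => exact ⟨0, fun t _ h1 h2 => by omega⟩
    | succ r ih =>
      obtain ⟨M, hM⟩ := ih
      by_cases hr : r + 1 < P.T
      · obtain ⟨t, ht⟩ : ∃ t, t + (r + 1) = P.T := ⟨P.T - (r + 1), by omega⟩
        have hM0 : ∀ j, t < j → j < P.T → 0 ≤ M (j + 1) ∧
            ∀ᵐ s ∂(P.law j), P.ValidAt Q (par M) M j s :=
          fun j hj hlt => hM j (by omega) (by omega) hlt
        obtain ⟨C, hC0, hC⟩ := exists_validAt hP hQ (hpar M) hε hμ hbd (by omega : 1 ≤ t)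
          (by omega : t < P.T) hM0
          (fun j hj hle => hin M j (by omega) hle fun hlt => (hM0 j hj hlt).1)
          (hdual M (t + 1) (by omega) (by omega) fun hlt => (hM0 (t + 1) (by omega) hlt).1)
        set M' := Function.update M (t + 1) C with hM'
        have hne : ∀ j, t < j → M (j + 1) = M' (j + 1) := fun j hj => by
          rw [hM', Function.update_of_ne (by omega)]
        have hagree : ∀ j, t < j → (par M).AgreeAt (par M') j := fun j hj =>
          hloc M M' j (by omega) (hne j hj)
        refine ⟨M', fun j hj1 hj2 hj3 => ?_⟩
        rcases (by omega : j = t ∨ t < j) with rfl | hj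
        · refine ⟨by rw [hM', Function.update_self]; exact hC0, hC.mono fun s hs => ?_⟩
          exact (validAt_congr hj3 (fun i hi _ => hagree i hi) rfl s).1 hs
        · obtain ⟨h2, h3⟩ := hM0 j hj hj3
          refine ⟨by rwa [← hne j hj], h3.mono fun s hs => ?_⟩
          exact (validAt_congr hj3 (fun i hi _ => hagree i (by omega)) (hne j hj) s).1 hs
      · exact ⟨M, fun t h1 h2 h3 => hM t h1 (by omega) h3⟩
  obtain ⟨M, hM⟩ := key P.T
  exact ⟨M, fun t h1 hT => hM t h1 (by omega) hT⟩

end Problem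

theorem convexParams_agreeAt (P : Problem S E m) (Q : Method S E m) (ε : ℝ) (M M' : ℕ → ℝ) (t : ℕ)
    (h1 : 1 < t) (h : M (t + 1) = M' (t + 1)) :
    (convexParams P Q ε M).AgreeAt (convexParams P Q ε M') t := by
  have hN : (convexParams P Q ε M).N t = (convexParams P Q ε M').N t := by
    funext s q
    simp only [convexParams, h1.ne', if_false, h]
  refine ⟨hN, rfl, ?_, ?_⟩
  · funext s q k
    have := congrFun₂ hN s q
    simp only [convexParams, h1.ne', if_false, h]
  · funext s q k
    simp only [convexParams, h1.ne', if_false, h]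

theorem strongParams_agreeAt (P : Problem S E m) (Q : Method S E m) (μ : ℕ → ℝ) (ε : ℝ)
    (M M' : ℕ → ℝ) (t : ℕ) (h1 : 1 < t) (h : M (t + 1) = M' (t + 1)) :
    (strongParams P Q μ ε M).AgreeAt (strongParams P Q μ ε M') t := by
  refine ⟨?_, rfl, rfl, ?_⟩
  · funext s q
    simp only [strongParams, h1.ne', if_false, h]
  · funext s q k
    simp only [strongParams, h1.ne', if_false, h]

end DSA

end

/-! ### Both parameter choices inserted into the general analysis. -/

theorem mainTheorem3
    {S : ℕ → Type*} [∀ t, MeasurableSpace (S t)]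
    {E : ℕ → Type*} [∀ t, NormedAddCommGroup (E t)] [∀ t, NormedSpace ℝ (E t)]
    [∀ t, FiniteDimensional ℝ (E t)] [∀ t, MeasurableSpace (E t)] [∀ t, BorelSpace (E t)]
    {m : ℕ → ℕ} (P : DSA.Problem S E m) (Q : DSA.Method S E m)
    (hT : 3 ≤ P.T) (hP : P.Regular) (hQ : P.Admissible Q) (ε : ℝ) (hε : 0 < ε) :
    ((P.BoundedDuals Q →
        ∃ M : ℕ → ℝ, DSA.ValidConstants P Q (DSA.convexParams P Q ε M) M) ∧
      ∀ M : ℕ → ℝ, DSA.ValidConstants P Q (DSA.convexParams P Q ε M) M →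
        DSA.FindsSolution P Q (DSA.convexParams P Q ε M) ε) ∧
    ∀ μ : ℕ → ℝ, P.StronglyConvex μ →
      ((P.BoundedDuals Q →
          ∃ M : ℕ → ℝ, DSA.ValidConstants P Q (DSA.strongParams P Q μ ε M) M) ∧
        ∀ M : ℕ → ℝ, DSA.ValidConstants P Q (DSA.strongParams P Q μ ε M) M →
          DSA.FindsSolution P Q (DSA.strongParams P Q μ ε M) ε) := by
  have h1T : 1 < P.T := by omega
  refine ⟨⟨fun hbd => ?_, fun M hM => ?_⟩, fun μ hμ => ⟨fun hbd => ?_, fun M hM => ?_⟩⟩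
  · exact DSA.Problem.exists_validConstants hP hQ hε (par := fun M => DSA.convexParams P Q ε M)
      (DSA.Problem.measurable_convexParams hP hQ ε) (DSA.convexParams_agreeAt P Q ε)
      (fun t _ _ => Filter.Eventually.of_forall fun s => P.modulusAt_zero t s) hbd
      (fun M t h1 h2 h3 => DSA.Problem.innerFits_convexParams hP hT hε h1 h2 h3)
      (fun M t h1 h2 h3 => DSA.Problem.dualFits_convexParams hP hT hε h1 h2 h3)
  · exact DSA.Problem.findsSolution_of_fits hT hP hQ
      (DSA.Problem.measurable_convexParams hP hQ ε M) hε
      (fun t _ _ => Filter.Eventually.of_forall fun s => P.modulusAt_zero t s) hM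
      (fun t h1 h2 => DSA.Problem.innerFits_convexParams hP hT hε h1 h2
        fun h => (hM t h1.le h).1)
      (DSA.Problem.outerFits_convexParams hP hT hε (hM 1 le_rfl h1T).1 _ _)
  · exact DSA.Problem.exists_validConstants hP hQ hε (par := fun M => DSA.strongParams P Q μ ε M)
      (DSA.Problem.measurable_strongParams hP hQ μ ε) (DSA.strongParams_agreeAt P Q μ ε)
      (fun t h1 h2 => (hμ t h1 h2).2.mono fun s hs => ⟨(hμ t h1 h2).1.le, hs⟩) hbd
      (fun M t h1 h2 _ => DSA.Problem.innerFits_strongParams hP hε h1 h2 (hμ t h1.le h2).1)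
      (fun M t h1 h2 _ => DSA.Problem.dualFits_strongParams hP hε h1 h2 (hμ t h1.le h2).1)
  · exact DSA.Problem.findsSolution_of_fits hT hP hQ
      (DSA.Problem.measurable_strongParams hP hQ μ ε M) hε
      (fun t h1 h2 => (hμ t h1 h2).2.mono fun s hs => ⟨(hμ t h1 h2).1.le, hs⟩) hM
      (fun t h1 h2 => DSA.Problem.innerFits_strongParams hP hε h1 h2 (hμ t h1.le h2).1)
      (DSA.Problem.outerFits_strongParams hP hT hε (hM 1 le_rfl h1T).1 (hμ 1 le_rfl h1T.le).1 _ _)
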